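/- **Theorem.** There is an example of two Riemannian manifolds with isometric boundaries and identical lens data, but different $C^1$ jets at the boundary. It is given by the following construction. *Profiles.* Call a smooth function $f_1:[0,14]\to\mathbb R$ an admissible profile if $f_1(x)=x+1$ for $0\le x\le 1$; $f_1'(x)>0$ for $x\in[1,3)$ and $f_1'(3)=0$; $f_1(3+t)=f_1(3-t)$ for $t\in[0,1]$; $f_1'(x)<0$ for $x\in(3,6)$; $f_1(x)=1$ for $6\le x\le 7$; and $f_1(7+t)=f_1(7-t)$ for $t\in[0,7]$. For $y\ge 1$ let $H(y)$ be the Lebesgue measure of $\{x\in[0,6] : f_1(x)\ge y\}$. A central lineup of $f_1$ is a function $f_2$ on $[0,14]$ such that, for $x\in[0,3)$ and $y\ge 1$, $f_2(x)=y$ if and only if $x=3-H(y)/2$; $f_2(3)=f_1(3)$; $f_2(3+t)=f_2(3-t)$ for $t\in[0,3]$; $f_2(x)=1$ for $x\in[6,7]$; and $f_2(7+t)=f_2(7-t)$ for $t\in[0,7]$. *Surfaces.* Let $\ell>0$. Let $M$ be the strip $\mathbb R\times[0,14]$, or the cylinder obtained from it as the quotient by the slide $(x,y)\mapsto(x+\ell,y)$,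 or the Möbius band obtained as the quotient by the glide reflection $(x,y)\mapsto(x+\ell,14-y)$. *Lens equivalence.* Let $g_1,g_2$ be Riemannian metrics on a manifold $M$ with boundary. For $g=g_i$ let $\nu$ be the inward unit normal, and let $\Omega'_g$ be the set of triples $(\xi,\eta,T)$, $T>0$, such that for some unit speed geodesic $\gamma$ with $\gamma(0)\in\partial M$ and $\langle\gamma'(0),\nu\rangle>0$ that hits $\partial M$ again for the first time at time $T$, $\xi$ and $\eta$ are the orthogonal projections of $\gamma'(0)$ and $\gamma'(T)$ to $T\partial M$. Let $\tau_g$ be the distance function of $(M,g)$ (infimum of lengths of paths in $M$). Then $(M,g_1)$ and $(M,g_2)$ are lens equivalent if $g_1$ and $g_2$ induce the same metric on $\partial M$, $\Omega'_{g_1}=\Omega'_{g_2}$, and $\tau_{g_1}=\tau_{g_2}$ on $\partial M\times\partial M$. They have the same $C^1$ jet at $p\in\partial M$ if, in boundary normal coordinates for $g_1$ and for $g_2$ that restrict to the same coordinates on $\partial M$, the metric coefficients and their first derivatives in the normal direction agree at $p$. *Claim.* Admissible profiles exist. For every admissible profile $f_1$ there is exactly one central lineup $f_2$ on $[0,14]$,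 and $f_2$ is smooth on $[0,14]$. For every $\ell>0$ and each of the three surfaces $M$, which is a smooth connected surface with boundary, compact for the cylinder and the Möbius band, and with connected boundary for the Möbius band, the metrics $$f_1(y)\,dx^2+dy^2,\qquad f_2(y)\,dx^2+dy^2$$ descend to smooth Riemannian metrics $g_1,g_2$ on $M$ such that 1. $(M,g_1)$ and $(M,g_2)$ are lens equivalent; 2. at every boundary point, the second fundamental form of $\partial M$ with respect to the inward unit normal is negative definite for $g_1$ (the boundary is strictly concave) and vanishes for $g_2$ (the boundary is totally geodesic); 3. at every boundary point, $g_1$ and $g_2$ have different $C^1$ jets. -/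

import Mathlib

open Set Filter Topology Manifold Bundle
open scoped ContDiff ENNReal

noncomputable section

/-! ### Riemannian manifolds with boundary

Manifolds with boundary are modelled on the half-space `{x ∈ ℝⁿ | 0 ≤ x 0}` through Mathlib's model
`𝓡∂ n`, so the coordinate with index `0` is the one transversal to the boundary. -/

/-- A smooth Riemannian metric on a smooth manifold with boundary. -/
abbrev SmoothMetric (n : ℕ) [NeZero n] (M : Type*) [TopologicalSpace M]
    [ChartedSpace (EuclideanHalfSpace n) M] [IsManifold (𝓡∂ n) ∞ M] :=
  ContMDiffRiemannianMetric (𝓡∂ n) ∞ (EuclideanSpace ℝ (Fin n))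
    (fun x : M => TangentSpace (𝓡∂ n) x)

section Geometry

variable {n : ℕ} [NeZero n] {M : Type*} [TopologicalSpace M]
  [ChartedSpace (EuclideanHalfSpace n) M] [IsManifold (𝓡∂ n) ∞ M]

/-- The distance function of the metric `g`: the infimum of the lengths of `C¹` paths in `M`. Such
paths may touch or follow the boundary. -/
def metricDist (g : SmoothMetric n M) (x y : M) : ℝ≥0∞ :=
  letI : RiemannianBundle (fun x : M => TangentSpace (𝓡∂ n) x) := ⟨g.toRiemannianMetric⟩
  riemannianEDist (𝓡∂ n) x y

/-- The coefficients of the metric `g` in the chart `e`: the value at `y` of the pullback of `g`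
under the inverse of the chart, on the vectors `u` and `v` of the model space. -/
def coordMetric (g : SmoothMetric n M) (e : OpenPartialHomeomorph M (EuclideanHalfSpace n))
    (y u v : EuclideanSpace ℝ (Fin n)) : ℝ :=
  g.inner ((e.extend (𝓡∂ n)).symm y)
    (mfderivWithin 𝓘(ℝ, EuclideanSpace ℝ (Fin n)) (𝓡∂ n) (e.extend (𝓡∂ n)).symm (range (𝓡∂ n)) y u)
    (mfderivWithin 𝓘(ℝ, EuclideanSpace ℝ (Fin n)) (𝓡∂ n) (e.extend (𝓡∂ n)).symm (range (𝓡∂ n)) y v)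

/-- The derivative `D_w (g(u, v))` at `y` of a metric coefficient in the chart `e` (one-sided at
points of the boundary). -/
def coordMetricDeriv (g : SmoothMetric n M) (e : OpenPartialHomeomorph M (EuclideanHalfSpace n))
    (y w u v : EuclideanSpace ℝ (Fin n)) : ℝ :=
  fderivWithin ℝ (fun z => coordMetric g e z u v) (range (𝓡∂ n)) y w

/-- The Christoffel symbols of the first kind in the chart `e`: `⟨∇_u v, w⟩` for the vector fields
`u`, `v`, `w` with constant coefficients in the chart, `∇` being the Levi-Civita connection. -/
def christoffelFirst (g : SmoothMetric n M) (e : OpenPartialHomeomorph M (EuclideanHalfSpace n))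
    (y u v w : EuclideanSpace ℝ (Fin n)) : ℝ :=
  (coordMetricDeriv g e y u v w + coordMetricDeriv g e y v u w - coordMetricDeriv g e y w u v) / 2

/-- The coordinate with index `0` of a tangent vector in the preferred chart at `x`. At a boundary
point `x` it is zero for the vectors tangent to the boundary and positive for those that point
inwards. -/
def normalCoord {x : M} (v : TangentSpace (𝓡∂ n) x) : ℝ :=
  (show EuclideanSpace ℝ (Fin n) from v) 0

/-- The tangent space at the boundary point `x` of the boundary, inside the tangent space of `M`. -/
def boundaryTangent (x : M) : Set (TangentSpace (𝓡∂ n) x) :=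
  {v | normalCoord v = 0}

/-- `ν` is the inward-pointing unit normal vector at the boundary point `x`. -/
def IsInwardUnitNormal (g : SmoothMetric n M) (x : M) (ν : TangentSpace (𝓡∂ n) x) : Prop :=
  g.inner x ν ν = 1 ∧ (∀ u ∈ boundaryTangent x, g.inner x ν u = 0) ∧
    0 < normalCoord ν

/-- The second fundamental form `⟨∇_u v, ν⟩` of the boundary at the boundary point `x`, with respect
to the unit normal `ν`, on vectors `u`, `v` tangent to the boundary. In the preferred chart the
boundary is flat, so `u` and `v` extend with constant coefficients to fields tangent to it. -/
def secondFundamentalForm (g : SmoothMetric n M) (x : M) (ν u v : TangentSpace (𝓡∂ n) x) : ℝ :=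
  christoffelFirst g (chartAt (EuclideanHalfSpace n) x) (extChartAt (𝓡∂ n) x x) u v ν

/-- The boundary is strictly concave at `x`: its second fundamental form with respect to the
inward-pointing unit normal is negative definite. -/
def IsStrictlyConcaveAt (g : SmoothMetric n M) (x : M) : Prop :=
  ∃ ν, IsInwardUnitNormal g x ν ∧
    ∀ u ∈ boundaryTangent x, u ≠ 0 → secondFundamentalForm g x ν u u < 0

/-- The second fundamental form of the boundary vanishes at `x`. The boundary is totally geodesic if
this holds at all its points. -/
def IsTotallyGeodesicAt (g : SmoothMetric n M) (x : M) : Prop :=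
  ∃ ν, IsInwardUnitNormal g x ν ∧
    ∀ u ∈ boundaryTangent x, ∀ v ∈ boundaryTangent x, secondFundamentalForm g x ν u v = 0

/-! ### The `C¹` jet at the boundary -/

/-- The smooth chart `e` gives boundary normal coordinates for `g`: the coordinate lines transversal
to the boundary are unit speed and orthogonal to the slices, that is `g_{0j} = δ_{0j}` (which makes
these lines geodesics that leave the boundary perpendicularly). -/
def IsBoundaryNormalChart (g : SmoothMetric n M)
    (e : OpenPartialHomeomorph M (EuclideanHalfSpace n)) : Prop :=
  e ∈ IsManifold.maximalAtlas (𝓡∂ n) ∞ M ∧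
    ∀ y ∈ (e.extend (𝓡∂ n)).target, ∀ v, coordMetric g e y (EuclideanSpace.single 0 1) v = v 0

/-- The metrics `g₁` and `g₂` have the same `C¹` jet at the boundary point `x`: in boundary normal
coordinates for the one and for the other that restrict to the same coordinates on the boundary, the
metric coefficients and their first derivatives in the normal direction agree at `x`. -/
def SameC1JetAt (g₁ g₂ : SmoothMetric n M) (x : M) : Prop :=
  ∀ e₁ e₂ : OpenPartialHomeomorph M (EuclideanHalfSpace n),
    IsBoundaryNormalChart g₁ e₁ → IsBoundaryNormalChart g₂ e₂ → x ∈ e₁.source → x ∈ e₂.source →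
    (∀ᶠ z in 𝓝[(𝓡∂ n).boundary M] x, e₁ z = e₂ z) →
    ∀ u v : EuclideanSpace ℝ (Fin n),
      coordMetric g₁ e₁ (e₁.extend (𝓡∂ n) x) u v = coordMetric g₂ e₂ (e₂.extend (𝓡∂ n) x) u v ∧
      coordMetricDeriv g₁ e₁ (e₁.extend (𝓡∂ n) x) (EuclideanSpace.single 0 1) u v =
        coordMetricDeriv g₂ e₂ (e₂.extend (𝓡∂ n) x) (EuclideanSpace.single 0 1) u v

/-! ### Geodesics and lens data -/

/-- The velocity at time `t` of a curve defined on `[0, T]` (one-sided at the end points). -/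
def velocity (γ : ℝ → M) (T t : ℝ) : TangentSpace (𝓡∂ n) (γ t) :=
  mfderivWithin 𝓘(ℝ, ℝ) (𝓡∂ n) γ (Icc 0 T) t (1 : ℝ)

/-- `γ` is a unit speed geodesic of `g` on `[0, T]`. At the time `t` the geodesic equation
`⟨c'' + Γ(c', c'), w⟩ = 0` (for all `w`) is written for the coordinate representation `c` of `γ` in
the preferred chart at `γ t`. -/
def IsUnitSpeedGeodesic (g : SmoothMetric n M) (γ : ℝ → M) (T : ℝ) : Prop :=
  ContMDiffOn 𝓘(ℝ, ℝ) (𝓡∂ n) 2 γ (Icc 0 T) ∧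
  ∀ t ∈ Icc 0 T, g.inner (γ t) (velocity γ T t) (velocity γ T t) = 1 ∧
    let e := chartAt (EuclideanHalfSpace n) (γ t)
    let c : ℝ → EuclideanSpace ℝ (Fin n) := fun s => e.extend (𝓡∂ n) (γ s)
    let c' := derivWithin c (Icc 0 T)
    let c'' := derivWithin c' (Icc 0 T)
    ∀ w, coordMetric g e (c t) (c'' t) w + christoffelFirst g e (c t) (c' t) (c' t) w = 0

/-- `u` is the orthogonal projection of `v` to the tangent space of the boundary at `x`. -/
def IsBoundaryProjection (g : SmoothMetric n M) (x : M) (v u : TangentSpace (𝓡∂ n) x) : Prop :=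
  u ∈ boundaryTangent x ∧ ∀ w ∈ boundaryTangent x, g.inner x (v - u) w = 0

/-- The set `Ω'` of all triples `(ξ, η, T)` where, for some unit speed geodesic `γ` that starts at a
boundary point with inward-pointing velocity and hits the boundary again for the first time at the
time `T`, `ξ` and `η` are the orthogonal projections to the tangent spaces of the boundary of the
velocities of `γ` at the times `0` and `T`. -/
def lensRelation (g : SmoothMetric n M) :
    Set (TangentBundle (𝓡∂ n) M × TangentBundle (𝓡∂ n) M × ℝ) :=
  {q | ∃ (γ : ℝ → M) (T : ℝ) (u : TangentSpace (𝓡∂ n) (γ 0)) (v : TangentSpace (𝓡∂ n) (γ T)),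
    q = (⟨γ 0, u⟩, ⟨γ T, v⟩, T) ∧ 0 < T ∧ IsUnitSpeedGeodesic g γ T ∧
    γ 0 ∈ (𝓡∂ n).boundary M ∧ γ T ∈ (𝓡∂ n).boundary M ∧
    (∀ t ∈ Ioo 0 T, γ t ∉ (𝓡∂ n).boundary M) ∧
    (∃ ν, IsInwardUnitNormal g (γ 0) ν ∧ 0 < g.inner (γ 0) (velocity γ T 0) ν) ∧
    IsBoundaryProjection g (γ 0) (velocity γ T 0) u ∧
    IsBoundaryProjection g (γ T) (velocity γ T T) v}

/-- The Riemannian manifolds `(M, g₁)` and `(M, g₂)` have the same boundary as Riemannian manifolds: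
`g₁` and `g₂` induce the same metric on the boundary. -/
def SameBoundary (g₁ g₂ : SmoothMetric n M) : Prop :=
  ∀ x ∈ (𝓡∂ n).boundary M, ∀ u ∈ boundaryTangent x, ∀ v ∈ boundaryTangent x,
    g₁.inner x u v = g₂.inner x u v

/-- `(M, g₁)` and `(M, g₂)` are lens equivalent: they have the same boundary, the same `Ω'` and the
same distances between boundary points. -/
def LensEquivalent (g₁ g₂ : SmoothMetric n M) : Prop :=
  SameBoundary g₁ g₂ ∧ lensRelation g₁ = lensRelation g₂ ∧
  ∀ x ∈ (𝓡∂ n).boundary M, ∀ y ∈ (𝓡∂ n).boundary M, metricDist g₁ x y = metricDist g₂ x y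

end Geometry

/-! ### The profiles -/

/-- The admissible profiles on `[0, 14]`. -/
structure IsProfile (f : ℝ → ℝ) : Prop where
  smooth : ContDiffOn ℝ ∞ f (Icc 0 14)
  linear : ∀ x ∈ Icc (0 : ℝ) 1, f x = x + 1
  increasing : ∀ x ∈ Ico (1 : ℝ) 3, 0 < derivWithin f (Icc 0 14) x
  peak : derivWithin f (Icc 0 14) 3 = 0
  peak_symm : ∀ t ∈ Icc (0 : ℝ) 1, f (3 + t) = f (3 - t)
  decreasing : ∀ x ∈ Ioo (3 : ℝ) 6, derivWithin f (Icc 0 14) x < 0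
  flat : ∀ x ∈ Icc (6 : ℝ) 7, f x = 1
  symm : ∀ t ∈ Icc (0 : ℝ) 7, f (7 + t) = f (7 - t)

/-- `H(y)`, the Lebesgue measure of `{x ∈ [0, 6] | f x ≥ y}`. -/
def superlevelMeasure (f : ℝ → ℝ) (y : ℝ) : ℝ :=
  (MeasureTheory.volume {x ∈ Icc (0 : ℝ) 6 | y ≤ f x}).toReal

/-- `f₂` is the symmetric rearrangement (horizontal central lineup) of `f₁` on `[0, 14]`. -/
structure IsCentralLineup (f₁ f₂ : ℝ → ℝ) : Prop where
  rearrange : ∀ x ∈ Ico (0 : ℝ) 3, ∀ y ∈ Ici (1 : ℝ),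
    f₂ x = y ↔ x = 3 - superlevelMeasure f₁ y / 2
  peak : f₂ 3 = f₁ 3
  peak_symm : ∀ t ∈ Icc (0 : ℝ) 3, f₂ (3 + t) = f₂ (3 - t)
  flat : ∀ x ∈ Icc (6 : ℝ) 7, f₂ x = 1
  symm : ∀ t ∈ Icc (0 : ℝ) 7, f₂ (7 + t) = f₂ (7 - t)

/-! ### The strip, its quotients and the warped metrics -/

/-- The strip `ℝ × [0, 14]`. -/
def strip : Set (ℝ × ℝ) := univ ×ˢ Icc 0 14

/-- The surfaces covered by the strip: the strip itself, the cylinder, the Möbius band. -/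
inductive StripSurface where
  | strip
  | cylinder
  | moebius

/-- The equivalence relation on the strip that defines the surface: equality for the strip, the
orbits of the slide `(x, y) ↦ (x + ℓ, y)` for the cylinder, the orbits of the glide reflection
`(x, y) ↦ (x + ℓ, 14 - y)` for the Möbius band. -/
def StripSurface.rel (ℓ : ℝ) : StripSurface → ℝ × ℝ → ℝ × ℝ → Prop
  | .strip, p, q => q = p
  | .cylinder, p, q => ∃ k : ℤ, q = (p.1 + k * ℓ, p.2)
  | .moebius, p, q => ∃ k : ℤ, (Even k ∧ q = (p.1 + k * ℓ, p.2)) ∨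
      (Odd k ∧ q = (p.1 + k * ℓ, 14 - p.2))

section Strip

variable {M : Type*} [TopologicalSpace M] [ChartedSpace (EuclideanHalfSpace 2) M]

/-- The derivative at `p` of a map from the strip to `M`. -/
def stripDeriv (ψ : ℝ × ℝ → M) (p : ℝ × ℝ) : ℝ × ℝ →L[ℝ] TangentSpace (𝓡∂ 2) (ψ p) :=
  mfderivWithin 𝓘(ℝ, ℝ × ℝ) (𝓡∂ 2) ψ strip p

/-- `ψ` exhibits the surface with boundary `M` as the smooth quotient of the strip by `r`. -/
structure IsStripQuotient (r : ℝ × ℝ → ℝ × ℝ → Prop) (ψ : ℝ × ℝ → M) : Prop where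
  smooth : ContMDiffOn 𝓘(ℝ, ℝ × ℝ) (𝓡∂ 2) ∞ ψ strip
  bijective_deriv : ∀ p ∈ strip, Function.Bijective (stripDeriv ψ p)
  quotient : IsQuotientMap (strip.domRestrict ψ)
  fibers : ∀ p ∈ strip, ∀ q ∈ strip, ψ p = ψ q ↔ r p q
  boundary : ∀ p ∈ strip, ψ p ∈ (𝓡∂ 2).boundary M ↔ p.2 = 0 ∨ p.2 = 14

/-- The pullback of `g` to the strip is the warped metric `g_xx = f(y)`, `g_xy = 0`, `g_yy = 1`. -/
def IsWarpedMetric [IsManifold (𝓡∂ 2) ∞ M] (f : ℝ → ℝ) (ψ : ℝ × ℝ → M) (g : SmoothMetric 2 M) :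
    Prop :=
  ∀ p ∈ strip, ∀ v w : ℝ × ℝ,
    g.inner (ψ p) (stripDeriv ψ p v) (stripDeriv ψ p w) = f p.2 * v.1 * w.1 + v.2 * w.2

end Strip

end

/-!
Why the two metrics have the same lens data, but different jets.

*Geodesics.* Let `f ≥ 1` be symmetric about `7`, with `f 0 = 1` and equal to `1` near the middle of the strip
(`IsWarp`). A unit speed geodesic of `f(y) dx² + dy²` has the Clairaut constant `c = f(y) x'`, and
`y'² = 1 - c² / f(y)`. If it enters the strip from the boundary, then `c² < 1`, so `y'` never vanishes: the
geodesic crosses the strip and leaves on the other side with the same tangential component `c`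
(`IsStripGeodesic.cross`). Its travel time `∫ (1 - c²/f)^(-1/2) dy` and its displacement
`∫ (c/f) (1 - c²/f)^(-1/2) dy` are integrals of functions of `f`, and such integrals do not change when
`f` is replaced by an equimeasurable function. Hence `Ω'` is the same for `f₁` and for its symmetric
rearrangement `f₂` (`IsHalfLineup.crossTime_eq`, `IsHalfLineup.crossShift_eq`).

*Distances.* Two points on the same boundary line are joined most cheaply along the boundary, since `f ≥ 1`
with equality there. For points on opposite lines, the closed form `c dx + (1 - c²/f)^(1/2) dy` has norm
at most one, so it calibrates the crossing geodesic with constant `c` (`crossTime_le_integral`). Every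
displacement occurs for some `c`, because on the flat part of `f` the displacement tends to infinity as
`c` tends to one (`IsWarp.exists_crossShift_eq`). So the boundary distances, too, depend only on the
crossing times and displacements.

*The rearrangement.* Half a profile rises from height `1` at `0` to its maximum at `3` and falls back to `1`
at `6`. Let `σ s` be the point of the rising branch at the height of the point `6 - s` of the falling one.
As the slope of the rising branch is positive and the profile is even near `3`, this is a smooth monotone
function of `s`, so `X s = (s + σ s)/2` is a change of variables with `X' ≥ 1/2`, and the rearrangement
is given by `f₂ (X s) = f₁ (6 - s)` for `s ≤ 3` (`IsHalfProfile.exists_isHalfLineup`). Hence `f₂` is smooth,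
and its derivative at `0` vanishes with that of `f₁` at `6`, while `f₁' = 1` at `0`. The second fundamental
form of the boundary and the normal derivatives of the metric coefficients show this difference.

*The surfaces.* All three are quotients of the strip by a group of slides and glide reflections. The charts
are inverses of the projection composed with a reflection, so every transition map is a translation
combined with a reflection, every chart is a boundary normal chart, and the metric has the same
coefficients in all of them. As the projection is a covering map, geodesics and paths lift to the strip
(`QuotientSurface.exists_lift`), where the one-dimensional computations above apply.
-/

noncomputable section

/-! ### Half profiles -/

/-- The left half of a profile, extended to the whole line: it is `x + 1` to the left of `1`, has a
single peak at `3`, near which it is even, and is constantly `1` from `6` on. -/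
structure IsHalfProfile (P : ℝ → ℝ) : Prop where
  smooth : ContDiff ℝ ∞ P
  linear : ∀ x ≤ 1, P x = x + 1
  increasing : ∀ x < 3, 0 < deriv P x
  peak_symm : ∀ t ∈ Icc (0 : ℝ) 1, P (3 + t) = P (3 - t)
  decreasing : ∀ x ∈ Ioo (3 : ℝ) 6, deriv P x < 0
  flat : ∀ x ≥ 6, P x = 1

/-- For `P` equal to `1` on `[6, ∞)`, the function that is `P` on `[0, 7]` and even around `7`. -/
def mirror (P : ℝ → ℝ) (x : ℝ) : ℝ := P x + P (14 - x) - 1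

theorem mirror_of_le {P : ℝ → ℝ} (h : ∀ x ≥ 6, P x = 1) {x : ℝ} (hx : x ≤ 8) :
    mirror P x = P x := by
  rw [mirror, h (14 - x) (by linarith)]; ring

theorem mirror_symm (P : ℝ → ℝ) (x : ℝ) : mirror P (14 - x) = mirror P x := by
  rw [mirror, mirror, sub_sub_cancel]; ring

theorem contDiff_mirror {P : ℝ → ℝ} (h : ContDiff ℝ ∞ P) : ContDiff ℝ ∞ (mirror P) := by
  unfold mirror; fun_prop

theorem hasDerivAt_mirror {P : ℝ → ℝ} (h : ∀ x ≥ 6, P x = 1) (hP : ContDiff ℝ ∞ P) {x : ℝ}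
    (hx : x < 8) : HasDerivAt (mirror P) (deriv P x) x := by
  have h1 : HasDerivAt P (deriv P x) x :=
    ((hP.differentiable (by simp)) x).hasDerivAt
  refine h1.congr_of_eventuallyEq ?_
  filter_upwards [Iio_mem_nhds hx] with y hy using mirror_of_le h (le_of_lt hy)

namespace IsHalfProfile

variable {P : ℝ → ℝ} (hP : IsHalfProfile P)
include hP

theorem differentiable : Differentiable ℝ P := hP.smooth.differentiable (by simp)

theorem symm_of_mem {x : ℝ} (hx : x ∈ Icc (2 : ℝ) 4) : P (6 - x) = P x := by
  rcases le_total x 3 with h | h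
  · have := hP.peak_symm (3 - x) ⟨by linarith, by linarith [hx.1]⟩
    rw [show 3 + (3 - x) = 6 - x by ring, show 3 - (3 - x) = x by ring] at this
    exact this
  · have := hP.peak_symm (x - 3) ⟨by linarith, by linarith [hx.2]⟩
    rw [show 3 + (x - 3) = x by ring, show 3 - (x - 3) = 6 - x by ring] at this
    exact this.symm

theorem deriv_three : deriv P 3 = 0 := by
  have h1 : HasDerivAt P (deriv P 3) 3 := (hP.differentiable 3).hasDerivAt
  have h2 : HasDerivAt (fun x => P (6 - x)) (-deriv P 3) 3 := by
    have h3 : HasDerivAt P (deriv P 3) (6 - 3) := by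
      rw [show (6 : ℝ) - 3 = 3 by norm_num]; exact h1
    simpa using h3.comp_const_sub 6 3
  have h4 : (fun x => P (6 - x)) =ᶠ[𝓝 3] P := by
    filter_upwards [Icc_mem_nhds (by norm_num : (2 : ℝ) < 3) (by norm_num : (3 : ℝ) < 4)] with x hx
      using hP.symm_of_mem hx
  have := h2.unique (h1.congr_of_eventuallyEq h4)
  linarith

theorem strictMonoOn : StrictMonoOn P (Iic 3) :=
  strictMonoOn_of_deriv_pos (convex_Iic 3) hP.smooth.continuous.continuousOn
    (by simpa using hP.increasing)

theorem strictAntiOn : StrictAntiOn P (Icc 3 6) :=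
  strictAntiOn_of_deriv_neg (convex_Icc 3 6) hP.smooth.continuous.continuousOn
    (by simpa using hP.decreasing)

theorem one_le {x : ℝ} (hx : 0 ≤ x) : 1 ≤ P x := by
  rcases le_total x 3 with h | h
  · have := hP.strictMonoOn.monotoneOn (by simp : (0 : ℝ) ∈ Iic 3) (by simpa using h) hx
    rw [hP.linear 0 (by norm_num)] at this
    linarith
  · rcases le_total x 6 with h' | h'
    · have := hP.strictAntiOn.antitoneOn (⟨h, h'⟩ : x ∈ Icc (3 : ℝ) 6)
        (⟨by norm_num, le_rfl⟩ : (6 : ℝ) ∈ Icc (3 : ℝ) 6) h'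
      rwa [hP.flat 6 le_rfl] at this
    · exact (hP.flat x h').ge

theorem isProfile_mirror : IsProfile (mirror P) := by
  have hd : ∀ x ∈ Icc (0 : ℝ) 7, derivWithin (mirror P) (Icc 0 14) x = deriv P x := fun x hx =>
    (hasDerivAt_mirror hP.flat hP.smooth (by linarith [hx.2])).hasDerivWithinAt.derivWithin
      (uniqueDiffOn_Icc (by norm_num) x ⟨hx.1, by linarith [hx.2]⟩)
  have he : ∀ x ≤ (8 : ℝ), mirror P x = P x := fun x => mirror_of_le hP.flat
  refine ⟨(contDiff_mirror hP.smooth).contDiffOn, ?_, ?_, ?_, ?_, ?_, ?_, ?_⟩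
  · intro x hx
    rw [he x (by linarith [hx.2]), hP.linear x hx.2]
  · intro x hx
    rw [hd x ⟨by linarith [hx.1], by linarith [hx.2]⟩]
    exact hP.increasing x hx.2
  · rw [hd 3 (by norm_num), hP.deriv_three]
  · intro t ht
    rw [he _ (by linarith [ht.2]), he _ (by linarith [ht.1]), hP.peak_symm t ht]
  · intro x hx
    rw [hd x ⟨by linarith [hx.1], by linarith [hx.2]⟩]
    exact hP.decreasing x hx
  · intro x hx
    rw [he x (by linarith [hx.2]), hP.flat x hx.1]
  · intro t _
    rw [← mirror_symm P (7 + t)]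
    congr 1; ring

end IsHalfProfile

/-- Every profile is the mirror of a half profile; in particular it extends smoothly to the line. -/
theorem IsProfile.exists_isHalfProfile {f : ℝ → ℝ} (hf : IsProfile f) :
    ∃ P, IsHalfProfile P ∧ EqOn f (mirror P) (Icc 0 14) := by
  set P : ℝ → ℝ := fun x => if x ≤ 1 / 2 then x + 1 else if x ≤ 13 / 2 then f x else 1 with hPdef
  have h1 : ∀ x ≤ 1, P x = x + 1 := by
    intro x hx
    simp only [hPdef]
    split_ifs with h h'
    · rfl
    · exact hf.linear x ⟨by linarith, hx⟩
    · linarith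
  have h2 : ∀ x ∈ Icc (0 : ℝ) 7, P x = f x := by
    intro x hx
    simp only [hPdef]
    split_ifs with h h'
    · exact (hf.linear x ⟨hx.1, by linarith⟩).symm
    · rfl
    · exact (hf.flat x ⟨by linarith, hx.2⟩).symm
  have h3 : ∀ x ≥ 6, P x = 1 := by
    intro x hx
    simp only [hPdef]
    split_ifs with h h'
    · linarith
    · exact hf.flat x ⟨hx, by linarith⟩
    · rfl
  have hev : ∀ x ∈ Ioo (0 : ℝ) 7, P =ᶠ[𝓝 x] f := fun x hx => by
    filter_upwards [Ioo_mem_nhds hx.1 hx.2] with y hy using h2 y (Ioo_subset_Icc_self hy)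
  have hd : ∀ x ∈ Ioo (0 : ℝ) 7, deriv P x = derivWithin f (Icc 0 14) x := fun x hx => by
    rw [(hev x hx).deriv_eq, derivWithin_of_mem_nhds (Icc_mem_nhds hx.1 (by linarith [hx.2]))]
  have hlin : ∀ x < 1, P =ᶠ[𝓝 x] fun x => x + 1 := fun x hx => by
    filter_upwards [Iio_mem_nhds hx] with y hy using h1 y (le_of_lt hy)
  refine ⟨P, ⟨?_, h1, ?_, ?_, ?_, h3⟩, ?_⟩
  · rw [contDiff_iff_contDiffAt]
    intro x
    rcases lt_or_ge x 1 with hx | hx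
    · exact (contDiffAt_id.add contDiffAt_const).congr_of_eventuallyEq (hlin x hx)
    rcases lt_or_ge x 7 with hx' | hx'
    · exact (hf.smooth.contDiffAt (Icc_mem_nhds (by linarith) (by linarith))).congr_of_eventuallyEq
        (hev x ⟨by linarith, hx'⟩)
    · refine (contDiffAt_const (c := (1 : ℝ))).congr_of_eventuallyEq ?_
      filter_upwards [Ioi_mem_nhds (by linarith : 6 < x)] with y hy using h3 y (le_of_lt hy)
  · intro x hx
    rcases lt_or_ge x 1 with hx' | hx'
    · rw [(hlin x hx').deriv_eq]; simp
    · rw [hd x ⟨by linarith, by linarith⟩]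
      exact hf.increasing x ⟨hx', hx⟩
  · intro t ht
    rw [h2 _ ⟨by linarith [ht.1], by linarith [ht.2]⟩, h2 _ ⟨by linarith [ht.2], by linarith [ht.1]⟩,
      hf.peak_symm t ht]
  · intro x hx
    rw [hd x ⟨by linarith [hx.1], by linarith [hx.2]⟩]
    exact hf.decreasing x hx
  · intro x hx
    rcases le_total x 7 with h | h
    · rw [mirror_of_le h3 (by linarith), h2 x ⟨hx.1, h⟩]
    · have := hf.symm (x - 7) ⟨by linarith, by linarith [hx.2]⟩
      rw [show 7 + (x - 7) = x by ring, show 7 - (x - 7) = 14 - x by ring] at this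
      rw [← mirror_symm, mirror_of_le h3 (by linarith), this,
        h2 _ ⟨by linarith [hx.2], by linarith⟩]

/-- Half profiles exist. The derivative is prescribed: `1` up to `1`, then `3 - x` near the peak,
then negative and flat at `6`; bumps on either side of the peak balance its integral. -/
theorem exists_isHalfProfile : ∃ P, IsHalfProfile P := by
  set A : ℝ → ℝ := fun x => 1 - Real.smoothTransition (x - 1)
  set B : ℝ → ℝ := fun x => Real.smoothTransition (x - 1) * Real.smoothTransition ((6 - x) / 2)
  set h₀ : ℝ → ℝ := fun x => A x + B x * (3 - x) with hh₀
  let φ₁ : ContDiffBump (3 / 2 : ℝ) := ⟨1 / 8, 1 / 4, by norm_num, by norm_num⟩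
  let φ₂ : ContDiffBump (9 / 2 : ℝ) := ⟨1 / 8, 1 / 4, by norm_num, by norm_num⟩
  set b₁ : ℝ → ℝ := φ₁.normed MeasureTheory.volume with hb₁
  set b₂ : ℝ → ℝ := φ₂.normed MeasureTheory.volume with hb₂
  have hs₁ : Function.support b₁ = Metric.ball (3 / 2) (1 / 4) := φ₁.support_normed_eq
  have hs₂ : Function.support b₂ = Metric.ball (9 / 2) (1 / 4) := φ₂.support_normed_eq
  have hz₁ : ∀ x, x ∉ Ioo (1 : ℝ) 2 → b₁ x = 0 := by
    intro x hx
    rw [← Function.notMem_support, hs₁, Real.ball_eq_Ioo]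
    exact fun h => hx ⟨by linarith [h.1], by linarith [h.2]⟩
  have hz₂ : ∀ x, x ∉ Ioo (4 : ℝ) 5 → b₂ x = 0 := by
    intro x hx
    rw [← Function.notMem_support, hs₂, Real.ball_eq_Ioo]
    exact fun h => hx ⟨by linarith [h.1], by linarith [h.2]⟩
  have hp₁ : ∀ x, 0 ≤ b₁ x := fun x => φ₁.nonneg_normed x
  have hp₂ : ∀ x, 0 ≤ b₂ x := fun x => φ₂.nonneg_normed x
  have hc₁ : ContDiff ℝ ∞ b₁ := φ₁.contDiff_normed
  have hc₂ : ContDiff ℝ ∞ b₂ := φ₂.contDiff_normed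
  have hc₀ : ContDiff ℝ ∞ h₀ := by
    simp only [hh₀, A, B]; fun_prop
  have hi₁ : ∫ x in (0 : ℝ)..6, b₁ x = 1 := by
    rw [intervalIntegral.integral_eq_integral_of_support_subset]
    · exact φ₁.integral_normed
    · rw [hs₁, Real.ball_eq_Ioo]
      exact fun x hx => ⟨by linarith [hx.1], by linarith [hx.2]⟩
  have hi₂ : ∫ x in (0 : ℝ)..6, b₂ x = 1 := by
    rw [intervalIntegral.integral_eq_integral_of_support_subset]
    · exact φ₂.integral_normed
    · rw [hs₂, Real.ball_eq_Ioo]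
      exact fun x hx => ⟨by linarith [hx.1], by linarith [hx.2]⟩
  have hA1 : ∀ x ≤ 1, A x = 1 := fun x hx => by
    simp [A, Real.smoothTransition.zero_of_nonpos (by linarith : x - 1 ≤ 0)]
  have hA2 : ∀ x ≥ 2, A x = 0 := fun x hx => by
    simp [A, Real.smoothTransition.one_of_one_le (by linarith : 1 ≤ x - 1)]
  have hA3 : ∀ x < 2, 0 < A x := fun x hx => by
    simp [A, Real.smoothTransition.lt_one_of_lt_one (by linarith : x - 1 < 1)]
  have hB0 : ∀ x, 0 ≤ B x := fun x =>
    mul_nonneg (Real.smoothTransition.nonneg _) (Real.smoothTransition.nonneg _)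
  have hB1 : ∀ x ≤ 1, B x = 0 := fun x hx => by
    simp [B, Real.smoothTransition.zero_of_nonpos (by linarith : x - 1 ≤ 0)]
  have hB2 : ∀ x ∈ Icc (2 : ℝ) 4, B x = 1 := fun x hx => by
    simp [B, Real.smoothTransition.one_of_one_le (by linarith [hx.1] : 1 ≤ x - 1),
      Real.smoothTransition.one_of_one_le (by linarith [hx.2] : 1 ≤ (6 - x) / 2)]
  have hB3 : ∀ x ∈ Ioo (1 : ℝ) 6, 0 < B x := fun x hx =>
    mul_pos (Real.smoothTransition.pos_of_pos (by linarith [hx.1]))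
      (Real.smoothTransition.pos_of_pos (by linarith [hx.2]))
  have hB4 : ∀ x ≥ 6, B x = 0 := fun x hx => by
    simp [B, Real.smoothTransition.zero_of_nonpos (by linarith : (6 - x) / 2 ≤ 0)]
  have hpos : ∀ x < 3, 0 < h₀ x := by
    intro x hx
    rcases lt_or_ge x 2 with h | h
    · have := hA3 x h
      have := mul_nonneg (hB0 x) (by linarith : 0 ≤ 3 - x)
      simp only [hh₀]; linarith
    · have := mul_pos (hB3 x ⟨by linarith, by linarith⟩) (by linarith : 0 < 3 - x)
      simp only [hh₀, hA2 x h]; linarith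
  have hneg : ∀ x ∈ Ioo (3 : ℝ) 6, h₀ x < 0 := by
    intro x hx
    have := mul_pos (hB3 x ⟨by linarith [hx.1], hx.2⟩) (by linarith [hx.1] : 0 < x - 3)
    simp only [hh₀, hA2 x (by linarith [hx.1])]; linarith
  set l := ∫ x in (0 : ℝ)..3, h₀ x
  set r := -∫ x in (3 : ℝ)..6, h₀ x with hr
  have hl0 : 0 ≤ l := by
    refine intervalIntegral.integral_nonneg (by norm_num) fun x hx => ?_
    rcases hx.2.lt_or_eq with h | h
    · exact (hpos x h).le
    · simp [hh₀, h, hA2 3 (by norm_num)]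
  have hr0 : 0 ≤ r := by
    rw [hr, ← intervalIntegral.integral_neg]
    refine intervalIntegral.integral_nonneg (by norm_num) fun x hx => ?_
    rcases hx.1.lt_or_eq with h | h
    · rcases hx.2.lt_or_eq with h' | h'
      · linarith [hneg x ⟨h, h'⟩]
      · simp [hh₀, h', hA2 6 (by norm_num), hB4 6]
    · simp [hh₀, ← h, hA2 3 (by norm_num)]
  set h : ℝ → ℝ := fun x => h₀ x + r * b₁ x - l * b₂ x with hh
  have hch : ContDiff ℝ ∞ h := by simp only [hh]; fun_prop
  have hcont := hch.continuous
  have hint : ∀ a b, IntervalIntegrable h MeasureTheory.volume a b := fun a b =>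
    hcont.intervalIntegrable a b
  set P : ℝ → ℝ := fun x => 1 + ∫ t in (0 : ℝ)..x, h t with hP
  have hder : ∀ x, HasDerivAt P (h x) x := fun x =>
    (intervalIntegral.integral_hasDerivAt_right (hint _ _)
      (hcont.stronglyMeasurableAtFilter _ _) hcont.continuousAt).const_add 1
  have hderiv : deriv P = h := funext fun x => (hder x).deriv
  have hmid : ∀ x ∈ Icc (2 : ℝ) 4, h x = 3 - x := by
    intro x hx
    simp only [hh, hh₀]
    rw [hz₁ x (fun h => by linarith [h.2, hx.1]), hz₂ x (fun h => by linarith [h.1, hx.2]),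
      hA2 x hx.1, hB2 x hx]
    ring
  refine ⟨P, ⟨?_, ?_, ?_, ?_, ?_, ?_⟩⟩
  · rw [contDiff_infty_iff_deriv, hderiv]
    exact ⟨fun x => (hder x).differentiableAt, hch⟩
  · intro x hx
    have : ∫ t in (0 : ℝ)..x, h t = ∫ t in (0 : ℝ)..x, (1 : ℝ) := by
      refine intervalIntegral.integral_congr fun t ht => ?_
      have ht1 : t ≤ 1 := ht.2.trans (max_le (by norm_num) hx)
      simp only [hh, hh₀]
      rw [hz₁ t (fun h => by linarith [h.1]), hz₂ t (fun h => by linarith [h.1]), hA1 t ht1,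
        hB1 t ht1]
      ring
    simp only [hP, this]
    simp; ring
  · intro x hx
    rw [hderiv]
    have := hpos x hx
    have := mul_nonneg hr0 (hp₁ x)
    simp only [hh, hz₂ x (fun h => by linarith [h.1])]
    linarith
  · intro t ht
    have key : ∀ a b : ℝ, a ∈ Icc (2 : ℝ) 4 → b ∈ Icc (2 : ℝ) 4 →
        P b - P a = (3 - a) ^ 2 / 2 - (3 - b) ^ 2 / 2 := by
      intro a b ha hb
      have e1 : P b - P a = ∫ t in a..b, h t := by
        simp only [hP]
        rw [← intervalIntegral.integral_interval_sub_left (hint 0 b) (hint 0 a)]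
        ring
      rw [e1, intervalIntegral.integral_congr (g := fun t => 3 - t)
        (fun t ht => hmid t (uIcc_subset_Icc ha hb ht)),
        intervalIntegral.integral_sub (by simp) (by simp)]
      simp; ring
    have := key (3 - t) (3 + t) ⟨by linarith [ht.2], by linarith [ht.1]⟩
      ⟨by linarith [ht.1], by linarith [ht.2]⟩
    nlinarith
  · intro x hx
    rw [hderiv]
    have := hneg x hx
    have := mul_nonneg hl0 (hp₂ x)
    simp only [hh, hz₁ x (fun h => by linarith [h.2, hx.1])]
    linarith
  · intro x hx
    have e1 : ∫ t in (6 : ℝ)..x, h t = 0 := by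
      rw [intervalIntegral.integral_congr (g := fun _ => (0 : ℝ))]
      · simp
      intro t ht
      have ht6 : 6 ≤ t := (le_min le_rfl hx).trans ht.1
      simp only [hh, hh₀]
      rw [hz₁ t (fun h => by linarith [h.2]), hz₂ t (fun h => by linarith [h.2]),
        hA2 t (by linarith), hB4 t ht6]
      ring
    have e2 : ∫ t in (0 : ℝ)..6, h t = 0 := by
      have i₀ : ∀ a b, IntervalIntegrable h₀ MeasureTheory.volume a b := fun a b =>
        hc₀.continuous.intervalIntegrable a b
      have i₁ : IntervalIntegrable (fun x => r * b₁ x) MeasureTheory.volume 0 6 :=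
        (continuous_const.mul hc₁.continuous).intervalIntegrable _ _
      have i₂ : IntervalIntegrable (fun x => l * b₂ x) MeasureTheory.volume 0 6 :=
        (continuous_const.mul hc₂.continuous).intervalIntegrable _ _
      simp only [hh]
      rw [intervalIntegral.integral_sub ((i₀ 0 6).add i₁) i₂,
        intervalIntegral.integral_add (i₀ 0 6) i₁, intervalIntegral.integral_const_mul,
        intervalIntegral.integral_const_mul, hi₁, hi₂,
        ← intervalIntegral.integral_add_adjacent_intervals (i₀ 0 3) (i₀ 3 6)]
      ring
    simp only [hP]
    rw [← intervalIntegral.integral_add_adjacent_intervals (hint 0 6) (hint 6 x), e1, e2]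
    ring

/-! ### The central lineup -/

/-- A continuous solution `h` of `g (h x) = φ x` is smooth where `g' ≠ 0`. -/
theorem contDiffAt_of_comp_eq {g h φ : ℝ → ℝ} {x : ℝ} (hg : ContDiff ℝ ∞ g)
    (hφ : ContDiffAt ℝ ∞ φ x) (hh : ContinuousAt h x) (hd : deriv g (h x) ≠ 0)
    (he : ∀ᶠ y in 𝓝 x, g (h y) = φ y) : ContDiffAt ℝ ∞ h x := by
  have hgx : HasDerivAt g (deriv g (h x)) (h x) := (hg.differentiable (by simp) (h x)).hasDerivAt
  have hf : HasFDerivAt g ((ContinuousLinearEquiv.unitsEquivAut ℝ (Units.mk0 _ hd) : ℝ ≃L[ℝ] ℝ) :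
      ℝ →L[ℝ] ℝ) (h x) := hgx.hasFDerivAt_equiv hd
  have hcd : ContDiffAt ℝ ∞ g (h x) := hg.contDiffAt
  have hloc := hcd.to_localInverse hf (by simp)
  have hev := (hcd.hasStrictFDerivAt' hf (by simp)).eventually_left_inverse
  have hx : g (h x) = φ x := he.self_of_nhds
  rw [hx] at hloc
  refine (hloc.comp x hφ).congr_of_eventuallyEq ?_
  filter_upwards [hh.eventually hev, he] with y hy hy'
  simp only [Function.comp, ← hy']
  exact hy.symm

/-- The lineup `Q` of a half profile `P` on `[0, 6]`, extended by the constant `1`: it is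
even around `3`, and on `[0, 3]` it is given through a change of variables `X` by `Q (X s) =
P (6 - s)`, where `X s` is half the sum of `s` and the point `σ s` at which the increasing branch of
`P` takes the value `P (6 - s)`. -/
structure IsHalfLineup (P Q X σ : ℝ → ℝ) : Prop where
  smooth : ContDiff ℝ ∞ Q
  smooth_left : ContDiff ℝ ∞ σ
  left_zero : σ 0 = 0
  left_three : σ 3 = 3
  left_mem : ∀ s ∈ Icc (0 : ℝ) 3, σ s ∈ Icc (0 : ℝ) 3
  left_eq : ∀ s ≤ (3 : ℝ), P (σ s) = P (6 - s)
  var_eq : ∀ s, X s = (s + σ s) / 2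
  var_mono : StrictMono X
  var_surj : Function.Surjective X
  comp_var : ∀ s ≤ (3 : ℝ), Q (X s) = P (6 - s)
  symm : ∀ x, Q (6 - x) = Q x
  flat : ∀ x ≥ 6, Q x = 1

namespace IsHalfProfile

variable {P : ℝ → ℝ} (hP : IsHalfProfile P)
include hP

theorem antitoneOn : AntitoneOn P (Ici 3) := by
  have h1 : AntitoneOn P (Ici 6) := fun x hx y hy _ => by rw [hP.flat x hx, hP.flat y hy]
  have := hP.strictAntiOn.antitoneOn.union_right h1 (c := 6)
    ⟨⟨by norm_num, le_rfl⟩, fun x hx => hx.2⟩ ⟨by simp, fun x hx => hx⟩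
  rwa [Icc_union_Ici_eq_Ici (by norm_num)] at this

theorem le_peak (x : ℝ) : P x ≤ P 3 := by
  rcases le_total x 3 with h | h
  · exact hP.strictMonoOn.monotoneOn h (by simp) h
  · exact hP.antitoneOn (by simp) h h

/-- The inverse of the increasing branch of a half profile, extended continuously. -/
theorem exists_left_inverse : ∃ a : ℝ → ℝ, Continuous a ∧ Monotone a ∧
    (∀ x ≤ 3, a (P x) = x) ∧ ∀ y ≤ P 3, P (a y) = y ∧ a y ≤ 3 := by
  set P₁ : ℝ → ℝ := fun x => if x ≤ 3 then P x else P 3 + (x - 3) with hP₁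
  have hle : ∀ x ≤ 3, P₁ x = P x := fun x hx => by simp [hP₁, hx]
  have hge : ∀ x ≥ 3, P₁ x = P 3 + (x - 3) := fun x hx => by
    rcases hx.eq_or_lt with h | h
    · simp [hP₁, ← h]
    · simp [hP₁, h]
  have hcont : Continuous P₁ := by
    refine Continuous.if_le hP.smooth.continuous (by fun_prop) continuous_id continuous_const ?_
    intro x hx
    rw [show x = 3 from hx, sub_self, add_zero]
  have hmono : StrictMono P₁ := by
    refine StrictMonoOn.Iic_union_Ici (a := 3) ?_ ?_
    · intro x hx y hy hxy
      rw [hle x hx, hle y hy]; exact hP.strictMonoOn hx hy hxy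
    · intro x hx y hy hxy
      rw [hge x hx, hge y hy]; linarith
  have hsurj : Function.Surjective P₁ := by
    refine hcont.surjective ?_ ?_
    · refine (tendsto_atTop_add_const_left _ (P 3)
        (tendsto_atTop_add_const_right _ (-3) tendsto_id)).congr' ?_
      filter_upwards [Ici_mem_atTop 3] with x hx
      rw [hge x hx, id, sub_eq_add_neg x]
    · refine (tendsto_atBot_add_const_right _ (1 : ℝ) tendsto_id).congr' ?_
      filter_upwards [Iic_mem_atBot 1] with x hx
      rw [hle x (le_trans hx (by norm_num)), hP.linear x hx, id]
  set e := hmono.orderIsoOfSurjective P₁ hsurj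
  have he : ∀ x, e x = P₁ x := fun x => rfl
  have h1 : ∀ x ≤ 3, e.symm (P x) = x := fun x hx => by
    rw [← hle x hx, ← he, e.symm_apply_apply]
  refine ⟨e.symm, e.symm.continuous, e.symm.monotone, h1, fun y hy => ?_⟩
  have h3 : e.symm y ≤ 3 := by
    rw [← h1 3 le_rfl]; exact e.symm.monotone hy
  exact ⟨by rw [← hle _ h3, ← he, e.apply_symm_apply], h3⟩

theorem exists_isHalfLineup : ∃ Q X σ, IsHalfLineup P Q X σ := by
  obtain ⟨a, hac, ham, ha1, ha2⟩ := hP.exists_left_inverse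
  set σ : ℝ → ℝ := fun s => if s ≤ 5 / 2 then a (P (6 - s)) else s with hσ
  have hσ1 : ∀ s ≤ 3, σ s = a (P (6 - s)) := by
    intro s hs
    simp only [hσ]
    split_ifs with h
    · rfl
    · rw [hP.symm_of_mem ⟨by linarith, by linarith⟩, ha1 s hs]
  have hσ2 : ∀ s ≥ 2, σ s = s := by
    intro s hs
    simp only [hσ]
    split_ifs with h
    · rw [hP.symm_of_mem ⟨by linarith, by linarith⟩, ha1 s (by linarith)]
    · rfl
  have hP0 : P 0 = 1 := by rw [hP.linear 0 (by norm_num)]; norm_num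
  have hσ3 : ∀ s ≤ 0, σ s = 0 := by
    intro s hs
    rw [hσ1 s (by linarith), hP.flat _ (by linarith), ← hP0, ha1 0 (by norm_num)]
  have heq : ∀ s ≤ 3, P (σ s) = P (6 - s) := fun s hs => by
    rw [hσ1 s hs]; exact (ha2 _ (hP.le_peak _)).1
  have hmono : Monotone σ := by
    refine MonotoneOn.Iic_union_Ici (a := 3) ?_ ?_
    · intro s hs t ht hst
      simp only [mem_Iic] at hs ht
      rw [hσ1 s hs, hσ1 t ht]
      exact ham (hP.antitoneOn (by simp; linarith) (by simp; linarith) (by linarith))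
    · intro s hs t ht hst
      simp only [mem_Ici] at hs ht
      rwa [hσ2 s (by linarith), hσ2 t (by linarith)]
  have hσ33 : σ 3 = 3 := hσ2 3 (by norm_num)
  have hσ00 : σ 0 = 0 := hσ3 0 le_rfl
  have hlt : ∀ s < 3, σ s < 3 := by
    intro s hs
    have h1 : P (6 - s) < P 3 := by
      have h2 : P (6 - max s 0) < P 3 := hP.strictAntiOn ⟨le_rfl, by norm_num⟩
        ⟨by have : max s 0 < 3 := max_lt hs (by norm_num)
            linarith, by linarith [le_max_right s 0]⟩
        (by have : max s 0 < 3 := max_lt hs (by norm_num)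
            linarith)
      refine lt_of_le_of_lt ?_ h2
      exact hP.antitoneOn
        (by have : max s 0 < 3 := max_lt hs (by norm_num)
            simp only [mem_Ici]; linarith) (by simp only [mem_Ici]; linarith)
        (by linarith [le_max_left s 0])
    rw [← heq s hs.le] at h1
    have h3 : σ s ≤ 3 := by rw [← hσ33]; exact hmono hs.le
    rcases h3.lt_or_eq with h | h
    · exact h
    · rw [h] at h1; exact absurd h1 (lt_irrefl _)
  have hsm : ContDiff ℝ ∞ σ := by
    rw [contDiff_iff_contDiffAt]
    intro s
    rcases lt_or_ge s 3 with hs | hs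
    · refine contDiffAt_of_comp_eq (φ := fun s => P (6 - s)) hP.smooth
        (hP.smooth.comp (contDiff_const.sub contDiff_id)).contDiffAt ?_
        (hP.increasing _ (hlt s hs)).ne' ?_
      · have : ContinuousAt (fun s => a (P (6 - s))) s :=
          (hac.comp (hP.smooth.continuous.comp (by fun_prop))).continuousAt
        refine this.congr ?_
        filter_upwards [Iio_mem_nhds hs] with t ht using (hσ1 t (le_of_lt ht)).symm
      · filter_upwards [Iio_mem_nhds hs] with t ht using heq t (le_of_lt ht)
    · refine contDiffAt_id.congr_of_eventuallyEq ?_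
      filter_upwards [Ioi_mem_nhds (by linarith : 2 < s)] with t ht using hσ2 t (le_of_lt ht)
  set X : ℝ → ℝ := fun s => (s + σ s) / 2 with hX
  have hXsm : ContDiff ℝ ∞ X := by simp only [hX]; fun_prop
  have hXm : StrictMono X := fun s t hst => by
    have := hmono hst.le
    simp only [hX]; linarith
  have hXd : ∀ s, deriv X s ≠ 0 := by
    intro s
    have h1 : HasDerivAt σ (deriv σ s) s := (hsm.differentiable (by simp) s).hasDerivAt
    have h2 : HasDerivAt X ((1 + deriv σ s) / 2) s := ((hasDerivAt_id s).add h1).div_const 2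
    have : 0 ≤ deriv σ s := hmono.deriv_nonneg
    rw [h2.deriv]; positivity
  have hXs : Function.Surjective X := by
    refine hXsm.continuous.surjective ?_ ?_
    · refine tendsto_id.congr' ?_
      filter_upwards [Ici_mem_atTop 2] with s hs
      simp only [hX, hσ2 s hs, id]; ring
    · refine (tendsto_id.atBot_div_const (by norm_num : (0 : ℝ) < 2)).congr' ?_
      filter_upwards [Iic_mem_atBot 0] with s hs
      simp [hX, hσ3 s hs]
  set e := hXm.orderIsoOfSurjective X hXs
  set S : ℝ → ℝ := ⇑e.symm with hS
  have hXS : ∀ x, X (S x) = x := fun x => e.apply_symm_apply x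
  have hSX : ∀ s, S (X s) = s := fun s => e.symm_apply_apply s
  have hSsm : ContDiff ℝ ∞ S := contDiff_iff_contDiffAt.2 fun x =>
    contDiffAt_of_comp_eq hXsm contDiffAt_id e.symm.continuous.continuousAt (hXd _)
      (Eventually.of_forall hXS)
  have hS2 : ∀ x ≥ 2, S x = x := fun x hx => by
    conv_lhs => rw [show x = X x by simp only [hX, hσ2 x hx]; ring]
    exact hSX x
  have hS3 : S 3 = 3 := hS2 3 (by norm_num)
  set k : ℝ → ℝ := fun x => P (6 - S x) with hk
  have hksm : ContDiff ℝ ∞ k := hP.smooth.comp (contDiff_const.sub hSsm)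
  have hk2 : ∀ x ∈ Icc (2 : ℝ) 4, k (6 - x) = k x := fun x hx => by
    simp only [hk]
    rw [hS2 x hx.1, hS2 (6 - x) (by linarith [hx.2]), sub_sub_cancel, hP.symm_of_mem hx]
  set Q : ℝ → ℝ := fun x => if x ≤ 3 then k x else k (6 - x) with hQ
  have hQ1 : ∀ x ≤ 4, Q x = k x := fun x hx => by
    simp only [hQ]
    split_ifs with h
    · rfl
    · exact hk2 x ⟨by linarith, hx⟩
  have hQ2 : ∀ x ≥ 2, Q x = k (6 - x) := fun x hx => by
    simp only [hQ]
    split_ifs with h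
    · exact (hk2 x ⟨hx, by linarith⟩).symm
    · rfl
  refine ⟨Q, X, σ, ⟨?_, hsm, hσ00, hσ33, ?_, heq, fun s => rfl, hXm, hXs, ?_, ?_, ?_⟩⟩
  · rw [contDiff_iff_contDiffAt]
    intro x
    rcases lt_or_ge x 4 with hx | hx
    · refine hksm.contDiffAt.congr_of_eventuallyEq ?_
      filter_upwards [Iio_mem_nhds hx] with t ht using hQ1 t (le_of_lt ht)
    · refine (hksm.comp (contDiff_const.sub contDiff_id)).contDiffAt.congr_of_eventuallyEq
        (f := fun x => k (6 - x)) ?_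
      filter_upwards [Ioi_mem_nhds (by linarith : 2 < x)] with t ht using hQ2 t (le_of_lt ht)
  · intro s hs
    exact ⟨hσ00 ▸ hmono hs.1, hσ33 ▸ hmono hs.2⟩
  · intro s hs
    have : X s ≤ 3 := by
      have := hXm.monotone hs
      simp only [hX, hσ33] at this ⊢
      linarith
    rw [hQ1 _ (by linarith)]
    simp only [hk, hSX]
  · intro x
    rcases le_total x 3 with h | h
    · rw [hQ1 x (by linarith), hQ2 (6 - x) (by linarith), sub_sub_cancel]
    · rw [hQ2 x (by linarith), hQ1 (6 - x) (by linarith)]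
  · intro x hx
    have h0 : S 0 = 0 := by
      have := hSX 0
      simpa [hX, hσ00] using this
    have : S (6 - x) ≤ 0 := by
      rw [← h0]; exact e.symm.monotone (by linarith)
    rw [hQ2 x (by linarith)]
    exact hP.flat _ (by linarith)

end IsHalfProfile

namespace IsHalfLineup

variable {P Q X σ : ℝ → ℝ} (hQ : IsHalfLineup P Q X σ)
include hQ

theorem var_zero : X 0 = 0 := by rw [hQ.var_eq, hQ.left_zero]; norm_num

theorem var_three : X 3 = 3 := by rw [hQ.var_eq, hQ.left_three]; norm_num

theorem flat_left {x : ℝ} (hx : x ≤ 0) : Q x = 1 := by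
  rw [← hQ.symm]; exact hQ.flat _ (by linarith)

theorem deriv_zero : deriv Q 0 = 0 := by
  have h1 : HasDerivAt Q (deriv Q 0) 0 := (hQ.smooth.differentiable (by simp) 0).hasDerivAt
  have h2 : HasDerivWithinAt Q 0 (Iic 0) 0 :=
    (hasDerivWithinAt_const 0 (Iic 0) (1 : ℝ)).congr (fun x hx => hQ.flat_left hx)
      (hQ.flat_left le_rfl)
  exact (uniqueDiffWithinAt_Iic 0).eq_deriv _ h1.hasDerivWithinAt h2

/-- Every point of `[0, 3]` is `X s` for a parameter `s ∈ [0, 3]`. -/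
theorem exists_param {x : ℝ} (hx : x ∈ Icc (0 : ℝ) 3) : ∃ s ∈ Icc (0 : ℝ) 3, X s = x := by
  obtain ⟨s, rfl⟩ := hQ.var_surj x
  refine ⟨s, ⟨?_, ?_⟩, rfl⟩
  · rw [← hQ.var_mono.le_iff_le, hQ.var_zero]; exact hx.1
  · rw [← hQ.var_mono.le_iff_le, hQ.var_three]; exact hx.2

theorem one_le (hP : IsHalfProfile P) (x : ℝ) : 1 ≤ Q x := by
  wlog h : x ≤ 3 generalizing x
  · rw [← hQ.symm]; exact this _ (by linarith)
  rcases le_total x 0 with h0 | h0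
  · exact (hQ.flat_left h0).ge
  · obtain ⟨s, hs, rfl⟩ := hQ.exists_param ⟨h0, h⟩
    rw [hQ.comp_var s hs.2]; exact hP.one_le (by linarith [hs.2])

/-- A half profile and its lineup are equimeasurable. -/
theorem integral_comp_eq {G : ℝ → ℝ} (hG : Continuous G) (hP : IsHalfProfile P) :
    ∫ x in (0 : ℝ)..6, G (Q x) = ∫ x in (0 : ℝ)..6, G (P x) := by
  have cQ : Continuous fun x => G (Q x) := hG.comp hQ.smooth.continuous
  have cP : Continuous fun x => G (P x) := hG.comp hP.smooth.continuous
  have cP' : Continuous fun x => G (P (6 - x)) := cP.comp (by fun_prop)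
  have cσ : Continuous (deriv σ) := hQ.smooth_left.continuous_deriv (by simp)
  have hσ : ∀ s, HasDerivAt σ (deriv σ s) s := fun s =>
    (hQ.smooth_left.differentiable (by simp) s).hasDerivAt
  have hXd : ∀ s, HasDerivAt X ((1 + deriv σ s) / 2) s := fun s => by
    have := ((hasDerivAt_id s).add (hσ s)).div_const 2
    exact this.congr_of_eventuallyEq (Eventually.of_forall hQ.var_eq)
  have e1 : ∫ x in (3 : ℝ)..6, G (Q x) = ∫ x in (0 : ℝ)..3, G (Q x) := by
    have := intervalIntegral.integral_comp_sub_left (a := 0) (b := 3) (fun x => G (Q x)) 6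
    norm_num [hQ.symm] at this
    exact this.symm
  have e2 : ∫ x in (0 : ℝ)..3, G (P (6 - x)) = ∫ x in (3 : ℝ)..6, G (P x) := by
    have := intervalIntegral.integral_comp_sub_left (a := 0) (b := 3) (fun x => G (P x)) 6
    norm_num at this
    exact this
  have e3 : ∫ s in (0 : ℝ)..3, G (Q (X s)) * ((1 + deriv σ s) / 2) = ∫ x in (0 : ℝ)..3, G (Q x) := by
    have := intervalIntegral.integral_comp_mul_deriv (a := 0) (b := 3) (f := X)
      (f' := fun s => (1 + deriv σ s) / 2) (g := fun x => G (Q x)) (fun s _ => hXd s)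
      (by fun_prop) cQ
    rwa [hQ.var_zero, hQ.var_three] at this
  have e4 : ∫ s in (0 : ℝ)..3, G (P (σ s)) * deriv σ s = ∫ x in (0 : ℝ)..3, G (P x) := by
    have := intervalIntegral.integral_comp_mul_deriv (a := 0) (b := 3) (f := σ)
      (f' := deriv σ) (g := fun x => G (P x)) (fun s _ => hσ s) cσ.continuousOn cP
    rwa [hQ.left_zero, hQ.left_three] at this
  have cPσ : Continuous fun s => G (P (σ s)) * deriv σ s :=
    (cP.comp hQ.smooth_left.continuous).mul cσ
  have e5 : ∫ s in (0 : ℝ)..3, G (Q (X s)) * ((1 + deriv σ s) / 2) =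
      ((∫ s in (0 : ℝ)..3, G (P (6 - s))) + ∫ s in (0 : ℝ)..3, G (P (σ s)) * deriv σ s) / 2 := by
    rw [← intervalIntegral.integral_add (cP'.intervalIntegrable _ _) (cPσ.intervalIntegrable _ _),
      ← intervalIntegral.integral_div]
    refine intervalIntegral.integral_congr fun s hs => ?_
    rw [uIcc_of_le (by norm_num)] at hs
    simp only [hQ.comp_var s hs.2, hQ.left_eq s hs.2]
    ring
  rw [← intervalIntegral.integral_add_adjacent_intervals (cQ.intervalIntegrable 0 3)
    (cQ.intervalIntegrable 3 6), ← intervalIntegral.integral_add_adjacent_intervals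
    (cP.intervalIntegrable 0 3) (cP.intervalIntegrable 3 6), e1, ← e3, e5, e2, e4]
  ring

theorem superlevelMeasure_eq (hP : IsHalfProfile P) {f : ℝ → ℝ} (hf : EqOn f P (Icc 0 6)) {s : ℝ}
    (hs : s ∈ Icc (0 : ℝ) 3) : superlevelMeasure f (P (6 - s)) = 6 - 2 * X s := by
  have hσ := hQ.left_mem s hs
  have : {x ∈ Icc (0 : ℝ) 6 | P (6 - s) ≤ f x} = Icc (σ s) (6 - s) := by
    ext x
    constructor
    · rintro ⟨hx, h⟩
      rw [hf hx] at h
      rcases le_total x 3 with h3 | h3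
      · rw [← hQ.left_eq s hs.2, hP.strictMonoOn.le_iff_le hσ.2 h3] at h
        exact ⟨h, by linarith [hs.2]⟩
      · rw [hP.strictAntiOn.le_iff_ge ⟨by linarith [hs.2], by linarith [hs.1]⟩ ⟨h3, hx.2⟩] at h
        exact ⟨by linarith [hσ.2], h⟩
    · rintro ⟨h1, h2⟩
      have hx : x ∈ Icc (0 : ℝ) 6 := ⟨by linarith [hσ.1], by linarith [hs.1]⟩
      refine ⟨hx, ?_⟩
      rw [hf hx]
      rcases le_total x 3 with h3 | h3
      · rw [← hQ.left_eq s hs.2]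
        exact hP.strictMonoOn.monotoneOn hσ.2 h3 h1
      · exact hP.antitoneOn h3 (by simp only [mem_Ici]; linarith [hs.2]) h2
  rw [superlevelMeasure, this, Real.volume_Icc, ENNReal.toReal_ofReal (by linarith [hσ.2, hs.2]),
    hQ.var_eq]
  ring

theorem isCentralLineup (hP : IsHalfProfile P) {f : ℝ → ℝ} (hf : EqOn f P (Icc 0 6)) :
    IsCentralLineup f (mirror Q) := by
  have he : ∀ x ≤ 8, mirror Q x = Q x := fun x hx => mirror_of_le hQ.flat hx
  refine ⟨?_, ?_, ?_, ?_, ?_⟩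
  · intro x hx y hy
    rw [he x (by linarith [hx.2])]
    obtain ⟨s, hs, rfl⟩ := hQ.exists_param (Ico_subset_Icc_self hx)
    rw [hQ.comp_var s hs.2]
    constructor
    · rintro rfl
      rw [hQ.superlevelMeasure_eq hP hf hs]; ring
    · intro h
      rcases lt_or_ge (P 3) y with h3 | h3
      · exfalso
        have : {x ∈ Icc (0 : ℝ) 6 | y ≤ f x} = ∅ := by
          rw [eq_empty_iff_forall_notMem]
          rintro x ⟨hx, h⟩
          rw [hf hx] at h
          linarith [hP.le_peak x]
        rw [superlevelMeasure, this] at h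
        simp only [MeasureTheory.measure_empty, ENNReal.toReal_zero] at h
        linarith [hx.2]
      · have hivt := intermediate_value_Icc' (by norm_num : (3 : ℝ) ≤ 6)
          hP.smooth.continuous.continuousOn
        obtain ⟨t, ht, rfl⟩ := hivt ⟨by rw [hP.flat 6 le_rfl]; exact hy, h3⟩
        have hm : 6 - t ∈ Icc (0 : ℝ) 3 := ⟨by linarith [ht.2], by linarith [ht.1]⟩
        have := hQ.superlevelMeasure_eq hP hf hm
        rw [sub_sub_cancel] at this
        rw [this] at h
        have : s = 6 - t := hQ.var_mono.injective (by linarith)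
        rw [this, sub_sub_cancel]
  · rw [he 3 (by norm_num), hf ⟨by norm_num, by norm_num⟩]
    conv_lhs => rw [← hQ.var_three]
    rw [hQ.comp_var 3 le_rfl]; norm_num
  · intro t ht
    rw [he _ (by linarith [ht.2]), he _ (by linarith [ht.1]), ← hQ.symm]
    congr 1; ring
  · intro x hx
    rw [he x (by linarith [hx.2]), hQ.flat x hx.1]
  · intro t _
    rw [← mirror_symm Q (7 + t)]
    congr 1; ring

end IsHalfLineup

/-- The central lineup is unique. -/
theorem IsCentralLineup.eqOn {f₁ f g : ℝ → ℝ} (hf : IsCentralLineup f₁ f)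
    (hg : IsCentralLineup f₁ g) (h1 : ∀ x ∈ Ico (0 : ℝ) 3, 1 ≤ g x) : EqOn f g (Icc 0 14) := by
  have a1 : ∀ x ∈ Ico (0 : ℝ) 3, f x = g x := fun x hx =>
    (hf.rearrange x hx _ (h1 x hx)).2 ((hg.rearrange x hx _ (h1 x hx)).1 rfl)
  have a2 : ∀ x ∈ Icc (0 : ℝ) 3, f x = g x := fun x hx => by
    rcases hx.2.lt_or_eq with h | rfl
    · exact a1 x ⟨hx.1, h⟩
    · rw [hf.peak, hg.peak]
  have a3 : ∀ x ∈ Icc (0 : ℝ) 7, f x = g x := fun x hx => by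
    rcases le_total x 3 with h | h
    · exact a2 x ⟨hx.1, h⟩
    rcases le_total x 6 with h' | h'
    · have hm : x - 3 ∈ Icc (0 : ℝ) 3 := ⟨by linarith, by linarith⟩
      have e1 := hf.peak_symm _ hm
      have e2 := hg.peak_symm _ hm
      rw [add_sub_cancel] at e1 e2
      rw [e1, e2, a2 _ ⟨by linarith, by linarith⟩]
    · rw [hf.flat x ⟨h', hx.2⟩, hg.flat x ⟨h', hx.2⟩]
  intro x hx
  rcases le_total x 7 with h | h
  · exact a3 x ⟨hx.1, h⟩
  · have hm : x - 7 ∈ Icc (0 : ℝ) 7 := ⟨by linarith, by linarith [hx.2]⟩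
    have e1 := hf.symm _ hm
    have e2 := hg.symm _ hm
    rw [add_sub_cancel] at e1 e2
    rw [e1, e2, a3 _ ⟨by linarith [hx.2], by linarith⟩]

/-! ### Crossing times and shifts -/

/-- A warping function for the strip, extended smoothly and symmetrically to the line: it is `1` on
the boundary and around the middle line, and at least `1` in between. -/
structure IsWarp (f : ℝ → ℝ) : Prop where
  smooth : ContDiff ℝ ∞ f
  one_le : ∀ y ∈ Icc (0 : ℝ) 14, 1 ≤ f y
  symm : ∀ y, f (14 - y) = f y
  flat : ∀ y ∈ Icc (6 : ℝ) 8, f y = 1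
  zero : f 0 = 1

/-- The transversal speed of a unit speed geodesic with Clairaut constant `c` at a height where the
warping function has the value `v`. Values below `1` are replaced by `1`, so that the function is
positive and continuous everywhere for `|c| < 1`; in the strip the warping function is at least `1`. -/
def crossSpeed (c v : ℝ) : ℝ := √(1 - c ^ 2 / max v 1)

/-- The time that a unit speed geodesic with Clairaut constant `c` takes to cross the strip. -/
def crossTime (f : ℝ → ℝ) (c : ℝ) : ℝ := ∫ y in (0 : ℝ)..14, (crossSpeed c (f y))⁻¹

/-- The displacement along the strip of a unit speed geodesic with Clairaut constant `c` while it
crosses the strip. -/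
def crossShift (f : ℝ → ℝ) (c : ℝ) : ℝ :=
  ∫ y in (0 : ℝ)..14, c / max (f y) 1 * (crossSpeed c (f y))⁻¹

theorem one_sub_le_one_sub_div {c : ℝ} (v : ℝ) : 1 - c ^ 2 ≤ 1 - c ^ 2 / max v 1 := by
  have := div_le_self (sq_nonneg c) (le_max_right v 1)
  linarith

theorem crossSpeed_pos {c : ℝ} (hc : c ^ 2 < 1) (v : ℝ) : 0 < crossSpeed c v :=
  Real.sqrt_pos.2 (by linarith [one_sub_le_one_sub_div (c := c) v])

theorem crossSpeed_sq {c : ℝ} (hc : c ^ 2 < 1) (v : ℝ) :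
    crossSpeed c v ^ 2 = 1 - c ^ 2 / max v 1 :=
  Real.sq_sqrt (by linarith [one_sub_le_one_sub_div (c := c) v])

theorem crossSpeed_le_one (c v : ℝ) : crossSpeed c v ≤ 1 := by
  have : 0 ≤ c ^ 2 / max v 1 := by positivity
  rw [crossSpeed, Real.sqrt_le_iff]
  constructor <;> linarith

theorem max_one_ne_zero (v : ℝ) : max v 1 ≠ 0 := by positivity

theorem continuous_crossSpeed (c : ℝ) : Continuous (crossSpeed c) := by
  unfold crossSpeed
  exact (continuous_const.sub (continuous_const.div (by fun_prop) max_one_ne_zero)).sqrt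

theorem continuous_inv_crossSpeed {c : ℝ} (hc : c ^ 2 < 1) :
    Continuous fun v => (crossSpeed c v)⁻¹ :=
  (continuous_crossSpeed c).inv₀ fun v => (crossSpeed_pos hc v).ne'

theorem continuous_shift_integrand {c : ℝ} (hc : c ^ 2 < 1) :
    Continuous fun v => c / max v 1 * (crossSpeed c v)⁻¹ :=
  (continuous_const.div (by fun_prop) max_one_ne_zero).mul (continuous_inv_crossSpeed hc)

theorem crossTime_pos {f : ℝ → ℝ} (hf : Continuous f) {c : ℝ} (hc : c ^ 2 < 1) :
    0 < crossTime f c :=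
  intervalIntegral.intervalIntegral_pos_of_pos
    (((continuous_inv_crossSpeed hc).comp hf).intervalIntegrable _ _)
    (fun y => inv_pos.2 (crossSpeed_pos hc _)) (by norm_num)

/-- The calibration identity: the crossing time splits into the contribution `c • shift` of the
closed form `c dx` and that of the form `crossSpeed c (f y) dy`. -/
theorem crossTime_eq {f : ℝ → ℝ} (hf : Continuous f) {c : ℝ} (hc : c ^ 2 < 1) :
    crossTime f c = c * crossShift f c + ∫ y in (0 : ℝ)..14, crossSpeed c (f y) := by
  have c1 : Continuous fun y => c * (c / max (f y) 1 * (crossSpeed c (f y))⁻¹) :=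
    continuous_const.mul ((continuous_shift_integrand hc).comp hf)
  have c2 : Continuous fun y => crossSpeed c (f y) := (continuous_crossSpeed c).comp hf
  rw [crossTime, crossShift, ← intervalIntegral.integral_const_mul,
    ← intervalIntegral.integral_add (c1.intervalIntegrable _ _) (c2.intervalIntegrable _ _)]
  refine intervalIntegral.integral_congr fun y _ => ?_
  have h1 := crossSpeed_pos hc (f y)
  have h2 := crossSpeed_sq hc (f y)
  have h3 := max_one_ne_zero (f y)
  field_simp at h2 ⊢
  linarith

/-- Every displacement is realized by a Clairaut constant, because the strip has a flat part of
positive width: there the displacement tends to infinity as `c` tends to `1`. -/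
theorem IsWarp.exists_crossShift_eq {f : ℝ → ℝ} (hf : IsWarp f) (d : ℝ) :
    ∃ c : ℝ, c ^ 2 < 1 ∧ crossShift f c = d := by
  have hneg : ∀ c, crossShift f (-c) = -crossShift f c := by
    intro c
    simp only [crossShift, crossSpeed, neg_sq, ← intervalIntegral.integral_neg]
    congr 1; ext y; ring
  wlog hd : 0 ≤ d generalizing d
  · obtain ⟨c, hc, h⟩ := this (-d) (by linarith)
    exact ⟨-c, by rwa [neg_sq], by rw [hneg, h, neg_neg]⟩
  -- on the flat part the displacement is `2 c / √(1 - c²)`, which is `d + 1` for this `c₀`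
  set b : ℝ := √(1 + (d + 1) ^ 2) with hb
  have hb2 : b ^ 2 = 1 + (d + 1) ^ 2 := Real.sq_sqrt (by positivity)
  have hbpos : 0 < b := Real.sqrt_pos.2 (by positivity)
  set c₀ : ℝ := (d + 1) / b with hc₀
  have hc₀pos : 0 < c₀ := by positivity
  have hc₀sq : c₀ ^ 2 < 1 := by
    rw [hc₀, div_pow, div_lt_one (by positivity), hb2]; linarith
  have hs : √(1 - c₀ ^ 2) = 1 / b := by
    rw [show 1 - c₀ ^ 2 = (1 / b) ^ 2 by
      rw [hc₀, div_pow, div_pow]; field_simp; rw [hb2]; ring]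
    exact Real.sqrt_sq (by positivity)
  have hint : ∀ a b, IntervalIntegrable (fun y => c₀ / max (f y) 1 * (crossSpeed c₀ (f y))⁻¹)
      MeasureTheory.volume a b := fun a b =>
    ((continuous_shift_integrand hc₀sq).comp hf.smooth.continuous).intervalIntegrable a b
  have hnn : ∀ y, 0 ≤ c₀ / max (f y) 1 * (crossSpeed c₀ (f y))⁻¹ := fun y =>
    mul_nonneg (by positivity) (inv_nonneg.2 (Real.sqrt_nonneg _))
  have hbig : d ≤ crossShift f c₀ := by
    have e1 : ∫ y in (6 : ℝ)..8, c₀ / max (f y) 1 * (crossSpeed c₀ (f y))⁻¹ = 2 * (d + 1) := by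
      rw [intervalIntegral.integral_congr (g := fun _ => d + 1)]
      · simp; ring
      intro y hy
      rw [uIcc_of_le (by norm_num)] at hy
      simp only [hf.flat y hy, crossSpeed, max_self, div_one, hs]
      rw [hc₀]; field_simp
    have e2 : 0 ≤ ∫ y in (0 : ℝ)..6, c₀ / max (f y) 1 * (crossSpeed c₀ (f y))⁻¹ :=
      intervalIntegral.integral_nonneg (by norm_num) fun y _ => hnn y
    have e3 : 0 ≤ ∫ y in (8 : ℝ)..14, c₀ / max (f y) 1 * (crossSpeed c₀ (f y))⁻¹ :=
      intervalIntegral.integral_nonneg (by norm_num) fun y _ => hnn y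
    rw [crossShift, ← intervalIntegral.integral_add_adjacent_intervals (hint 0 6) (hint 6 14),
      ← intervalIntegral.integral_add_adjacent_intervals (hint 6 8) (hint 8 14), e1]
    linarith
  -- the integrand is replaced by one that is continuous in `(c, y)` and agrees for `|c| ≤ c₀`
  set F : ℝ → ℝ → ℝ := fun c y =>
    c / max (f y) 1 * (√(max (1 - c ^ 2 / max (f y) 1) (1 - c₀ ^ 2)))⁻¹ with hF
  have hFc : Continuous (Function.uncurry F) := by
    have hfc := hf.smooth.continuous
    simp only [hF, Function.uncurry_def]
    refine (continuous_fst.div (by fun_prop) fun p => max_one_ne_zero _).mul (Continuous.inv₀ ?_ ?_)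
    · refine Continuous.sqrt (Continuous.max (continuous_const.sub ?_) continuous_const)
      exact (continuous_fst.pow 2).div (by fun_prop) fun p => max_one_ne_zero _
    · intro p
      exact (Real.sqrt_pos.2 (lt_max_of_lt_right (by linarith))).ne'
  have hFi : Continuous fun c => ∫ y in (0 : ℝ)..14, F c y :=
    intervalIntegral.continuous_parametric_intervalIntegral_of_continuous' hFc 0 14
  have hFe : ∀ c ∈ Icc 0 c₀, ∫ y in (0 : ℝ)..14, F c y = crossShift f c := by
    intro c hc
    rw [crossShift]
    refine intervalIntegral.integral_congr fun y _ => ?_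
    have h1 : c ^ 2 ≤ c₀ ^ 2 := pow_le_pow_left₀ hc.1 hc.2 2
    simp only [hF, crossSpeed]
    rw [max_eq_left ((by linarith : 1 - c₀ ^ 2 ≤ 1 - c ^ 2).trans (one_sub_le_one_sub_div _))]
  have h0 : crossShift f 0 = 0 := by simp [crossShift]
  obtain ⟨c, hc, h⟩ := intermediate_value_Icc hc₀pos.le hFi.continuousOn
    (show d ∈ Icc _ _ by
      rw [hFe 0 ⟨le_rfl, hc₀pos.le⟩, hFe c₀ ⟨hc₀pos.le, le_rfl⟩, h0]; exact ⟨hd, hbig⟩)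
  refine ⟨c, ?_, by rw [← hFe c hc]; exact h⟩
  have h1 : c ^ 2 ≤ c₀ ^ 2 := pow_le_pow_left₀ hc.1 hc.2 2
  linarith

/-! ### Geodesics of the warped strip -/

/-- The curve `(x, y)` in the strip is a unit speed geodesic of `f(y) dx² + dy²` on `[0, T]`. -/
structure IsStripGeodesic (f : ℝ → ℝ) (T : ℝ) (x y : ℝ → ℝ) : Prop where
  smooth_fst : ContDiffOn ℝ 2 x (Icc 0 T)
  smooth_snd : ContDiffOn ℝ 2 y (Icc 0 T)
  mem : ∀ t ∈ Icc 0 T, y t ∈ Icc (0 : ℝ) 14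
  unit : ∀ t ∈ Icc 0 T,
    f (y t) * derivWithin x (Icc 0 T) t ^ 2 + derivWithin y (Icc 0 T) t ^ 2 = 1
  eq_fst : ∀ t ∈ Icc 0 T, f (y t) * derivWithin (derivWithin x (Icc 0 T)) (Icc 0 T) t +
    deriv f (y t) * derivWithin y (Icc 0 T) t * derivWithin x (Icc 0 T) t = 0
  eq_snd : ∀ t ∈ Icc 0 T, derivWithin (derivWithin y (Icc 0 T)) (Icc 0 T) t =
    deriv f (y t) * derivWithin x (Icc 0 T) t ^ 2 / 2

theorem IsWarp.deriv_symm {f : ℝ → ℝ} (hf : IsWarp f) (y : ℝ) :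
    deriv f (14 - y) = -deriv f y := by
  have h1 : HasDerivAt f (deriv f (14 - y)) (14 - y) :=
    (hf.smooth.differentiable (by simp) _).hasDerivAt
  have h2 := h1.comp_const_sub 14 y
  simp only [hf.symm] at h2
  rw [h2.deriv, neg_neg]

theorem IsStripGeodesic.reflect {f : ℝ → ℝ} (hf : IsWarp f) {T : ℝ} {x y : ℝ → ℝ}
    (h : IsStripGeodesic f T x y) : IsStripGeodesic f T x (fun t => 14 - y t) := by
  have e1 : derivWithin (fun t => 14 - y t) (Icc 0 T) = fun t => -derivWithin y (Icc 0 T) t := by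
    ext t; rw [derivWithin_const_sub]
  refine ⟨h.smooth_fst, contDiffOn_const.sub h.smooth_snd, ?_, ?_, ?_, ?_⟩
  · intro t ht
    have := h.mem t ht
    exact ⟨by linarith [this.2], by linarith [this.1]⟩
  · intro t ht
    rw [e1, hf.symm]
    simpa using h.unit t ht
  · intro t ht
    rw [e1, hf.symm, hf.deriv_symm]
    simpa using h.eq_fst t ht
  · intro t ht
    rw [e1, hf.deriv_symm, derivWithin.fun_neg, h.eq_snd t ht]
    ring

theorem ContDiffOn.hasDerivWithinAt_two {u : ℝ → ℝ} {T : ℝ} (h : ContDiffOn ℝ 2 u (Icc 0 T))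
    (hT : 0 < T) :
    (∀ t ∈ Icc 0 T, HasDerivWithinAt u (derivWithin u (Icc 0 T) t) (Icc 0 T) t) ∧
    (∀ t ∈ Icc 0 T, HasDerivWithinAt (derivWithin u (Icc 0 T))
      (derivWithin (derivWithin u (Icc 0 T)) (Icc 0 T) t) (Icc 0 T) t) := by
  have h1 : ContDiffOn ℝ 1 (derivWithin u (Icc 0 T)) (Icc 0 T) :=
    h.derivWithin (uniqueDiffOn_Icc hT) (by norm_num)
  exact ⟨fun t ht => (h.differentiableOn (by norm_num) t ht).hasDerivWithinAt,
    fun t ht => (h1.differentiableOn (by norm_num) t ht).hasDerivWithinAt⟩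

theorem eq_of_hasDerivWithinAt_zero {u : ℝ → ℝ} {T : ℝ}
    (h : ∀ t ∈ Icc 0 T, HasDerivWithinAt u 0 (Icc 0 T) t) {t : ℝ} (ht : t ∈ Icc 0 T) :
    u t = u 0 :=
  constant_of_has_deriv_right_zero (fun s hs => (h s hs).continuousWithinAt)
    (fun s hs => ((h s (Ico_subset_Icc_self hs)).mono_of_mem_nhdsWithin
      (Icc_mem_nhdsGE_of_mem hs))) t ht

/-- A geodesic that enters the strip at the bottom rises with the speed `crossSpeed c (f y) > 0`, by
conservation of the Clairaut constant `c` and of the energy. So it leaves at the top, and the time and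
the displacement are functions of `c`. -/
theorem IsStripGeodesic.cross {f : ℝ → ℝ} (hf : IsWarp f) {T : ℝ} (hT : 0 < T) {x y : ℝ → ℝ}
    (h : IsStripGeodesic f T x y) (h0 : y 0 = 0) (hin : 0 < derivWithin y (Icc 0 T) 0)
    (hend : y T = 0 ∨ y T = 14) :
    derivWithin x (Icc 0 T) 0 ^ 2 < 1 ∧ y T = 14 ∧
    T = crossTime f (derivWithin x (Icc 0 T) 0) ∧
    x T = x 0 + crossShift f (derivWithin x (Icc 0 T) 0) ∧
    derivWithin x (Icc 0 T) T = derivWithin x (Icc 0 T) 0 := by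
  obtain ⟨dx, ddx⟩ := h.smooth_fst.hasDerivWithinAt_two hT
  obtain ⟨dy, ddy⟩ := h.smooth_snd.hasDerivWithinAt_two hT
  set x' := derivWithin x (Icc 0 T)
  set y' := derivWithin y (Icc 0 T)
  have m0 : (0 : ℝ) ∈ Icc 0 T := ⟨le_rfl, hT.le⟩
  have mT : T ∈ Icc 0 T := ⟨hT.le, le_rfl⟩
  set c := x' 0 with hc
  have hfd : ∀ u, HasDerivAt f (deriv f u) u := fun u =>
    (hf.smooth.differentiable (by simp) u).hasDerivAt
  have clairaut : ∀ t ∈ Icc 0 T, f (y t) * x' t = c := by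
    intro t ht
    have := eq_of_hasDerivWithinAt_zero (u := fun t => f (y t) * x' t) (T := T) (fun s hs => by
      have := ((hfd (y s)).comp_hasDerivWithinAt s (dy s hs)).mul (ddx s hs)
      refine this.congr_deriv ?_
      have := h.eq_fst s hs
      simp only [Function.comp]
      linarith) ht
    simp only [h0, hf.zero, one_mul] at this
    exact this
  have hf1 : ∀ t ∈ Icc 0 T, 1 ≤ f (y t) := fun t ht => hf.one_le _ (h.mem t ht)
  have hc1 : c ^ 2 < 1 := by
    have := h.unit 0 m0
    rw [h0, hf.zero, one_mul] at this
    have := pow_pos hin 2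
    linarith
  have hysq : ∀ t ∈ Icc 0 T, y' t ^ 2 = crossSpeed c (f (y t)) ^ 2 := by
    intro t ht
    have h1 := hf1 t ht
    have h2 := h.unit t ht
    have h3 := clairaut t ht
    rw [crossSpeed_sq hc1, max_eq_left h1, ← h3]
    have : f (y t) ≠ 0 := by positivity
    field_simp
    linarith
  have hypos : ∀ t ∈ Icc 0 T, 0 < y' t := by
    intro t ht
    by_contra hneg
    have hcont : ContinuousOn y' (Icc 0 t) := fun s hs =>
      ((ddy s ⟨hs.1, hs.2.trans ht.2⟩).continuousWithinAt).mono (Icc_subset_Icc_right ht.2)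
    obtain ⟨s, hs, hs0⟩ := intermediate_value_Icc' ht.1 hcont
      (⟨not_lt.1 hneg, hin.le⟩ : (0 : ℝ) ∈ Icc _ _)
    have h1 := hysq s ⟨hs.1, hs.2.trans ht.2⟩
    have h2 := pow_pos (crossSpeed_pos hc1 (f (y s))) 2
    rw [hs0] at h1
    norm_num at h1
    linarith
  have hy' : ∀ t ∈ Icc 0 T, y' t = crossSpeed c (f (y t)) := fun t ht => by
    have h1 := hysq t ht
    rwa [sq_eq_sq₀ (hypos t ht).le (crossSpeed_pos hc1 _).le] at h1
  have hx' : ∀ t ∈ Icc 0 T, x' t = c / max (f (y t)) 1 := fun t ht => by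
    have h1 := hf1 t ht
    rw [max_eq_left h1, ← clairaut t ht]
    field_simp
  have hyT : y T = 14 := by
    refine hend.resolve_left fun h' => ?_
    have : StrictMonoOn y (Icc 0 T) := by
      refine strictMonoOn_of_deriv_pos (convex_Icc 0 T)
        (fun t ht => (dy t ht).continuousWithinAt) fun t ht => ?_
      rw [interior_Icc] at ht
      rw [((dy t (Ioo_subset_Icc_self ht)).hasDerivAt (Icc_mem_nhds ht.1 ht.2)).deriv]
      exact hypos t (Ioo_subset_Icc_self ht)
    have := this m0 mT hT
    rw [h0, h'] at this
    exact lt_irrefl _ this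
  have prim : ∀ G : ℝ → ℝ, Continuous G → ∀ t ∈ Icc 0 T, HasDerivWithinAt
      (fun t => ∫ u in (0 : ℝ)..y t, G (f u)) (G (f (y t)) * crossSpeed c (f (y t)))
      (Icc 0 T) t := by
    intro G hG t ht
    have hcont : Continuous fun u => G (f u) := hG.comp hf.smooth.continuous
    have h1 : HasDerivAt (fun v => ∫ u in (0 : ℝ)..v, G (f u)) (G (f (y t))) (y t) :=
      intervalIntegral.integral_hasDerivAt_right (hcont.intervalIntegrable _ _)
        (hcont.stronglyMeasurableAtFilter _ _) hcont.continuousAt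
    rw [← hy' t ht]
    exact h1.comp_hasDerivWithinAt t (dy t ht)
  refine ⟨hc1, hyT, ?_, ?_, ?_⟩
  · have := eq_of_hasDerivWithinAt_zero
      (u := fun t => t - ∫ u in (0 : ℝ)..y t, (crossSpeed c (f u))⁻¹) (T := T) (fun s hs => by
        have := (hasDerivWithinAt_id s (Icc 0 T)).sub (prim _ (continuous_inv_crossSpeed hc1) s hs)
        refine this.congr_deriv ?_
        rw [inv_mul_cancel₀ (crossSpeed_pos hc1 _).ne', sub_self]) mT
    simp only [h0, hyT, intervalIntegral.integral_same, sub_zero] at this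
    rw [crossTime]
    linarith
  · have := eq_of_hasDerivWithinAt_zero
      (u := fun t => x t - ∫ u in (0 : ℝ)..y t, c / max (f u) 1 * (crossSpeed c (f u))⁻¹) (T := T)
      (fun s hs => by
        have := (dx s hs).sub (prim _ (continuous_shift_integrand hc1) s hs)
        refine this.congr_deriv ?_
        rw [mul_assoc, inv_mul_cancel₀ (crossSpeed_pos hc1 _).ne', hx' s hs]
        ring) mT
    simp only [h0, hyT, intervalIntegral.integral_same, sub_zero] at this
    rw [crossShift]
    linarith
  · have := clairaut T mT
    rwa [hyT, show (14 : ℝ) = 14 - 0 by norm_num, hf.symm, hf.zero, one_mul] at this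

/-- For every Clairaut constant `c` with `|c| < 1` there is a geodesic that crosses the strip. -/
theorem IsWarp.exists_stripGeodesic {f : ℝ → ℝ} (hf : IsWarp f) {c : ℝ} (hc : c ^ 2 < 1)
    (x₀ : ℝ) : ∃ x y : ℝ → ℝ, IsStripGeodesic f (crossTime f c) x y ∧ x 0 = x₀ ∧
      x (crossTime f c) = x₀ + crossShift f c ∧ y 0 = 0 ∧ y (crossTime f c) = 14 ∧
      (∀ t ∈ Ioo 0 (crossTime f c), y t ∈ Ioo (0 : ℝ) 14) ∧
      0 < derivWithin y (Icc 0 (crossTime f c)) 0 ∧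
      derivWithin x (Icc 0 (crossTime f c)) 0 = c := by
  have hfc := hf.smooth.continuous
  have prim : ∀ G : ℝ → ℝ, Continuous G → ∀ v, HasDerivAt
      (fun v => ∫ u in (0 : ℝ)..v, G (f u)) (G (f v)) v := fun G hG v =>
    intervalIntegral.integral_hasDerivAt_right ((hG.comp hfc).intervalIntegrable _ _)
      ((hG.comp hfc).stronglyMeasurableAtFilter _ _) (hG.comp hfc).continuousAt
  set Θ : ℝ → ℝ := fun v => ∫ u in (0 : ℝ)..v, (crossSpeed c (f u))⁻¹ with hΘ
  have dΘ : ∀ v, HasDerivAt Θ (crossSpeed c (f v))⁻¹ v := prim _ (continuous_inv_crossSpeed hc)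
  have Θcont : Continuous Θ := continuous_iff_continuousAt.2 fun v => (dΘ v).continuousAt
  have Θmono : StrictMono Θ := strictMono_of_deriv_pos fun v => by
    rw [(dΘ v).deriv]; exact inv_pos.2 (crossSpeed_pos hc _)
  have Θ0 : Θ 0 = 0 := by simp [hΘ]
  have hsub : Monotone fun v => Θ v - v := by
    have d : ∀ v, HasDerivAt (fun v => Θ v - v) ((crossSpeed c (f v))⁻¹ - 1) v := fun v =>
      (dΘ v).sub (hasDerivAt_id v)
    refine monotone_of_deriv_nonneg (fun v => (d v).differentiableAt) fun v => ?_
    rw [(d v).deriv, sub_nonneg]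
    exact (one_le_inv₀ (crossSpeed_pos hc _)).2 (crossSpeed_le_one _ _)
  have Θsurj : Function.Surjective Θ := by
    refine Θcont.surjective ?_ ?_
    · refine tendsto_atTop_mono' atTop ?_ tendsto_id
      filter_upwards [Ici_mem_atTop 0] with v hv
      have := hsub hv
      simp only [Θ0, id] at this ⊢
      linarith
    · refine tendsto_atBot_mono' atBot ?_ tendsto_id
      filter_upwards [Iic_mem_atBot 0] with v hv
      have := hsub hv
      simp only [Θ0, id] at this ⊢
      linarith
  set e := Θmono.orderIsoOfSurjective Θ Θsurj
  set y : ℝ → ℝ := ⇑e.symm with hy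
  have Θy : ∀ t, Θ (y t) = t := fun t => e.apply_symm_apply t
  have yΘ : ∀ v, y (Θ v) = v := fun v => e.symm_apply_apply v
  have dy : ∀ t, HasDerivAt y (crossSpeed c (f (y t))) t := fun t => by
    have := HasDerivAt.of_local_left_inverse (g := y) (a := t) e.symm.continuous.continuousAt
      (dΘ (y t)) (inv_ne_zero (crossSpeed_pos hc _).ne') (Eventually.of_forall Θy)
    rwa [inv_inv] at this
  set Ξ : ℝ → ℝ := fun v => ∫ u in (0 : ℝ)..v, c / max (f u) 1 * (crossSpeed c (f u))⁻¹ with hΞ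
  set x : ℝ → ℝ := fun t => x₀ + Ξ (y t) with hx
  have dx : ∀ t, HasDerivAt x (c / max (f (y t)) 1) t := fun t => by
    have := ((prim _ (continuous_shift_integrand hc) (y t)).comp t (dy t)).const_add x₀
    refine this.congr_deriv ?_
    rw [mul_assoc, inv_mul_cancel₀ (crossSpeed_pos hc _).ne', mul_one]
  set T := crossTime f c with hT
  have hTpos : 0 < T := crossTime_pos hfc hc
  have y0 : y 0 = 0 := by simpa only [Θ0] using yΘ 0
  have yT : y T = 14 := yΘ 14
  have ymono : StrictMono y := e.symm.strictMono
  have ymem : ∀ t ∈ Icc 0 T, y t ∈ Icc (0 : ℝ) 14 := fun t ht =>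
    ⟨y0 ▸ ymono.monotone ht.1, yT ▸ ymono.monotone ht.2⟩
  have hu := uniqueDiffOn_Icc hTpos
  have m0 : (0 : ℝ) ∈ Icc 0 T := ⟨le_rfl, hTpos.le⟩
  have Dy : ∀ t ∈ Icc 0 T, derivWithin y (Icc 0 T) t = √(1 - c ^ 2 / f (y t)) := fun t ht => by
    rw [(dy t).hasDerivWithinAt.derivWithin (hu t ht), crossSpeed,
      max_eq_left (hf.one_le _ (ymem t ht))]
  have Dx : ∀ t ∈ Icc 0 T, derivWithin x (Icc 0 T) t = c / f (y t) := fun t ht => by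
    rw [(dx t).hasDerivWithinAt.derivWithin (hu t ht), max_eq_left (hf.one_le _ (ymem t ht))]
  have hfd : ∀ u, HasDerivAt f (deriv f u) u := fun u =>
    (hf.smooth.differentiable (by simp) u).hasDerivAt
  have hrad : ∀ t ∈ Icc 0 T, 0 < 1 - c ^ 2 / f (y t) := fun t ht => by
    have := one_sub_le_one_sub_div (c := c) (f (y t))
    rw [max_eq_left (hf.one_le _ (ymem t ht))] at this
    linarith
  have hfy : ∀ t ∈ Icc 0 T, f (y t) ≠ 0 := fun t ht => by
    have := hf.one_le _ (ymem t ht); positivity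
  have yC1 : ContDiffOn ℝ 1 y (Icc 0 T) := by
    rw [show (1 : ℕ∞ω) = 0 + 1 by norm_num, contDiffOn_succ_iff_derivWithin hu]
    refine ⟨fun t _ => (dy t).differentiableAt.differentiableWithinAt, by simp, ?_⟩
    rw [contDiffOn_zero]
    refine ContinuousOn.congr (f := fun t => crossSpeed c (f (y t))) ?_
      fun t ht => (dy t).hasDerivWithinAt.derivWithin (hu t ht)
    exact ((continuous_crossSpeed c).comp (hfc.comp e.symm.continuous)).continuousOn
  have fyC1 : ContDiffOn ℝ 1 (fun t => f (y t)) (Icc 0 T) :=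
    (hf.smooth.of_le (by exact_mod_cast le_top)).comp_contDiffOn yC1
  have yC2 : ContDiffOn ℝ 2 y (Icc 0 T) := by
    rw [show (2 : ℕ∞ω) = 1 + 1 by norm_num, contDiffOn_succ_iff_derivWithin hu]
    refine ⟨fun t _ => (dy t).differentiableAt.differentiableWithinAt, by simp, ?_⟩
    refine ContDiffOn.congr ?_ Dy
    exact (contDiffOn_const.sub (contDiffOn_const.div fyC1 hfy)).sqrt fun t ht => (hrad t ht).ne'
  have xC2 : ContDiffOn ℝ 2 x (Icc 0 T) := by
    rw [show (2 : ℕ∞ω) = 1 + 1 by norm_num, contDiffOn_succ_iff_derivWithin hu]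
    refine ⟨fun t _ => (dx t).differentiableAt.differentiableWithinAt, by simp, ?_⟩
    refine ContDiffOn.congr ?_ Dx
    exact contDiffOn_const.div fyC1 hfy
  refine ⟨x, y, ⟨xC2, yC2, ymem, ?_, ?_, ?_⟩, ?_, ?_, y0, yT, ?_, ?_, ?_⟩
  · intro t ht
    rw [Dx t ht, Dy t ht, Real.sq_sqrt (hrad t ht).le]
    have := hfy t ht
    field_simp
    ring
  · intro t ht
    have h1 : HasDerivWithinAt (fun t => c / f (y t))
        (-(c * (deriv f (y t) * derivWithin y (Icc 0 T) t)) / f (y t) ^ 2) (Icc 0 T) t := by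
      have h2 := (hfd (y t)).comp_hasDerivWithinAt t (yC1.differentiableOn (by norm_num) t
        ht).hasDerivWithinAt
      have := (hasDerivWithinAt_const t (Icc 0 T) c).div h2 (hfy t ht)
      refine this.congr_deriv ?_
      simp [Function.comp]
    rw [derivWithin_congr Dx (Dx t ht), h1.derivWithin (hu t ht), Dx t ht]
    have := hfy t ht
    field_simp
    ring
  · intro t ht
    have h1 : HasDerivWithinAt (fun t => √(1 - c ^ 2 / f (y t)))
        (c ^ 2 * (deriv f (y t) * derivWithin y (Icc 0 T) t) / f (y t) ^ 2 /
          (2 * √(1 - c ^ 2 / f (y t)))) (Icc 0 T) t := by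
      have h2 := (hfd (y t)).comp_hasDerivWithinAt t (yC1.differentiableOn (by norm_num) t
        ht).hasDerivWithinAt
      have := (((hasDerivWithinAt_const t (Icc 0 T) (c ^ 2)).div h2 (hfy t ht)).const_sub 1).sqrt
        (hrad t ht).ne'
      refine this.congr_deriv ?_
      simp [Function.comp, neg_div]
    rw [derivWithin_congr Dy (Dy t ht), h1.derivWithin (hu t ht), Dx t ht, Dy t ht]
    have := hfy t ht
    have := (Real.sqrt_pos.2 (hrad t ht)).ne'
    generalize √(1 - c ^ 2 / f (y t)) = q at this ⊢
    field_simp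
  · simp [hx, y0, hΞ]
  · simp only [hx, yT]; rfl
  · exact fun t ht => ⟨y0 ▸ ymono ht.1, yT ▸ ymono ht.2⟩
  · rw [(dy 0).hasDerivWithinAt.derivWithin (hu 0 m0)]
    exact crossSpeed_pos hc _
  · rw [Dx 0 m0, y0, hf.zero, div_one]

/-! ### Lengths of curves in the warped strip -/

/-- The calibration `c dx + crossSpeed c (f y) dy` is a closed form of norm `1`, so a curve that
climbs through the strip is at least as long as the crossing time for the same displacement. -/
theorem crossTime_le_integral {f : ℝ → ℝ} (hf : IsWarp f) {c : ℝ} (hc : c ^ 2 < 1)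
    {x y : ℝ → ℝ} (hx : ContDiffOn ℝ 1 x (Icc 0 1)) (hy : ContDiffOn ℝ 1 y (Icc 0 1))
    (hmem : ∀ t ∈ Icc (0 : ℝ) 1, y t ∈ Icc (0 : ℝ) 14) (h0 : y 0 = 0) (h1 : y 1 = 14)
    (hshift : x 1 = x 0 + crossShift f c) :
    crossTime f c ≤ ∫ t in (0 : ℝ)..1, √(f (y t) * derivWithin x (Icc 0 1) t ^ 2 +
      derivWithin y (Icc 0 1) t ^ 2) := by
  have hu := uniqueDiffOn_Icc (zero_lt_one (α := ℝ))
  have hfc := hf.smooth.continuous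
  have dx : ∀ t ∈ Icc (0 : ℝ) 1, HasDerivWithinAt x (derivWithin x (Icc 0 1) t) (Icc 0 1) t :=
    fun t ht => (hx.differentiableOn (by norm_num) t ht).hasDerivWithinAt
  have dy : ∀ t ∈ Icc (0 : ℝ) 1, HasDerivWithinAt y (derivWithin y (Icc 0 1) t) (Icc 0 1) t :=
    fun t ht => (hy.differentiableOn (by norm_num) t ht).hasDerivWithinAt
  have cx := hx.continuousOn_derivWithin hu (by norm_num)
  have cy := hy.continuousOn_derivWithin hu (by norm_num)
  set x' := derivWithin x (Icc 0 1)
  set y' := derivWithin y (Icc 0 1)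
  have cs : Continuous fun u => crossSpeed c (f u) := (continuous_crossSpeed c).comp hfc
  set F : ℝ → ℝ := fun t => c * x t + ∫ u in (0 : ℝ)..y t, crossSpeed c (f u) with hF
  have dF : ∀ t ∈ Icc (0 : ℝ) 1,
      HasDerivWithinAt F (c * x' t + crossSpeed c (f (y t)) * y' t) (Icc 0 1) t := by
    intro t ht
    have : HasDerivAt (fun v => ∫ u in (0 : ℝ)..v, crossSpeed c (f u)) (crossSpeed c (f (y t)))
        (y t) := intervalIntegral.integral_hasDerivAt_right (cs.intervalIntegrable _ _)
      (cs.stronglyMeasurableAtFilter _ _) cs.continuousAt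
    exact ((dx t ht).const_mul c).add (this.comp_hasDerivWithinAt t (dy t ht))
  have cF' : ContinuousOn (fun t => c * x' t + crossSpeed c (f (y t)) * y' t) (Icc 0 1) :=
    (continuousOn_const.mul cx).add ((cs.comp_continuousOn hy.continuousOn).mul cy)
  have ftc : ∫ t in (0 : ℝ)..1, (c * x' t + crossSpeed c (f (y t)) * y' t) = F 1 - F 0 := by
    refine intervalIntegral.integral_eq_sub_of_hasDeriv_right_of_le zero_le_one
      (fun t ht => (dF t ht).continuousWithinAt) (fun t ht => ?_)
      (cF'.intervalIntegrable_of_Icc zero_le_one)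
    exact ((dF t (Ioo_subset_Icc_self ht)).hasDerivAt (Icc_mem_nhds ht.1 ht.2)).hasDerivWithinAt
  have hF01 : F 1 - F 0 = crossTime f c := by
    rw [crossTime_eq hfc hc]
    simp only [hF, h0, h1, hshift, intervalIntegral.integral_same]
    ring
  rw [← hF01, ← ftc]
  refine intervalIntegral.integral_mono_on zero_le_one
    (cF'.intervalIntegrable_of_Icc zero_le_one) ?_ fun t ht => ?_
  · refine ContinuousOn.intervalIntegrable_of_Icc zero_le_one ?_
    exact (((hfc.comp_continuousOn hy.continuousOn).mul (cx.pow 2)).add (cy.pow 2)).sqrt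
  · have hf1 := hf.one_le _ (hmem t ht)
    have hs := crossSpeed_sq hc (f (y t))
    rw [max_eq_left hf1] at hs
    refine Real.le_sqrt_of_sq_le ?_
    set s := crossSpeed c (f (y t))
    set v := f (y t)
    have hv : c ^ 2 = v * (1 - s ^ 2) := by
      rw [hs]; field_simp; ring
    have h2 : v * s ^ 2 = v - c ^ 2 := by linarith
    -- the defect in the Cauchy-Schwarz inequality is a square divided by `v`
    have h3 : 0 ≤ (v * s * x' t - c * y' t) ^ 2 / v := by positivity
    have h4 : (v * s * x' t - c * y' t) ^ 2 / v =
        v * x' t ^ 2 + y' t ^ 2 - (c * x' t + s * y' t) ^ 2 := by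
      rw [div_eq_iff (by positivity)]
      have : c ^ 2 * (y' t ^ 2 + v * x' t ^ 2) =
        v * (1 - s ^ 2) * (y' t ^ 2 + v * x' t ^ 2) := by rw [hv]
      nlinarith [this]
    linarith

theorem abs_sub_le_integral {f : ℝ → ℝ} (hf : IsWarp f)
    {x y : ℝ → ℝ} (hx : ContDiffOn ℝ 1 x (Icc 0 1)) (hy : ContDiffOn ℝ 1 y (Icc 0 1))
    (hmem : ∀ t ∈ Icc (0 : ℝ) 1, y t ∈ Icc (0 : ℝ) 14) :
    |x 1 - x 0| ≤ ∫ t in (0 : ℝ)..1, √(f (y t) * derivWithin x (Icc 0 1) t ^ 2 +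
      derivWithin y (Icc 0 1) t ^ 2) := by
  have hu := uniqueDiffOn_Icc (zero_lt_one (α := ℝ))
  have dx : ∀ t ∈ Icc (0 : ℝ) 1, HasDerivWithinAt x (derivWithin x (Icc 0 1) t) (Icc 0 1) t :=
    fun t ht => (hx.differentiableOn (by norm_num) t ht).hasDerivWithinAt
  have cx := hx.continuousOn_derivWithin hu (by norm_num)
  have cy := hy.continuousOn_derivWithin hu (by norm_num)
  set x' := derivWithin x (Icc 0 1)
  set y' := derivWithin y (Icc 0 1)
  have ftc : ∫ t in (0 : ℝ)..1, x' t = x 1 - x 0 := by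
    refine intervalIntegral.integral_eq_sub_of_hasDeriv_right_of_le zero_le_one
      (fun t ht => (dx t ht).continuousWithinAt) (fun t ht => ?_)
      (cx.intervalIntegrable_of_Icc zero_le_one)
    exact ((dx t (Ioo_subset_Icc_self ht)).hasDerivAt (Icc_mem_nhds ht.1 ht.2)).hasDerivWithinAt
  rw [← ftc]
  refine (intervalIntegral.abs_integral_le_integral_abs zero_le_one).trans ?_
  refine intervalIntegral.integral_mono_on zero_le_one
    (cx.abs.intervalIntegrable_of_Icc zero_le_one) ?_ fun t ht => ?_
  · refine ContinuousOn.intervalIntegrable_of_Icc zero_le_one ?_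
    exact (((hf.smooth.continuous.comp_continuousOn hy.continuousOn).mul (cx.pow 2)).add
      (cy.pow 2)).sqrt
  · have hf1 := hf.one_le _ (hmem t ht)
    rw [← Real.sqrt_sq_eq_abs]
    refine Real.sqrt_le_sqrt ?_
    nlinarith [sq_nonneg (x' t), sq_nonneg (y' t)]

/-! ### The two profiles have the same crossing times and shifts -/

theorem integral_comp_mirror {P G : ℝ → ℝ} (hP : Continuous P) (h6 : ∀ x ≥ 6, P x = 1)
    (hG : Continuous G) :
    ∫ y in (0 : ℝ)..14, G (mirror P y) = 2 * ((∫ y in (0 : ℝ)..6, G (P y)) + G 1) := by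
  have hm : Continuous (mirror P) := by unfold mirror; fun_prop
  have hc : Continuous fun y => G (mirror P y) := hG.comp hm
  have e1 : ∫ y in (7 : ℝ)..14, G (mirror P y) = ∫ y in (0 : ℝ)..7, G (mirror P y) := by
    have := intervalIntegral.integral_comp_sub_left (a := 0) (b := 7) (fun y => G (mirror P y)) 14
    norm_num [mirror_symm] at this
    exact this.symm
  have e2 : ∫ y in (6 : ℝ)..7, G (mirror P y) = G 1 := by
    rw [intervalIntegral.integral_congr (g := fun _ => G 1)]
    · simp; norm_num
    intro y hy
    rw [uIcc_of_le (by norm_num)] at hy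
    simp only [mirror_of_le h6 (by linarith [hy.2] : y ≤ 8), h6 y hy.1]
  have e3 : ∫ y in (0 : ℝ)..6, G (mirror P y) = ∫ y in (0 : ℝ)..6, G (P y) := by
    refine intervalIntegral.integral_congr fun y hy => ?_
    rw [uIcc_of_le (by norm_num)] at hy
    simp only [mirror_of_le h6 (by linarith [hy.2] : y ≤ 8)]
  rw [← intervalIntegral.integral_add_adjacent_intervals (hc.intervalIntegrable 0 7)
    (hc.intervalIntegrable 7 14), e1, ← intervalIntegral.integral_add_adjacent_intervals
    (hc.intervalIntegrable 0 6) (hc.intervalIntegrable 6 7), e2, e3]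
  ring

theorem isWarp_mirror {P : ℝ → ℝ} (hs : ContDiff ℝ ∞ P) (h1 : ∀ x ≥ 0, 1 ≤ P x)
    (h6 : ∀ x ≥ 6, P x = 1) (h0 : P 0 = 1) : IsWarp (mirror P) := by
  refine ⟨contDiff_mirror hs, ?_, mirror_symm P, ?_, ?_⟩
  · intro y hy
    wlog h : y ≤ 8 generalizing y
    · rw [← mirror_symm]
      exact this _ ⟨by linarith [hy.2], by linarith [hy.1]⟩ (by linarith)
    · rw [mirror_of_le h6 h]; exact h1 y hy.1
  · intro y hy
    rw [mirror_of_le h6 hy.2, h6 y hy.1]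
  · rw [mirror_of_le h6 (by norm_num), h0]

theorem IsHalfProfile.isWarp {P : ℝ → ℝ} (hP : IsHalfProfile P) : IsWarp (mirror P) :=
  isWarp_mirror hP.smooth (fun _ => hP.one_le) hP.flat
    (by rw [hP.linear 0 (by norm_num)]; norm_num)

theorem IsHalfProfile.deriv_mirror {P : ℝ → ℝ} (hP : IsHalfProfile P) :
    deriv (mirror P) 0 = 1 := by
  rw [(hasDerivAt_mirror hP.flat hP.smooth (by norm_num)).deriv]
  have : P =ᶠ[𝓝 0] fun x => x + 1 := by
    filter_upwards [Iio_mem_nhds (zero_lt_one (α := ℝ))] with x hx using hP.linear x (le_of_lt hx)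
  rw [this.deriv_eq]; simp

section

variable {P Q X σ : ℝ → ℝ} (hP : IsHalfProfile P) (hQ : IsHalfLineup P Q X σ)
include hQ

theorem IsHalfLineup.deriv_mirror : deriv (mirror Q) 0 = 0 := by
  rw [(hasDerivAt_mirror hQ.flat hQ.smooth (by norm_num)).deriv, hQ.deriv_zero]

include hP

theorem IsHalfLineup.isWarp : IsWarp (mirror Q) :=
  isWarp_mirror hQ.smooth (fun x _ => hQ.one_le hP x) hQ.flat (hQ.flat_left le_rfl)

theorem IsHalfLineup.integral_mirror_eq {G : ℝ → ℝ} (hG : Continuous G) :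
    ∫ y in (0 : ℝ)..14, G (mirror Q y) = ∫ y in (0 : ℝ)..14, G (mirror P y) := by
  rw [integral_comp_mirror hQ.smooth.continuous hQ.flat hG,
    integral_comp_mirror hP.smooth.continuous hP.flat hG, hQ.integral_comp_eq hG hP]

theorem IsHalfLineup.crossTime_eq {c : ℝ} (hc : c ^ 2 < 1) :
    crossTime (mirror Q) c = crossTime (mirror P) c :=
  hQ.integral_mirror_eq hP (continuous_inv_crossSpeed hc)

theorem IsHalfLineup.crossShift_eq {c : ℝ} (hc : c ^ 2 < 1) :
    crossShift (mirror Q) c = crossShift (mirror P) c :=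
  hQ.integral_mirror_eq hP (continuous_shift_integrand hc)

end

/-! ### Deck transformations of the strip -/

theorem mem_strip {p : ℝ × ℝ} : p ∈ strip ↔ p.2 ∈ Icc (0 : ℝ) 14 := by simp [strip]

theorem fst_mem_strip (x : ℝ) {y : ℝ} (hy : y ∈ Icc (0 : ℝ) 14) : (x, y) ∈ strip := mem_strip.2 hy

/-- The identity for `ε = 1`, and the reflection `y ↦ 14 - y` of the fibre for `ε = -1`. -/
def fiberFlip (ε : ℤˣ) (y : ℝ) : ℝ := ((ε : ℤ) : ℝ) * (y - 7) + 7

@[simp] theorem fiberFlip_one (y : ℝ) : fiberFlip 1 y = y := by simp [fiberFlip]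

@[simp] theorem fiberFlip_neg_one (y : ℝ) : fiberFlip (-1) y = 14 - y := by
  simp [fiberFlip]; ring

theorem fiberFlip_mul (ε ε' : ℤˣ) (y : ℝ) :
    fiberFlip (ε * ε') y = fiberFlip ε (fiberFlip ε' y) := by
  simp [fiberFlip]; ring

theorem fiberFlip_fiberFlip (ε : ℤˣ) (y : ℝ) : fiberFlip ε (fiberFlip ε y) = y := by
  rw [← fiberFlip_mul, Int.units_mul_self, fiberFlip_one]

theorem fiberFlip_mem {ε : ℤˣ} {y : ℝ} (hy : y ∈ Icc (0 : ℝ) 14) :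
    fiberFlip ε y ∈ Icc (0 : ℝ) 14 := by
  rcases Int.units_eq_one_or ε with rfl | rfl
  · simpa using hy
  · rw [fiberFlip_neg_one]; exact ⟨by linarith [hy.2], by linarith [hy.1]⟩

theorem continuous_fiberFlip (ε : ℤˣ) : Continuous (fiberFlip ε) := by unfold fiberFlip; fun_prop

theorem IsWarp.comp_fiberFlip {f : ℝ → ℝ} (hf : IsWarp f) (ε : ℤˣ) (y : ℝ) :
    f (fiberFlip ε y) = f y := by
  rcases Int.units_eq_one_or ε with rfl | rfl
  · simp
  · rw [fiberFlip_neg_one, hf.symm]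

theorem IsWarp.deriv_fiberFlip {f : ℝ → ℝ} (hf : IsWarp f) (ε : ℤˣ) (y : ℝ) :
    deriv f (fiberFlip ε y) = ((ε : ℤ) : ℝ) * deriv f y := by
  rcases Int.units_eq_one_or ε with rfl | rfl
  · simp
  · rw [fiberFlip_neg_one, hf.deriv_symm]; simp

/-- The strip, as a space on which the slides by multiples of `ℓ` act, combined with reflections. -/
def StripCover (_ : ℝ) : Type := {p : ℝ × ℝ // p ∈ strip}

namespace StripCover

variable {ℓ : ℝ}

instance : TopologicalSpace (StripCover ℓ) := instTopologicalSpaceSubtype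

/-- The coordinate along the strip. -/
def fst (p : StripCover ℓ) : ℝ := p.1.1

/-- The coordinate across the strip. -/
def snd (p : StripCover ℓ) : ℝ := p.1.2

/-- The point of the strip with the given coordinates, the second one being clamped. -/
def mk (ℓ : ℝ) (p : ℝ × ℝ) : StripCover ℓ :=
  ⟨(p.1, projIcc 0 14 (by norm_num) p.2), mem_strip.2 (projIcc 0 14 (by norm_num) p.2).2⟩

theorem snd_mem (p : StripCover ℓ) : p.snd ∈ Icc (0 : ℝ) 14 := mem_strip.1 p.2

@[ext] theorem ext {p q : StripCover ℓ} (h1 : p.fst = q.fst) (h2 : p.snd = q.snd) : p = q :=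
  Subtype.ext (Prod.ext h1 h2)

@[simp] theorem fst_mk (p : ℝ × ℝ) : (mk ℓ p).fst = p.1 := rfl

theorem snd_mk {p : ℝ × ℝ} (hp : p.2 ∈ Icc (0 : ℝ) 14) : (mk ℓ p).snd = p.2 := by
  have := projIcc_of_mem (by norm_num : (0 : ℝ) ≤ 14) hp
  exact congrArg Subtype.val this

@[simp] theorem mk_eta (p : StripCover ℓ) : mk ℓ (p.fst, p.snd) = p :=
  ext rfl (snd_mk p.snd_mem)

theorem continuous_fst : Continuous (fst : StripCover ℓ → ℝ) :=
  _root_.continuous_fst.comp continuous_subtype_val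

theorem continuous_snd : Continuous (snd : StripCover ℓ → ℝ) :=
  _root_.continuous_snd.comp continuous_subtype_val

theorem continuous_mk : Continuous (mk ℓ) := by
  unfold mk
  exact Continuous.subtype_mk (_root_.continuous_fst.prodMk
    (continuous_subtype_val.comp (continuous_projIcc.comp _root_.continuous_snd))) _

instance : T2Space (StripCover ℓ) := inferInstanceAs (T2Space {p : ℝ × ℝ // p ∈ strip})

instance : SecondCountableTopology (StripCover ℓ) :=
  inferInstanceAs (SecondCountableTopology {p : ℝ × ℝ // p ∈ strip})

theorem isClosed_strip : IsClosed strip := isClosed_univ.prod isClosed_Icc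

instance : LocallyCompactSpace (StripCover ℓ) :=
  isClosed_strip.isClosedEmbedding_subtypeVal.locallyCompactSpace

instance : ConnectedSpace (StripCover ℓ) :=
  isConnected_iff_connectedSpace.1
    (isConnected_univ.prod (isConnected_Icc (by norm_num : (0 : ℝ) ≤ 14)))

instance : MulAction (Multiplicative ℤ × ℤˣ) (StripCover ℓ) where
  smul g p := ⟨(p.fst + (g.1.toAdd : ℝ) * ℓ, fiberFlip g.2 p.snd),
    mem_strip.2 (fiberFlip_mem p.snd_mem)⟩
  one_smul p := by
    refine ext ?_ ?_
    · change p.fst + ((0 : ℤ) : ℝ) * ℓ = p.fst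
      simp
    · exact fiberFlip_one _
  mul_smul g h p := by
    refine ext ?_ ?_
    · change p.fst + ((g.1.toAdd + h.1.toAdd : ℤ) : ℝ) * ℓ =
        p.fst + (h.1.toAdd : ℝ) * ℓ + (g.1.toAdd : ℝ) * ℓ
      push_cast; ring
    · exact fiberFlip_mul _ _ _

theorem fst_smul (g : Multiplicative ℤ × ℤˣ) (p : StripCover ℓ) :
    (g • p).fst = p.fst + (g.1.toAdd : ℝ) * ℓ := rfl

theorem snd_smul (g : Multiplicative ℤ × ℤˣ) (p : StripCover ℓ) :
    (g • p).snd = fiberFlip g.2 p.snd := rfl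

theorem continuous_smul (g : Multiplicative ℤ × ℤˣ) :
    Continuous fun p : StripCover ℓ => g • p :=
  Continuous.subtype_mk ((continuous_fst.add continuous_const).prodMk
    ((continuous_fiberFlip _).comp continuous_snd)) _

end StripCover

/-- The group of deck transformations: the graph of the homomorphism from the group of slides that
says which of them are combined with a reflection. For the strip it is trivial. -/
def StripSurface.deck : StripSurface → Subgroup (Multiplicative ℤ × ℤˣ)
  | .strip => ⊥
  | .cylinder => (1 : Multiplicative ℤ →* ℤˣ).graph
  | .moebius => (zpowersHom ℤˣ (-1)).graph

theorem StripSurface.eq_one_of_mem_deck {S : StripSurface} {g : Multiplicative ℤ × ℤˣ}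
    (hg : g ∈ S.deck) (h1 : g.1.toAdd = 0) : g = 1 := by
  have h1' : g.1 = 1 := h1
  cases S with
  | strip => exact Subgroup.mem_bot.1 hg
  | cylinder =>
    have : (1 : Multiplicative ℤ →* ℤˣ) g.1 = g.2 := MonoidHom.mem_graph.1 hg
    exact Prod.ext h1' (by rw [← this]; rfl)
  | moebius =>
    have : zpowersHom ℤˣ (-1) g.1 = g.2 := MonoidHom.mem_graph.1 hg
    exact Prod.ext h1' (by rw [← this, h1', map_one]; rfl)

/-! ### The quotient surfaces -/

/-- The quotient of the strip by the deck transformations. -/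
def QuotientSurface (S : StripSurface) (ℓ : ℝ) : Type :=
  MulAction.orbitRel.Quotient S.deck (StripCover ℓ)

namespace QuotientSurface

variable {S : StripSurface} {ℓ : ℝ}

instance : TopologicalSpace (QuotientSurface S ℓ) :=
  inferInstanceAs (TopologicalSpace (Quotient (MulAction.orbitRel S.deck (StripCover ℓ))))

/-- The projection of the strip to its quotient. -/
def proj (S : StripSurface) (p : StripCover ℓ) : QuotientSurface S ℓ :=
  Quotient.mk (MulAction.orbitRel S.deck (StripCover ℓ)) p

instance : ContinuousConstSMul S.deck (StripCover ℓ) :=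
  ⟨fun g => StripCover.continuous_smul g.1⟩

theorem proj_eq_iff {p q : StripCover ℓ} : proj S p = proj S q ↔ ∃ g ∈ S.deck, g • q = p := by
  refine (Quotient.eq (r := MulAction.orbitRel S.deck (StripCover ℓ))).trans ?_
  constructor
  · rintro ⟨g, hg⟩; exact ⟨g.1, g.2, hg⟩
  · rintro ⟨g, hg, h⟩; exact ⟨⟨g, hg⟩, h⟩

theorem proj_smul {g : Multiplicative ℤ × ℤˣ} (hg : g ∈ S.deck) (p : StripCover ℓ) :
    proj S (g • p) = proj S p := proj_eq_iff.2 ⟨g, hg, rfl⟩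

theorem isQuotientMap_proj : IsQuotientMap (proj S : StripCover ℓ → QuotientSurface S ℓ) :=
  isQuotientMap_quotient_mk'

theorem continuous_proj : Continuous (proj S : StripCover ℓ → QuotientSurface S ℓ) :=
  isQuotientMap_proj.continuous

theorem surjective_proj : Function.Surjective (proj S : StripCover ℓ → QuotientSurface S ℓ) :=
  isQuotientMap_proj.surjective

theorem isOpenMap_proj : IsOpenMap (proj S : StripCover ℓ → QuotientSurface S ℓ) :=
  isOpenMap_quotient_mk'_mul (Γ := S.deck)

instance : SecondCountableTopology (QuotientSurface S ℓ) :=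
  ContinuousConstSMul.secondCountableTopology (Γ := S.deck)

instance : ConnectedSpace (QuotientSurface S ℓ) :=
  surjective_proj.connectedSpace continuous_proj

section

variable [hℓ : Fact (0 < ℓ)]

/-- A deck transformation that moves a point by less than `ℓ` along the strip is trivial. -/
theorem _root_.StripSurface.eq_one_of_abs_lt {g : Multiplicative ℤ × ℤˣ} (hg : g ∈ S.deck)
    {p : StripCover ℓ} (h : |(g • p).fst - p.fst| < ℓ) : g = 1 := by
  refine StripSurface.eq_one_of_mem_deck hg ?_
  rw [StripCover.fst_smul, add_sub_cancel_left, abs_mul, abs_of_pos hℓ.out] at h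
  have h1 : |(g.1.toAdd : ℝ)| < 1 := by
    by_contra! h'
    have := mul_le_mul_of_nonneg_right h' hℓ.out.le
    linarith
  have h2 : |g.1.toAdd| < 1 := by exact_mod_cast h1
  exact Int.abs_lt_one_iff.1 h2

theorem isQuotientCoveringMap_proj :
    IsQuotientCoveringMap (proj S : StripCover ℓ → QuotientSurface S ℓ) S.deck where
  toIsQuotientMap := isQuotientMap_proj
  continuous_const_smul := fun g => StripCover.continuous_smul g.1
  apply_eq_iff_mem_orbit := Quotient.eq
  disjoint e := by
    refine ⟨{p | |p.fst - e.fst| < ℓ / 2}, ?_, ?_⟩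
    · refine IsOpen.mem_nhds (isOpen_lt ?_ continuous_const) ?_
      · exact (StripCover.continuous_fst.sub continuous_const).abs
      · simpa using hℓ.out
    · rintro g ⟨_, ⟨p, hp, rfl⟩, hq⟩
      have hp' : |p.fst - e.fst| < ℓ / 2 := hp
      have hq' : |(g.1 • p).fst - e.fst| < ℓ / 2 := hq
      refine Subtype.ext (StripSurface.eq_one_of_abs_lt (p := p) g.2 ?_)
      rw [abs_lt] at *
      constructor <;> linarith [hp'.1, hp'.2, hq'.1, hq'.2]

theorem isCoveringMap_proj : IsCoveringMap (proj S : StripCover ℓ → QuotientSurface S ℓ) :=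
  isQuotientCoveringMap_proj.isCoveringMap

instance : ProperlyDiscontinuousSMul S.deck (StripCover ℓ) where
  finite_disjoint_inter_image := by
    intro K L hK hL
    obtain ⟨C, hC⟩ := (hK.image StripCover.continuous_fst).isBounded.exists_norm_le
    obtain ⟨D, hD⟩ := (hL.image StripCover.continuous_fst).isBounded.exists_norm_le
    set N : ℤ := ⌈(C + D) / ℓ⌉
    have hfin : ((fun g : S.deck => g.1.1.toAdd) ⁻¹' Icc (-N) N).Finite := by
      refine (finite_Icc (-N) N).preimage fun g _ h _ hgh => ?_
      have : (g * h⁻¹).1.1.toAdd = 0 := by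
        change g.1.1.toAdd + -h.1.1.toAdd = 0
        have h' : g.1.1.toAdd = h.1.1.toAdd := hgh
        rw [h']; ring
      have := StripSurface.eq_one_of_mem_deck (g * h⁻¹).2 this
      exact mul_inv_eq_one.1 (Subtype.ext this)
    refine hfin.subset ?_
    rintro g hg
    obtain ⟨_, ⟨p, hp, rfl⟩, hq⟩ := hg
    have h1 := hC _ ⟨p, hp, rfl⟩
    have h2 : ‖(g.1 • p).fst‖ ≤ D := hD _ ⟨_, hq, rfl⟩
    rw [StripCover.fst_smul] at h2
    rw [Real.norm_eq_abs, abs_le] at h1 h2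
    have h3 : |(g.1.1.toAdd : ℝ)| ≤ (C + D) / ℓ := by
      rw [le_div_iff₀ hℓ.out]
      conv_lhs => rw [← abs_of_pos hℓ.out, ← abs_mul]
      rw [abs_le]
      constructor <;> linarith [h1.1, h1.2, h2.1, h2.2]
    have h4 : |(g.1.1.toAdd : ℝ)| ≤ N := h3.trans (Int.le_ceil _)
    have h5 : |g.1.1.toAdd| ≤ N := by exact_mod_cast h4
    exact abs_le.1 h5

instance : T2Space (QuotientSurface S ℓ) :=
  inferInstanceAs (T2Space (Quotient (MulAction.orbitRel S.deck (StripCover ℓ))))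

end

/-! ### Charts -/

/-- The point of the half-space with the given coordinates. -/
def halfSpacePoint (u v : ℝ) (hu : 0 ≤ u) : EuclideanHalfSpace 2 := ⟨!₂[u, v], by simpa using hu⟩

/-- The coordinates on the strip that start at the boundary component singled out by `ε`. -/
def coverCoord (ε : ℤˣ) (p : StripCover ℓ) : EuclideanHalfSpace 2 :=
  halfSpacePoint (fiberFlip ε p.snd) p.fst (fiberFlip_mem p.snd_mem).1

/-- The inverse of `coverCoord`; the coordinate across the strip is clamped. -/
def coverPoint (ℓ : ℝ) (ε : ℤˣ) (h : EuclideanHalfSpace 2) : StripCover ℓ :=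
  StripCover.mk ℓ (h.1 1, fiberFlip ε (h.1 0))

theorem continuous_coverCoord (ε : ℤˣ) :
    Continuous (coverCoord ε : StripCover ℓ → EuclideanHalfSpace 2) := by
  refine Continuous.subtype_mk ((PiLp.continuous_toLp 2 _).comp (continuous_pi fun i => ?_)) _
  fin_cases i
  · exact (continuous_fiberFlip ε).comp StripCover.continuous_snd
  · exact StripCover.continuous_fst

theorem continuous_coverPoint (ε : ℤˣ) : Continuous (coverPoint ℓ ε) := by
  refine StripCover.continuous_mk.comp (Continuous.prodMk ?_ ((continuous_fiberFlip ε).comp ?_))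
  · exact (PiLp.continuous_apply 2 _ 1).comp continuous_subtype_val
  · exact (PiLp.continuous_apply 2 _ 0).comp continuous_subtype_val

theorem coverPoint_coverCoord (ε : ℤˣ) (p : StripCover ℓ) :
    coverPoint ℓ ε (coverCoord ε p) = p := by
  have : fiberFlip ε ((coverCoord ε p).1 0) = p.snd := by
    simp [coverCoord, halfSpacePoint, fiberFlip_fiberFlip]
  refine StripCover.ext ?_ ?_
  · simp [coverPoint, coverCoord, halfSpacePoint]
  · rw [coverPoint, StripCover.snd_mk]
    · exact this
    · simp only [this]; exact p.snd_mem

theorem snd_coverPoint {ε : ℤˣ} {h : EuclideanHalfSpace 2} (hh : h.1 0 ≤ 14) :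
    (coverPoint ℓ ε h).snd = fiberFlip ε (h.1 0) :=
  StripCover.snd_mk (fiberFlip_mem ⟨h.2, hh⟩)

theorem coverCoord_coverPoint {ε : ℤˣ} {h : EuclideanHalfSpace 2} (hh : h.1 0 ≤ 14) :
    coverCoord ε (coverPoint ℓ ε h) = h := by
  refine EuclideanHalfSpace.ext _ _ ?_
  ext i
  fin_cases i
  · simp [coverCoord, halfSpacePoint, snd_coverPoint hh, fiberFlip_fiberFlip]
  · simp [coverCoord, halfSpacePoint, coverPoint]

/-- The domain in the half-space of a local parametrization: an interval of length `ℓ` times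
`[0, 14)`. -/
def chartDomain (ℓ a : ℝ) : Set (EuclideanHalfSpace 2) := {h | h.1 0 < 14 ∧ |h.1 1 - a| < ℓ / 2}

theorem isOpen_chartDomain (ℓ a : ℝ) : IsOpen (chartDomain ℓ a) := by
  have h0 : Continuous fun h : EuclideanHalfSpace 2 => h.1 0 :=
    (PiLp.continuous_apply 2 _ 0).comp continuous_subtype_val
  have h1 : Continuous fun h : EuclideanHalfSpace 2 => h.1 1 :=
    (PiLp.continuous_apply 2 _ 1).comp continuous_subtype_val
  exact (isOpen_lt h0 continuous_const).inter
    (isOpen_lt (h1.sub continuous_const).abs continuous_const)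

theorem injOn_param [Fact (0 < ℓ)] (a : ℝ) (ε : ℤˣ) :
    InjOn (fun h => proj S (coverPoint ℓ ε h)) (chartDomain ℓ a) := by
  intro h hh k hk heq
  obtain ⟨g, hg, he⟩ := proj_eq_iff.1 heq
  have hg1 : g = 1 := by
    refine StripSurface.eq_one_of_abs_lt (p := coverPoint ℓ ε k) hg ?_
    rw [he]
    have h1 := hh.2
    have h2 := hk.2
    simp only [coverPoint, StripCover.fst_mk]
    rw [abs_lt] at *
    constructor <;> linarith [h1.1, h1.2, h2.1, h2.2]
  rw [hg1, one_smul] at he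
  rw [← coverCoord_coverPoint (ℓ := ℓ) (ε := ε) hh.1.le, ← he, coverCoord_coverPoint hk.1.le]

theorem isOpenMap_param (a : ℝ) (ε : ℤˣ) :
    IsOpenMap ((chartDomain ℓ a).domRestrict fun h => proj S (coverPoint ℓ ε h)) := by
  intro V hV
  obtain ⟨W, hW, rfl⟩ := isOpen_induced_iff.1 hV
  have : (chartDomain ℓ a).domRestrict (fun h => proj S (coverPoint ℓ ε h)) '' (Subtype.val ⁻¹' W) =
      proj S '' (coverCoord ε ⁻¹' (W ∩ chartDomain ℓ a)) := by
    ext m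
    constructor
    · rintro ⟨⟨h, hh⟩, hw, rfl⟩
      refine ⟨coverPoint ℓ ε h, ?_, rfl⟩
      rw [mem_preimage, coverCoord_coverPoint hh.1.le]
      exact ⟨hw, hh⟩
    · rintro ⟨p, ⟨hw, hh⟩, rfl⟩
      exact ⟨⟨coverCoord ε p, hh⟩, hw, by
        change proj S (coverPoint ℓ ε (coverCoord ε p)) = _
        rw [coverPoint_coverCoord]⟩
  rw [this]
  exact isOpenMap_proj _ (((hW.inter (isOpen_chartDomain ℓ a)).preimage (continuous_coverCoord ε)))

variable [hℓ : Fact (0 < ℓ)]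

/-- The local parametrization of the surface on `chartDomain ℓ a`. -/
def param (S : StripSurface) (ℓ : ℝ) [Fact (0 < ℓ)] (a : ℝ) (ε : ℤˣ) :
    OpenPartialHomeomorph (EuclideanHalfSpace 2) (QuotientSurface S ℓ) :=
  haveI : Nonempty (EuclideanHalfSpace 2) := ⟨0⟩
  OpenPartialHomeomorph.ofContinuousOpenRestrict (injOn_param (S := S) (ℓ := ℓ) a ε).toPartialEquiv
    (continuous_proj.comp (continuous_coverPoint ε)).continuousOn (isOpenMap_param a ε)
    (isOpen_chartDomain ℓ a)

theorem param_apply (a : ℝ) (ε : ℤˣ) (h : EuclideanHalfSpace 2) :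
    param S ℓ a ε h = proj S (coverPoint ℓ ε h) := rfl

theorem source_param (a : ℝ) (ε : ℤˣ) : (param S ℓ a ε).source = chartDomain ℓ a := rfl

theorem proj_mem_target_param {a : ℝ} {ε : ℤˣ} {p : StripCover ℓ}
    (h : coverCoord ε p ∈ chartDomain ℓ a) : proj S p ∈ (param S ℓ a ε).target := by
  have := (param S ℓ a ε).map_source (x := coverCoord ε p) h
  rwa [param_apply, coverPoint_coverCoord] at this

theorem param_symm_proj {a : ℝ} {ε : ℤˣ} {p : StripCover ℓ}
    (h : coverCoord ε p ∈ chartDomain ℓ a) :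
    (param S ℓ a ε).symm (proj S p) = coverCoord ε p := by
  have := (param S ℓ a ε).left_inv (x := coverCoord ε p) h
  rwa [param_apply, coverPoint_coverCoord] at this

/-- The boundary component from which the preferred chart at a point of the strip starts: the closer
one. -/
def nearSign (p : StripCover ℓ) : ℤˣ := if p.snd ≤ 7 then 1 else -1

theorem coverCoord_nearSign_mem (p : StripCover ℓ) :
    coverCoord (nearSign p) p ∈ chartDomain ℓ p.fst := by
  constructor
  · simp only [coverCoord, halfSpacePoint, nearSign]
    split_ifs with h
    · simp; linarith
    · simp; linarith
  · simpa [coverCoord, halfSpacePoint] using hℓ.out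

instance : ChartedSpace (EuclideanHalfSpace 2) (QuotientSurface S ℓ) where
  atlas := {e | ∃ a ε, e = (param S ℓ a ε).symm}
  chartAt m := (param S ℓ (Quotient.out m).fst (nearSign (Quotient.out m))).symm
  mem_chart_source m := by
    have h := proj_mem_target_param (S := S) (coverCoord_nearSign_mem (Quotient.out m))
    have e : proj S (Quotient.out m) = m := Quotient.out_eq m
    rw [e] at h
    exact h
  chart_mem_atlas m := ⟨_, _, rfl⟩

theorem mem_atlas_iff {e : OpenPartialHomeomorph (QuotientSurface S ℓ) (EuclideanHalfSpace 2)} :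
    e ∈ atlas (EuclideanHalfSpace 2) (QuotientSurface S ℓ) ↔ ∃ a ε, e = (param S ℓ a ε).symm :=
  Iff.rfl

end QuotientSurface

/-! ### The smooth structure of the quotient surfaces -/

/-- The derivative of the coordinates `stripCoord ε k`. -/
def stripCoordL (ε : ℤˣ) : ℝ × ℝ →L[ℝ] EuclideanSpace ℝ (Fin 2) :=
  LinearMap.toContinuousLinearMap
    { toFun := fun v => !₂[((ε : ℤ) : ℝ) * v.2, v.1]
      map_add' := fun v w => by ext i; fin_cases i <;> simp [mul_add]
      map_smul' := fun c v => by ext i; fin_cases i <;> simp; ring }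

/-- Coordinates on the strip that are adapted to the boundary: up to reflection and translation, the
two coordinates of the strip in reverse order. -/
def stripCoord (ε : ℤˣ) (k : ℝ) (p : ℝ × ℝ) : EuclideanSpace ℝ (Fin 2) :=
  !₂[fiberFlip ε p.2, p.1 + k]

/-- The derivative of `stripPoint ε`. -/
def stripPointL (ε : ℤˣ) : EuclideanSpace ℝ (Fin 2) →L[ℝ] ℝ × ℝ :=
  LinearMap.toContinuousLinearMap
    { toFun := fun z => (z 1, ((ε : ℤ) : ℝ) * z 0)
      map_add' := fun v w => by ext <;> simp [mul_add]
      map_smul' := fun c v => by ext <;> simp; ring }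

/-- The inverse of the coordinates `stripCoord ε 0`. -/
def stripPoint (ε : ℤˣ) (z : EuclideanSpace ℝ (Fin 2)) : ℝ × ℝ := (z 1, fiberFlip ε (z 0))

@[simp] theorem stripCoordL_apply_zero (ε : ℤˣ) (v : ℝ × ℝ) :
    stripCoordL ε v 0 = ((ε : ℤ) : ℝ) * v.2 := rfl

@[simp] theorem stripCoordL_apply_one (ε : ℤˣ) (v : ℝ × ℝ) : stripCoordL ε v 1 = v.1 := rfl

@[simp] theorem stripPointL_apply (ε : ℤˣ) (z : EuclideanSpace ℝ (Fin 2)) :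
    stripPointL ε z = (z 1, ((ε : ℤ) : ℝ) * z 0) := rfl

@[simp] theorem stripCoord_apply_zero (ε : ℤˣ) (k : ℝ) (p : ℝ × ℝ) :
    stripCoord ε k p 0 = fiberFlip ε p.2 := rfl

@[simp] theorem stripCoord_apply_one (ε : ℤˣ) (k : ℝ) (p : ℝ × ℝ) :
    stripCoord ε k p 1 = p.1 + k := rfl

theorem units_mul_self_real (ε : ℤˣ) : ((ε : ℤ) : ℝ) * ((ε : ℤ) : ℝ) = 1 := by
  rcases Int.units_eq_one_or ε with rfl | rfl <;> simp

theorem stripCoord_eq (ε : ℤˣ) (k : ℝ) (p : ℝ × ℝ) :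
    stripCoord ε k p = stripCoordL ε p + !₂[7 - 7 * ((ε : ℤ) : ℝ), k] := by
  ext i
  fin_cases i
  · simp [fiberFlip]; ring
  · simp

theorem stripPoint_eq (ε : ℤˣ) (z : EuclideanSpace ℝ (Fin 2)) :
    stripPoint ε z = stripPointL ε z + (0, 7 - 7 * ((ε : ℤ) : ℝ)) := by
  refine Prod.ext ?_ ?_
  · simp [stripPoint]
  · simp [stripPoint, fiberFlip]; ring

theorem hasFDerivAt_stripCoord (ε : ℤˣ) (k : ℝ) (p : ℝ × ℝ) :
    HasFDerivAt (stripCoord ε k) (stripCoordL ε) p := by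
  rw [funext (stripCoord_eq ε k)]
  exact (stripCoordL ε).hasFDerivAt.add_const _

theorem hasFDerivAt_stripPoint (ε : ℤˣ) (z : EuclideanSpace ℝ (Fin 2)) :
    HasFDerivAt (stripPoint ε) (stripPointL ε) z := by
  rw [funext (stripPoint_eq ε)]
  exact (stripPointL ε).hasFDerivAt.add_const _

theorem contDiff_stripCoord (ε : ℤˣ) (k : ℝ) {n : ℕ∞ω} : ContDiff ℝ n (stripCoord ε k) := by
  rw [funext (stripCoord_eq ε k)]
  exact (stripCoordL ε).contDiff.add contDiff_const

theorem contDiff_stripPoint (ε : ℤˣ) {n : ℕ∞ω} : ContDiff ℝ n (stripPoint ε) := by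
  rw [funext (stripPoint_eq ε)]
  exact (stripPointL ε).contDiff.add contDiff_const

/-- Up to a translation, `stripPoint ε` inverts `stripCoord ε k`. -/
theorem stripPoint_stripCoord (ε : ℤˣ) (k : ℝ) (p : ℝ × ℝ) :
    stripPoint ε (stripCoord ε k p) = (p.1 + k, p.2) := by
  simp [stripPoint, fiberFlip_fiberFlip]

theorem stripPoint_mem (ε : ℤˣ) {z : EuclideanSpace ℝ (Fin 2)} (hz : z 0 ∈ Icc (0 : ℝ) 14) :
    stripPoint ε z ∈ strip := fst_mem_strip _ (fiberFlip_mem hz)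

theorem eventually_mem_target {M : Type*} [TopologicalSpace M]
    {e : OpenPartialHomeomorph M (EuclideanHalfSpace 2)}
    {z : EuclideanSpace ℝ (Fin 2)} (hz : z ∈ (e.extend (𝓡∂ 2)).target) :
    (e.extend (𝓡∂ 2)).target ∈ 𝓝[range (𝓡∂ 2)] z := by
  have h := e.extend_target_mem_nhdsWithin (I := 𝓡∂ 2) (y := (e.extend (𝓡∂ 2)).symm z)
    (by rw [← e.extend_source (I := 𝓡∂ 2)]; exact (e.extend (𝓡∂ 2)).map_target hz)
  rwa [(e.extend (𝓡∂ 2)).right_inv hz] at h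

namespace QuotientSurface

variable {S : StripSurface} {ℓ : ℝ}

/-- The projection of the strip to the quotient surface, with the second coordinate clamped outside
the strip. -/
def stripMap (S : StripSurface) (ℓ : ℝ) (p : ℝ × ℝ) : QuotientSurface S ℓ :=
  proj S (StripCover.mk ℓ p)

theorem continuous_stripMap : Continuous (stripMap S ℓ) :=
  continuous_proj.comp StripCover.continuous_mk

theorem exists_stripMap_eq (m : QuotientSurface S ℓ) : ∃ p ∈ strip, stripMap S ℓ p = m := by
  obtain ⟨p, rfl⟩ := surjective_proj m
  exact ⟨(p.fst, p.snd), fst_mem_strip _ p.snd_mem, by rw [stripMap, StripCover.mk_eta]⟩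

variable [hℓ : Fact (0 < ℓ)]

theorem mem_target_extend {a : ℝ} {ε : ℤˣ} {z : EuclideanSpace ℝ (Fin 2)} :
    z ∈ ((param S ℓ a ε).symm.extend (𝓡∂ 2)).target ↔
      (0 ≤ z 0 ∧ z 0 < 14) ∧ |z 1 - a| < ℓ / 2 := by
  rw [OpenPartialHomeomorph.extend_target, range_modelWithCornersEuclideanHalfSpace]
  constructor
  · rintro ⟨h, h0⟩
    have h' : (𝓡∂ 2).symm z ∈ chartDomain ℓ a := h
    have e : ((𝓡∂ 2).symm z).1 = z := (𝓡∂ 2).right_inv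
      (by rw [range_modelWithCornersEuclideanHalfSpace]; exact h0)
    rw [chartDomain, mem_ofPred_eq, e] at h'
    exact ⟨⟨h0, h'.1⟩, h'.2⟩
  · rintro ⟨⟨h0, h1⟩, h2⟩
    have e : ((𝓡∂ 2).symm z).1 = z := (𝓡∂ 2).right_inv
      (by rw [range_modelWithCornersEuclideanHalfSpace]; exact h0)
    refine ⟨?_, h0⟩
    change (𝓡∂ 2).symm z ∈ chartDomain ℓ a
    rw [chartDomain, mem_ofPred_eq, e]
    exact ⟨h1, h2⟩

theorem extend_symm_eq {a : ℝ} {ε : ℤˣ} {z : EuclideanSpace ℝ (Fin 2)}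
    (hz : z ∈ ((param S ℓ a ε).symm.extend (𝓡∂ 2)).target) :
    ((param S ℓ a ε).symm.extend (𝓡∂ 2)).symm z = stripMap S ℓ (stripPoint ε z) := by
  have e : ((𝓡∂ 2).symm z).1 = z := (𝓡∂ 2).right_inv
    (by rw [range_modelWithCornersEuclideanHalfSpace]; exact (mem_target_extend.1 hz).1.1)
  change proj S (coverPoint ℓ ε ((𝓡∂ 2).symm z)) = _
  rw [coverPoint, e]; rfl

/-- Every chart of the atlas reads, near a point of the strip, as a reflection and translation of the
coordinates of the strip. -/
theorem eventually_extend_eq {e : OpenPartialHomeomorph (QuotientSurface S ℓ) (EuclideanHalfSpace 2)}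
    (he : e ∈ atlas (EuclideanHalfSpace 2) (QuotientSurface S ℓ)) {p : ℝ × ℝ}
    (h : stripMap S ℓ p ∈ e.source) : ∃ (ε : ℤˣ) (k : ℝ), ∀ᶠ q in 𝓝[strip] p,
      stripMap S ℓ q ∈ e.source ∧ e.extend (𝓡∂ 2) (stripMap S ℓ q) = stripCoord ε k q := by
  obtain ⟨a, ε, rfl⟩ := mem_atlas_iff.1 he
  have ht : stripMap S ℓ p ∈ (param S ℓ a ε).target := h
  have hs := (param S ℓ a ε).map_target ht
  have hr := (param S ℓ a ε).right_inv ht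
  rw [param_apply] at hr
  obtain ⟨g, hg, hgp⟩ := proj_eq_iff.1 hr
  rw [source_param] at hs
  have hcont : Continuous fun q => coverCoord ε (g • StripCover.mk ℓ q) :=
    (continuous_coverCoord ε).comp ((StripCover.continuous_smul g).comp StripCover.continuous_mk)
  have hp : coverCoord ε (g • StripCover.mk ℓ p) ∈ chartDomain ℓ a := by
    rw [hgp, coverCoord_coverPoint hs.1.le]; exact hs
  refine ⟨ε * g.2, (g.1.toAdd : ℝ) * ℓ, ?_⟩
  have hev := (hcont.tendsto p).eventually ((isOpen_chartDomain ℓ a).mem_nhds hp)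
  filter_upwards [nhdsWithin_le_nhds hev, self_mem_nhdsWithin] with q hq hqs
  have e1 : stripMap S ℓ q = proj S (g • StripCover.mk ℓ q) := (proj_smul hg _).symm
  rw [e1]
  refine ⟨proj_mem_target_param hq, ?_⟩
  change ((param S ℓ a ε).symm (proj S (g • StripCover.mk ℓ q))).1 = _
  rw [param_symm_proj hq]
  ext i
  fin_cases i
  · change fiberFlip ε (g • StripCover.mk ℓ q).snd = fiberFlip (ε * g.2) q.2
    rw [StripCover.snd_smul, StripCover.snd_mk (mem_strip.1 hqs), fiberFlip_mul]
  · rfl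

/-- The transition maps are locally reflections composed with translations. -/
theorem eventually_transition_eq {a : ℝ} {ε₀ : ℤˣ}
    {e' : OpenPartialHomeomorph (QuotientSurface S ℓ) (EuclideanHalfSpace 2)}
    (he' : e' ∈ atlas (EuclideanHalfSpace 2) (QuotientSurface S ℓ)) {z : EuclideanSpace ℝ (Fin 2)}
    (hz : z ∈ ((param S ℓ a ε₀).symm.extend (𝓡∂ 2)).target)
    (hz' : ((param S ℓ a ε₀).symm.extend (𝓡∂ 2)).symm z ∈ e'.source) : ∃ (ε : ℤˣ) (k : ℝ),
    ∀ᶠ w in 𝓝[range (𝓡∂ 2)] z, e'.extend (𝓡∂ 2) (((param S ℓ a ε₀).symm.extend (𝓡∂ 2)).symm w) =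
      stripCoord ε k (stripPoint ε₀ w) := by
  rw [extend_symm_eq hz] at hz'
  obtain ⟨ε, k, h⟩ := eventually_extend_eq he' hz'
  refine ⟨ε, k, ?_⟩
  have htend : Tendsto (stripPoint ε₀) (𝓝[range (𝓡∂ 2)] z) (𝓝[strip] (stripPoint ε₀ z)) := by
    refine tendsto_nhdsWithin_iff.2 ⟨?_, ?_⟩
    · exact ((contDiff_stripPoint (n := 0) ε₀).continuous.tendsto z).mono_left nhdsWithin_le_nhds
    · filter_upwards [eventually_mem_target hz] with w hw
      have := (mem_target_extend.1 hw).1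
      exact stripPoint_mem _ ⟨this.1, this.2.le⟩
  filter_upwards [htend.eventually h, eventually_mem_target hz] with w hw hwt
  rw [extend_symm_eq hwt]
  exact hw.2

instance : IsManifold (𝓡∂ 2) ∞ (QuotientSurface S ℓ) := by
  refine isManifold_of_contDiffOn _ _ _ fun e e' he he' z hz => ?_
  obtain ⟨a, ε₀, rfl⟩ := mem_atlas_iff.1 he
  have hz1 : z ∈ ((param S ℓ a ε₀).symm.extend (𝓡∂ 2)).target := by
    rw [OpenPartialHomeomorph.extend_target]
    exact ⟨hz.1.1, hz.2⟩
  obtain ⟨ε, k, h⟩ := eventually_transition_eq he' hz1 hz.1.2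
  have h1 : ContDiffWithinAt ℝ ∞ (stripCoord ε k ∘ stripPoint ε₀) (range (𝓡∂ 2)) z :=
    ((contDiff_stripCoord ε k).comp (contDiff_stripPoint ε₀)).contDiffWithinAt
  exact (h1.congr_of_eventuallyEq_of_mem h hz.2).mono inter_subset_right

theorem exists_chartSign {p : ℝ × ℝ} : ∃ ε : ℤˣ, ∃ k : ℝ, ∀ᶠ q in 𝓝[strip] p,
    stripMap S ℓ q ∈ (chartAt (EuclideanHalfSpace 2) (stripMap S ℓ p)).source ∧
    (chartAt (EuclideanHalfSpace 2) (stripMap S ℓ p)).extend (𝓡∂ 2) (stripMap S ℓ q) =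
      stripCoord ε k q :=
  eventually_extend_eq (chart_mem_atlas _ _) (mem_chart_source _ _)

/-- The sign of the preferred chart at the image of a point of the strip. -/
def chartSign (S : StripSurface) (ℓ : ℝ) [Fact (0 < ℓ)] (p : ℝ × ℝ) : ℤˣ :=
  (exists_chartSign (S := S) (ℓ := ℓ) (p := p)).choose

/-- The translation part of the preferred chart at the image of a point of the strip. -/
def chartShift (S : StripSurface) (ℓ : ℝ) [Fact (0 < ℓ)] (p : ℝ × ℝ) : ℝ :=
  (exists_chartSign (S := S) (ℓ := ℓ) (p := p)).choose_spec.choose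

theorem eventually_chartAt_extend (p : ℝ × ℝ) : ∀ᶠ q in 𝓝[strip] p,
    stripMap S ℓ q ∈ (chartAt (EuclideanHalfSpace 2) (stripMap S ℓ p)).source ∧
    (chartAt (EuclideanHalfSpace 2) (stripMap S ℓ p)).extend (𝓡∂ 2) (stripMap S ℓ q) =
      stripCoord (chartSign S ℓ p) (chartShift S ℓ p) q :=
  (exists_chartSign (S := S) (ℓ := ℓ) (p := p)).choose_spec.choose_spec

theorem chartAt_extend_self {p : ℝ × ℝ} (hp : p ∈ strip) :
    (chartAt (EuclideanHalfSpace 2) (stripMap S ℓ p)).extend (𝓡∂ 2) (stripMap S ℓ p) =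
      stripCoord (chartSign S ℓ p) (chartShift S ℓ p) p :=
  ((eventually_chartAt_extend p).self_of_nhdsWithin hp).2

theorem contMDiffOn_stripMap :
    ContMDiffOn 𝓘(ℝ, ℝ × ℝ) (𝓡∂ 2) ∞ (stripMap S ℓ) strip := by
  intro p hp
  rw [contMDiffWithinAt_iff]
  refine ⟨continuous_stripMap.continuousWithinAt, ?_⟩
  simp only [mfld_simps]
  refine (contDiff_stripCoord (chartSign S ℓ p)
    (chartShift S ℓ p)).contDiffWithinAt.congr_of_eventuallyEq_of_mem ?_ hp
  filter_upwards [eventually_chartAt_extend (S := S) (ℓ := ℓ) p] with q hq using hq.2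

theorem hasMFDerivWithinAt_stripMap {p : ℝ × ℝ} (hp : p ∈ strip) :
    HasMFDerivWithinAt 𝓘(ℝ, ℝ × ℝ) (𝓡∂ 2) (stripMap S ℓ) strip p
      (show TangentSpace 𝓘(ℝ, ℝ × ℝ) p →L[ℝ] TangentSpace (𝓡∂ 2) (stripMap S ℓ p) from
        stripCoordL (chartSign S ℓ p)) := by
  refine ⟨continuous_stripMap.continuousWithinAt, ?_⟩
  simp only [writtenInExtChartAt, mfld_simps]
  refine (hasFDerivAt_stripCoord (chartSign S ℓ p)
    (chartShift S ℓ p) p).hasFDerivWithinAt.congr_of_eventuallyEq ?_ (chartAt_extend_self hp)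
  filter_upwards [eventually_chartAt_extend (S := S) (ℓ := ℓ) p] with q hq using hq.2

theorem uniqueDiffOn_strip : UniqueDiffOn ℝ strip :=
  uniqueDiffOn_univ.prod (uniqueDiffOn_Icc (by norm_num))

theorem stripDeriv_stripMap {p : ℝ × ℝ} (hp : p ∈ strip) :
    stripDeriv (stripMap S ℓ) p = stripCoordL (chartSign S ℓ p) :=
  (hasMFDerivWithinAt_stripMap hp).mfderivWithin (uniqueDiffOn_strip.uniqueMDiffOn p hp)

/-- The velocity field of a curve, or more generally the derivative of a map, given through the
strip. -/
theorem mfderivWithin_eq_of_lift {E : Type*} [NormedAddCommGroup E] [NormedSpace ℝ E]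
    {F : E → QuotientSurface S ℓ} {G : E → ℝ × ℝ} {s : Set E} {x : E} {G' : E →L[ℝ] ℝ × ℝ}
    (hs : UniqueDiffWithinAt ℝ s x) (hx : x ∈ s) (hG : HasFDerivWithinAt G G' s x)
    (hF : ∀ᶠ y in 𝓝[s] x, G y ∈ strip ∧ F y = stripMap S ℓ (G y)) (v : E) :
    (mfderivWithin 𝓘(ℝ, E) (𝓡∂ 2) F s x v : EuclideanSpace ℝ (Fin 2)) =
      stripCoordL (chartSign S ℓ (G x)) (G' v) := by
  have hGx := hF.self_of_nhdsWithin hx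
  have h1 : HasMFDerivWithinAt 𝓘(ℝ, E) 𝓘(ℝ, ℝ × ℝ) G (s ∩ G ⁻¹' strip) x G' :=
    (hG.mono inter_subset_left).hasMFDerivWithinAt
  have h2 := (hasMFDerivWithinAt_stripMap (S := S) (ℓ := ℓ) hGx.1).comp x h1 inter_subset_right
  have hmem : s ∩ G ⁻¹' strip ∈ 𝓝[s] x := by
    filter_upwards [self_mem_nhdsWithin, hF] with y hy hy' using ⟨hy, hy'.1⟩
  have h3 := h2.mono_of_mem_nhdsWithin hmem
  have h4 := h3.congr_of_eventuallyEq (f₁ := F) (hF.mono fun y hy => hy.2) hGx.2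
  rw [h4.mfderivWithin (uniqueMDiffWithinAt_iff_uniqueDiffWithinAt.2 hs)]
  rfl

/-- A map that is given through the strip by a smooth map is smooth. -/
theorem contMDiffOn_of_lift {F : ℝ → QuotientSurface S ℓ} {G : ℝ → ℝ × ℝ} {s : Set ℝ} {n : ℕ}
    (hG : ContDiffOn ℝ n G s) (hF : ∀ y ∈ s, G y ∈ strip ∧ F y = stripMap S ℓ (G y)) :
    ContMDiffOn 𝓘(ℝ, ℝ) (𝓡∂ 2) n F s := by
  have h1 : ContMDiffOn 𝓘(ℝ, ℝ × ℝ) (𝓡∂ 2) n (stripMap S ℓ) strip :=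
    contMDiffOn_stripMap.of_le (by exact_mod_cast le_top)
  exact (h1.comp hG.contMDiffOn fun y hy => (hF y hy).1).congr fun y hy => (hF y hy).2

end QuotientSurface

/-! ### Warped metrics on the quotient surfaces -/

/-- The bilinear form `v dz₁² + dz₀²`. -/
def warpForm (v : ℝ) : EuclideanSpace ℝ (Fin 2) →L[ℝ] EuclideanSpace ℝ (Fin 2) →L[ℝ] ℝ :=
  v • (EuclideanSpace.proj 1 : EuclideanSpace ℝ (Fin 2) →L[ℝ] ℝ).smulRight
      (EuclideanSpace.proj 1 : EuclideanSpace ℝ (Fin 2) →L[ℝ] ℝ) +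
    (EuclideanSpace.proj 0 : EuclideanSpace ℝ (Fin 2) →L[ℝ] ℝ).smulRight
      (EuclideanSpace.proj 0 : EuclideanSpace ℝ (Fin 2) →L[ℝ] ℝ)

theorem warpForm_apply (v : ℝ) (u w : EuclideanSpace ℝ (Fin 2)) :
    warpForm v u w = v * u 1 * w 1 + u 0 * w 0 := by
  simp [warpForm, mul_assoc]

theorem warpForm_stripCoordL (v : ℝ) (ε : ℤˣ) (p q : ℝ × ℝ) :
    warpForm v (stripCoordL ε p) (stripCoordL ε q) = v * p.1 * q.1 + p.2 * q.2 := by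
  rw [warpForm_apply]
  simp only [stripCoordL_apply_zero, stripCoordL_apply_one]
  linear_combination (p.2 * q.2) * units_mul_self_real ε

theorem warpForm_symm (v : ℝ) (u w : EuclideanSpace ℝ (Fin 2)) :
    warpForm v u w = warpForm v w u := by
  rw [warpForm_apply, warpForm_apply]; ring

theorem warpForm_pos {v : ℝ} (hv : 0 < v) {u : EuclideanSpace ℝ (Fin 2)} (hu : u ≠ 0) :
    0 < warpForm v u u := by
  rw [warpForm_apply]
  have h1 : 0 ≤ v * u 1 * u 1 := by rw [mul_assoc]; exact mul_nonneg hv.le (mul_self_nonneg _)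
  have h0 : 0 ≤ u 0 * u 0 := mul_self_nonneg _
  by_contra! h
  have e0 : u 0 * u 0 = 0 := by linarith
  have e1 : v * (u 1 * u 1) = 0 := by rw [← mul_assoc]; linarith
  refine hu ?_
  ext i
  fin_cases i
  · simpa using e0
  · simpa [hv.ne'] using e1

theorem isVonNBounded_warpForm {v : ℝ} (hv : 1 ≤ v) :
    Bornology.IsVonNBounded ℝ {u : EuclideanSpace ℝ (Fin 2) | warpForm v u u < 1} := by
  refine (NormedSpace.isVonNBounded_ball ℝ (EuclideanSpace ℝ (Fin 2)) 1).subset fun u hu => ?_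
  rw [mem_ofPred_eq, warpForm_apply] at hu
  rw [mem_ball_zero_iff, EuclideanSpace.norm_eq, Real.sqrt_lt' one_pos, Fin.sum_univ_two]
  simp only [Real.norm_eq_abs, sq_abs]
  nlinarith [mul_self_nonneg (u 1)]

theorem contDiff_smul_add_const {W : Type*} [NormedAddCommGroup W] [NormedSpace ℝ W] (A B : W) :
    ContDiff ℝ ∞ fun v : ℝ => v • A + B :=
  (contDiff_id.smul contDiff_const).add contDiff_const

theorem contDiff_warpForm : ContDiff ℝ ∞ warpForm := contDiff_smul_add_const _ _

namespace QuotientSurface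

variable {S : StripSurface} {ℓ : ℝ}

/-- The coordinate across the strip of some lift of a point; it is determined up to reflection. -/
def height (m : QuotientSurface S ℓ) : ℝ := (Quotient.out m : StripCover ℓ).snd

theorem height_mem (m : QuotientSurface S ℓ) : height m ∈ Icc (0 : ℝ) 14 := StripCover.snd_mem _

theorem warp_height_stripMap {f : ℝ → ℝ} (hf : IsWarp f) {p : ℝ × ℝ} (hp : p ∈ strip) :
    f (height (stripMap S ℓ p)) = f p.2 := by
  have h : proj S (Quotient.out (stripMap S ℓ p) : StripCover ℓ) = stripMap S ℓ p :=
    Quotient.out_eq _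
  obtain ⟨g, _, hg⟩ := proj_eq_iff.1 h
  rw [height, ← hg, StripCover.snd_smul, StripCover.snd_mk (mem_strip.1 hp), hf.comp_fiberFlip]

variable [hℓ : Fact (0 < ℓ)]

section Atlas

variable {e : OpenPartialHomeomorph (QuotientSurface S ℓ) (EuclideanHalfSpace 2)}
  (he : e ∈ atlas (EuclideanHalfSpace 2) (QuotientSurface S ℓ)) {z : EuclideanSpace ℝ (Fin 2)}
  (hz : z ∈ (e.extend (𝓡∂ 2)).target)
include he hz

theorem mem_Ico_of_mem_target : z 0 ∈ Ico (0 : ℝ) 14 := by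
  obtain ⟨a, ε, rfl⟩ := mem_atlas_iff.1 he
  exact (mem_target_extend.1 hz).1

theorem mem_range_of_mem_target : z ∈ range (𝓡∂ 2) := by
  rw [range_modelWithCornersEuclideanHalfSpace]; exact (mem_Ico_of_mem_target he hz).1

/-- The derivative of the inverse of a chart of the atlas, read in the preferred chart at the image
point, is diagonal with entries `±1`. -/
theorem mfderivWithin_extend_symm : ∃ δ₁ δ₂ : ℤˣ, ∀ u : EuclideanSpace ℝ (Fin 2),
    (mfderivWithin 𝓘(ℝ, EuclideanSpace ℝ (Fin 2)) (𝓡∂ 2) (e.extend (𝓡∂ 2)).symm (range (𝓡∂ 2)) z u :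
      EuclideanSpace ℝ (Fin 2)) = stripCoordL δ₁ (stripPointL δ₂ u) := by
  have hr := mem_range_of_mem_target he hz
  obtain ⟨a, ε, rfl⟩ := mem_atlas_iff.1 he
  refine ⟨chartSign S ℓ (stripPoint ε z), ε, fun u => ?_⟩
  refine mfderivWithin_eq_of_lift ((𝓡∂ 2).uniqueDiffOn z hr) hr
    (hasFDerivAt_stripPoint ε z).hasFDerivWithinAt ?_ u
  filter_upwards [eventually_mem_target hz] with w hw
  have := (mem_target_extend.1 hw).1
  exact ⟨stripPoint_mem _ ⟨this.1, this.2.le⟩, extend_symm_eq hw⟩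

theorem warp_height_extend_symm {f : ℝ → ℝ} (hf : IsWarp f) :
    f (height ((e.extend (𝓡∂ 2)).symm z)) = f (z 0) := by
  have := mem_Ico_of_mem_target he hz
  obtain ⟨a, ε, rfl⟩ := mem_atlas_iff.1 he
  rw [extend_symm_eq hz, warp_height_stripMap hf (stripPoint_mem _ (Ico_subset_Icc_self this))]
  exact hf.comp_fiberFlip _ _

end Atlas

theorem warpForm_stripCoordL_stripPointL (v : ℝ) (δ₁ δ₂ : ℤˣ) (u w : EuclideanSpace ℝ (Fin 2)) :
    warpForm v (stripCoordL δ₁ (stripPointL δ₂ u)) (stripCoordL δ₁ (stripPointL δ₂ w)) =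
      v * u 1 * w 1 + u 0 * w 0 := by
  rw [warpForm_stripCoordL, stripPointL_apply, stripPointL_apply]
  linear_combination (u 0 * w 0) * units_mul_self_real δ₂

theorem warp_height_eq_extChartAt {f : ℝ → ℝ} (hf : IsWarp f) {m x : QuotientSurface S ℓ}
    (hx : x ∈ (chartAt (EuclideanHalfSpace 2) m).source) :
    f (height x) = f (extChartAt (𝓡∂ 2) m x 0) := by
  have hx' : x ∈ (extChartAt (𝓡∂ 2) m).source := by rwa [extChartAt_source]
  rw [← warp_height_extend_symm (chart_mem_atlas _ m) ((extChartAt (𝓡∂ 2) m).map_source hx') hf]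
  exact congrArg (fun x => f (height x)) ((extChartAt (𝓡∂ 2) m).left_inv hx').symm

theorem symm_trivializationAt {m x : QuotientSurface S ℓ}
    (hx : x ∈ (chartAt (EuclideanHalfSpace 2) m).source) : ∃ δ₁ δ₂ : ℤˣ,
    ∀ u : EuclideanSpace ℝ (Fin 2),
      ((trivializationAt (EuclideanSpace ℝ (Fin 2)) (TangentSpace (𝓡∂ 2)) m).symm x u :
        EuclideanSpace ℝ (Fin 2)) = stripCoordL δ₁ (stripPointL δ₂ u) := by
  have hx' : x ∈ (extChartAt (𝓡∂ 2) m).source := by rwa [extChartAt_source]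
  obtain ⟨δ₁, δ₂, h⟩ := mfderivWithin_extend_symm (chart_mem_atlas _ m)
    ((extChartAt (𝓡∂ 2) m).map_source hx')
  refine ⟨δ₁, δ₂, fun u => ?_⟩
  rw [← h u]
  have h1 := DFunLike.congr_fun (TangentBundle.symmL_trivializationAt (I := 𝓡∂ 2) (𝕜 := ℝ) hx) u
  rw [Trivialization.symmL_apply _ (by simpa using hx)] at h1
  exact h1

/-- The inner product `f(y) dx² + dy²` on the tangent spaces of the quotient surface. -/
def warpInner (f : ℝ → ℝ) (m : QuotientSurface S ℓ) :
    TangentSpace (𝓡∂ 2) m →L[ℝ] TangentSpace (𝓡∂ 2) m →L[ℝ] ℝ :=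
  warpForm (f (height m))

theorem contMDiff_warpInner {f : ℝ → ℝ} (hf : IsWarp f) :
    ContMDiff (𝓡∂ 2) ((𝓡∂ 2).prod
      𝓘(ℝ, EuclideanSpace ℝ (Fin 2) →L[ℝ] EuclideanSpace ℝ (Fin 2) →L[ℝ] ℝ)) ∞
      (fun m : QuotientSurface S ℓ => TotalSpace.mk'
        (EuclideanSpace ℝ (Fin 2) →L[ℝ] EuclideanSpace ℝ (Fin 2) →L[ℝ] ℝ) m (warpInner f m)) := by
  intro m
  rw [contMDiffAt_section]
  have hsrc := chart_source_mem_nhds (EuclideanHalfSpace 2) m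
  have hsm : ContMDiffAt (𝓡∂ 2) 𝓘(ℝ, ℝ) ∞ (fun x => f (height x)) m := by
    have h1 : ContDiff ℝ ∞ fun z : EuclideanSpace ℝ (Fin 2) => f (z 0) :=
      hf.smooth.comp (EuclideanSpace.proj 0 : EuclideanSpace ℝ (Fin 2) →L[ℝ] ℝ).contDiff
    have h2 := h1.contMDiff.contMDiffAt.comp m (contMDiffAt_extChartAt (I := 𝓡∂ 2) (x := m))
    refine h2.congr_of_eventuallyEq ?_
    filter_upwards [hsrc] with x hx using warp_height_eq_extChartAt hf hx
  have h3 := (contDiff_warpForm.contMDiff.contMDiffAt (x := f (height m))).comp m hsm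
  refine h3.congr_of_eventuallyEq ?_
  filter_upwards [hsrc] with x hx
  rw [hom_trivializationAt_apply]
  ext u w
  rw [inCoordinates_apply_eq₂ (by simpa using hx) (by simpa using hx) (by simp)]
  obtain ⟨δ₁, δ₂, h⟩ := symm_trivializationAt hx
  have := warpForm_stripCoordL_stripPointL (f (height x)) δ₁ δ₂ u w
  rw [← h u, ← h w] at this
  rw [Function.comp_apply, warpForm_apply, ← this]
  simp
  rfl

/-- The metric `f(y) dx² + dy²` on the quotient surface. -/
def warpMetric (S : StripSurface) (ℓ : ℝ) [Fact (0 < ℓ)] {f : ℝ → ℝ} (hf : IsWarp f) :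
    SmoothMetric 2 (QuotientSurface S ℓ) where
  inner m := warpInner f m
  symm m v w := warpForm_symm _ v w
  pos m v hv := warpForm_pos (by linarith [hf.one_le _ (height_mem m)]) hv
  isVonNBounded m := isVonNBounded_warpForm (hf.one_le _ (height_mem m))
  contMDiff := contMDiff_warpInner hf

end QuotientSurface

namespace QuotientSurface

variable {S : StripSurface} {ℓ : ℝ} [hℓ : Fact (0 < ℓ)] {f : ℝ → ℝ} (hf : IsWarp f)

theorem inner_warpMetric (m : QuotientSurface S ℓ) (u w : EuclideanSpace ℝ (Fin 2)) :
    (warpMetric S ℓ hf).inner m u w = f (height m) * u 1 * w 1 + u 0 * w 0 :=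
  warpForm_apply _ _ _

theorem isWarpedMetric_warpMetric : IsWarpedMetric f (stripMap S ℓ) (warpMetric S ℓ hf) := by
  intro p hp v w
  rw [stripDeriv_stripMap hp, ← warp_height_stripMap hf hp]
  exact warpForm_stripCoordL _ _ _ _

section Coordinates

variable {e : OpenPartialHomeomorph (QuotientSurface S ℓ) (EuclideanHalfSpace 2)}
  (he : e ∈ atlas (EuclideanHalfSpace 2) (QuotientSurface S ℓ)) {z : EuclideanSpace ℝ (Fin 2)}
  (hz : z ∈ (e.extend (𝓡∂ 2)).target)
include he hz

/-- In all charts of the atlas the metric is `f(z₀) dz₁² + dz₀²`. -/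
theorem coordMetric_warpMetric (u w : EuclideanSpace ℝ (Fin 2)) :
    coordMetric (warpMetric S ℓ hf) e z u w = f (z 0) * u 1 * w 1 + u 0 * w 0 := by
  obtain ⟨δ₁, δ₂, h⟩ := mfderivWithin_extend_symm he hz
  rw [← warp_height_extend_symm he hz hf, ← warpForm_stripCoordL_stripPointL _ δ₁ δ₂, ← h u, ← h w]
  rfl

theorem coordMetricDeriv_warpMetric (u w x : EuclideanSpace ℝ (Fin 2)) :
    coordMetricDeriv (warpMetric S ℓ hf) e z x u w = deriv f (z 0) * x 0 * u 1 * w 1 := by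
  have hr := mem_range_of_mem_target he hz
  have h1 : HasFDerivAt (fun z : EuclideanSpace ℝ (Fin 2) => f (z 0) * u 1 * w 1 + u 0 * w 0)
      ((w 1) • (u 1) • deriv f (z 0) • (EuclideanSpace.proj 0 :
        EuclideanSpace ℝ (Fin 2) →L[ℝ] ℝ)) z := by
    have h2 : HasFDerivAt (fun z : EuclideanSpace ℝ (Fin 2) => z 0)
        (EuclideanSpace.proj 0 : EuclideanSpace ℝ (Fin 2) →L[ℝ] ℝ) z :=
      (EuclideanSpace.proj 0 : EuclideanSpace ℝ (Fin 2) →L[ℝ] ℝ).hasFDerivAt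
    have h3 : HasDerivAt f (deriv f (z 0)) (z 0) :=
      (hf.smooth.differentiable (by simp) _).hasDerivAt
    exact (((h3.comp_hasFDerivAt z h2).mul_const (u 1)).mul_const (w 1)).add_const _
  have h4 : (fun z => coordMetric (warpMetric S ℓ hf) e z u w) =ᶠ[𝓝[range (𝓡∂ 2)] z]
      fun z => f (z 0) * u 1 * w 1 + u 0 * w 0 := by
    filter_upwards [eventually_mem_target hz] with y hy using coordMetric_warpMetric hf he hy u w
  rw [coordMetricDeriv, h4.fderivWithin_eq (coordMetric_warpMetric hf he hz u w),
    h1.hasFDerivWithinAt.fderivWithin ((𝓡∂ 2).uniqueDiffOn z hr)]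
  simp
  ring

theorem christoffelFirst_warpMetric (u v w : EuclideanSpace ℝ (Fin 2)) :
    christoffelFirst (warpMetric S ℓ hf) e z u v w =
      deriv f (z 0) * (u 0 * v 1 * w 1 + v 0 * u 1 * w 1 - w 0 * u 1 * v 1) / 2 := by
  simp only [christoffelFirst, coordMetricDeriv_warpMetric hf he hz]
  ring

end Coordinates

/-! ### The boundary -/

theorem mem_boundary_iff {m : QuotientSurface S ℓ} :
    m ∈ (𝓡∂ 2).boundary (QuotientSurface S ℓ) ↔ extChartAt (𝓡∂ 2) m m 0 = 0 := by
  change extChartAt (𝓡∂ 2) m m ∈ frontier (range (𝓡∂ 2)) ↔ _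
  rw [frontier_range_modelWithCornersEuclideanHalfSpace]
  exact eq_comm

theorem fiberFlip_chartSign_lt {p : ℝ × ℝ} (hp : p ∈ strip) :
    fiberFlip (chartSign S ℓ p) p.2 < 14 := by
  have h := mem_Ico_of_mem_target (chart_mem_atlas (EuclideanHalfSpace 2) (stripMap S ℓ p))
    (mem_extChartAt_target (I := 𝓡∂ 2) (stripMap S ℓ p))
  have h2 := chartAt_extend_self (S := S) (ℓ := ℓ) hp
  rw [extChartAt, h2] at h
  exact h.2

theorem chartSign_of_snd_eq_zero {p : ℝ × ℝ} (h : p.2 = 0) : chartSign S ℓ p = 1 := by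
  have hlt := fiberFlip_chartSign_lt (S := S) (ℓ := ℓ) (p := p)
    (mem_strip.2 (by rw [h]; norm_num))
  rcases Int.units_eq_one_or (chartSign S ℓ p) with h' | h'
  · exact h'
  · rw [h', h] at hlt; norm_num at hlt

theorem chartSign_of_snd_eq_top {p : ℝ × ℝ} (h : p.2 = 14) : chartSign S ℓ p = -1 := by
  have hlt := fiberFlip_chartSign_lt (S := S) (ℓ := ℓ) (p := p)
    (mem_strip.2 (by rw [h]; norm_num))
  rcases Int.units_eq_one_or (chartSign S ℓ p) with h' | h'
  · rw [h', h] at hlt; norm_num at hlt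
  · exact h'

theorem stripMap_mem_boundary_iff {p : ℝ × ℝ} (hp : p ∈ strip) :
    stripMap S ℓ p ∈ (𝓡∂ 2).boundary (QuotientSurface S ℓ) ↔ p.2 = 0 ∨ p.2 = 14 := by
  rw [mem_boundary_iff, extChartAt, chartAt_extend_self hp, stripCoord_apply_zero]
  constructor
  · intro h
    rcases Int.units_eq_one_or (chartSign S ℓ p) with h' | h'
    · rw [h', fiberFlip_one] at h; exact Or.inl h
    · rw [h', fiberFlip_neg_one] at h; exact Or.inr (by linarith)
  · rintro (h | h)
    · rw [chartSign_of_snd_eq_zero h, h, fiberFlip_one]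
    · rw [chartSign_of_snd_eq_top h, h, fiberFlip_neg_one, sub_self]

theorem warp_height_of_mem_boundary (hf : IsWarp f) {m : QuotientSurface S ℓ}
    (hm : m ∈ (𝓡∂ 2).boundary (QuotientSurface S ℓ)) : f (height m) = 1 := by
  obtain ⟨p, hp, rfl⟩ := exists_stripMap_eq m
  rw [warp_height_stripMap hf hp]
  rcases (stripMap_mem_boundary_iff hp).1 hm with h | h
  · rw [h, hf.zero]
  · rw [h, show (14 : ℝ) = 14 - 0 by norm_num, hf.symm, hf.zero]

theorem isInwardUnitNormal_single (m : QuotientSurface S ℓ) :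
    IsInwardUnitNormal (warpMetric S ℓ hf) m (EuclideanSpace.single 0 (1 : ℝ)) := by
  refine ⟨?_, fun u hu => ?_, ?_⟩
  · refine (inner_warpMetric hf m _ _).trans ?_
    simp
  · have key : ∀ u : EuclideanSpace ℝ (Fin 2), u 0 = 0 → f (height m) *
        EuclideanSpace.single (0 : Fin 2) (1 : ℝ) 1 * u 1 +
        EuclideanSpace.single (0 : Fin 2) (1 : ℝ) 0 * u 0 = 0 := by
      intro u hu
      simp [hu]
    exact (inner_warpMetric hf m _ _).trans (key u hu)
  · change (0 : ℝ) < EuclideanSpace.single (0 : Fin 2) (1 : ℝ) 0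
    simp

theorem exists_inwardUnitNormal_iff {m : QuotientSurface S ℓ} {v : EuclideanSpace ℝ (Fin 2)} :
    (∃ ν, IsInwardUnitNormal (warpMetric S ℓ hf) m ν ∧ 0 < (warpMetric S ℓ hf).inner m v ν) ↔
      0 < v 0 := by
  have hpos : 0 < f (height m) := by linarith [hf.one_le _ (height_mem m)]
  constructor
  · have key : ∀ ν : EuclideanSpace ℝ (Fin 2), 0 < ν 0 →
        f (height m) * ν 1 * EuclideanSpace.single (1 : Fin 2) (1 : ℝ) 1 +
          ν 0 * EuclideanSpace.single (1 : Fin 2) (1 : ℝ) 0 = 0 →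
        0 < f (height m) * v 1 * ν 1 + v 0 * ν 0 → 0 < v 0 := by
      intro ν h3 h2 h4
      have h5 : ν 1 = 0 := by simpa [hpos.ne'] using h2
      rw [h5, mul_zero, zero_add] at h4
      exact pos_of_mul_pos_left h4 h3.le
    rintro ⟨ν, ⟨_, h2, h3⟩, h4⟩
    have h2' := h2 (EuclideanSpace.single (1 : Fin 2) (1 : ℝ))
      (by change EuclideanSpace.single (1 : Fin 2) (1 : ℝ) 0 = 0; simp)
    exact key ν h3 ((inner_warpMetric hf m _ _).symm.trans h2')
      (h4.trans_eq (inner_warpMetric hf m _ _))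
  · intro h
    refine ⟨EuclideanSpace.single (0 : Fin 2) (1 : ℝ), isInwardUnitNormal_single hf m, ?_⟩
    have := inner_warpMetric hf m v (EuclideanSpace.single (0 : Fin 2) (1 : ℝ))
    rw [this]
    simpa using h

theorem isBoundaryProjection_iff {m : QuotientSurface S ℓ} {v u : EuclideanSpace ℝ (Fin 2)} :
    IsBoundaryProjection (warpMetric S ℓ hf) m v u ↔ u = !₂[0, v 1] := by
  have hpos : 0 < f (height m) := by linarith [hf.one_le _ (height_mem m)]
  constructor
  · rintro ⟨h1, h2⟩
    have h1' : u 0 = 0 := h1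
    have h2' := h2 (EuclideanSpace.single (1 : Fin 2) (1 : ℝ))
      (by change EuclideanSpace.single (1 : Fin 2) (1 : ℝ) 0 = 0; simp)
    have e2 := inner_warpMetric hf m (v - u) (EuclideanSpace.single (1 : Fin 2) (1 : ℝ))
    have h3 := e2.symm.trans h2'
    have h4 : v 1 - u 1 = 0 := by simpa [hpos.ne'] using h3
    ext i
    fin_cases i
    · simpa using h1'
    · simp; linarith
  · rintro rfl
    have key : ∀ w : EuclideanSpace ℝ (Fin 2), w 0 = 0 →
        f (height m) * (v - !₂[0, v 1]) 1 * w 1 + (v - !₂[0, v 1]) 0 * w 0 = 0 := by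
      intro w hw
      simp [hw]
    exact ⟨rfl, fun w hw => (inner_warpMetric hf m (v - !₂[0, v 1]) w).trans (key w hw)⟩

/-! ### Second fundamental form and jets -/

theorem secondFundamentalForm_warpMetric {m : QuotientSurface S ℓ}
    (hm : m ∈ (𝓡∂ 2).boundary (QuotientSurface S ℓ)) {u v : EuclideanSpace ℝ (Fin 2)}
    (hu : u 0 = 0) (hv : v 0 = 0) :
    secondFundamentalForm (warpMetric S ℓ hf) m (EuclideanSpace.single 0 (1 : ℝ)) u v =
      -(deriv f 0 * u 1 * v 1) / 2 := by
  have h := christoffelFirst_warpMetric hf (chart_mem_atlas (EuclideanHalfSpace 2) m)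
    (mem_extChartAt_target (I := 𝓡∂ 2) m) u v (EuclideanSpace.single 0 (1 : ℝ))
  refine h.trans ?_
  rw [mem_boundary_iff.1 hm, hu, hv]
  simp
  ring

theorem isStrictlyConcaveAt_warpMetric (h : 0 < deriv f 0) {m : QuotientSurface S ℓ}
    (hm : m ∈ (𝓡∂ 2).boundary (QuotientSurface S ℓ)) :
    IsStrictlyConcaveAt (warpMetric S ℓ hf) m := by
  have key : ∀ u : EuclideanSpace ℝ (Fin 2), u 0 = 0 → u ≠ 0 →
      -(deriv f 0 * u 1 * u 1) / 2 < 0 := by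
    intro u hu hu0
    have h1 : u 1 ≠ 0 := by
      intro h1
      refine hu0 ?_
      ext i
      fin_cases i
      · exact hu
      · exact h1
    have := mul_pos h (mul_self_pos.2 h1)
    linarith
  exact ⟨EuclideanSpace.single (0 : Fin 2) (1 : ℝ), isInwardUnitNormal_single hf m,
    fun u hu hu0 => (secondFundamentalForm_warpMetric hf hm hu hu).trans_lt (key u hu hu0)⟩

theorem isTotallyGeodesicAt_warpMetric (h : deriv f 0 = 0) {m : QuotientSurface S ℓ}
    (hm : m ∈ (𝓡∂ 2).boundary (QuotientSurface S ℓ)) :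
    IsTotallyGeodesicAt (warpMetric S ℓ hf) m := by
  refine ⟨EuclideanSpace.single (0 : Fin 2) (1 : ℝ), isInwardUnitNormal_single hf m,
    fun u hu v hv => ?_⟩
  refine (secondFundamentalForm_warpMetric hf hm hu hv).trans ?_
  rw [h]; simp

theorem isBoundaryNormalChart_warpMetric
    {e : OpenPartialHomeomorph (QuotientSurface S ℓ) (EuclideanHalfSpace 2)}
    (he : e ∈ atlas (EuclideanHalfSpace 2) (QuotientSurface S ℓ)) :
    IsBoundaryNormalChart (warpMetric S ℓ hf) e := by
  refine ⟨IsManifold.subset_maximalAtlas he, fun z hz v => ?_⟩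
  rw [coordMetric_warpMetric hf he hz]
  simp

theorem not_sameC1JetAt_warpMetric {f' : ℝ → ℝ} (hf' : IsWarp f') (h : deriv f 0 ≠ deriv f' 0)
    {m : QuotientSurface S ℓ} (hm : m ∈ (𝓡∂ 2).boundary (QuotientSurface S ℓ)) :
    ¬ SameC1JetAt (warpMetric S ℓ hf) (warpMetric S ℓ hf') m := by
  intro hjet
  have he := chart_mem_atlas (EuclideanHalfSpace 2) m
  have hz : (chartAt (EuclideanHalfSpace 2) m).extend (𝓡∂ 2) m ∈
      ((chartAt (EuclideanHalfSpace 2) m).extend (𝓡∂ 2)).target := mem_extChartAt_target m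
  have := (hjet _ _ (isBoundaryNormalChart_warpMetric hf he)
    (isBoundaryNormalChart_warpMetric hf' he) (mem_chart_source _ m) (mem_chart_source _ m)
    (Eventually.of_forall fun _ => rfl) (EuclideanSpace.single 1 1) (EuclideanSpace.single 1 1)).2
  have h0 : ((chartAt (EuclideanHalfSpace 2) m).extend (𝓡∂ 2) m) 0 = 0 := mem_boundary_iff.1 hm
  rw [coordMetricDeriv_warpMetric hf he hz, coordMetricDeriv_warpMetric hf' he hz, h0] at this
  exact h (by simpa using this)

theorem sameBoundary_warpMetric {f' : ℝ → ℝ} (hf' : IsWarp f') :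
    SameBoundary (warpMetric S ℓ hf) (warpMetric S ℓ hf') := by
  intro m hm u _ v _
  refine (inner_warpMetric hf m u v).trans ((inner_warpMetric hf' m u v).trans ?_).symm
  rw [warp_height_of_mem_boundary hf hm, warp_height_of_mem_boundary hf' hm]

end QuotientSurface

/-! ### Topology of the quotient surfaces -/

namespace QuotientSurface

variable {S : StripSurface} {ℓ : ℝ}

theorem stripMap_eq_iff_deck {p q : ℝ × ℝ} (hp : p ∈ strip) (hq : q ∈ strip) :
    stripMap S ℓ p = stripMap S ℓ q ↔
      ∃ g ∈ S.deck, q = (p.1 + (g.1.toAdd : ℝ) * ℓ, fiberFlip g.2 p.2) := by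
  rw [eq_comm, stripMap, stripMap, proj_eq_iff]
  refine exists_congr fun g => and_congr_right fun _ => ?_
  rw [StripCover.ext_iff, StripCover.fst_smul, StripCover.snd_smul,
    StripCover.snd_mk (mem_strip.1 hp), StripCover.snd_mk (mem_strip.1 hq), Prod.ext_iff]
  simp only [StripCover.fst_mk]
  exact and_congr eq_comm eq_comm

theorem stripMap_eq_iff {p q : ℝ × ℝ} (hp : p ∈ strip) (hq : q ∈ strip) :
    stripMap S ℓ p = stripMap S ℓ q ↔ S.rel ℓ p q := by
  rw [stripMap_eq_iff_deck hp hq]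
  cases S with
  | strip =>
    constructor
    · rintro ⟨g, hg, h⟩
      rw [Subgroup.mem_bot.1 hg] at h
      simpa [StripSurface.rel] using h
    · intro h
      refine ⟨1, Subgroup.one_mem _, ?_⟩
      simpa [StripSurface.rel] using h
  | cylinder =>
    constructor
    · rintro ⟨g, hg, h⟩
      have h2 : 1 = g.2 := MonoidHom.mem_graph.1 hg
      rw [← h2, fiberFlip_one] at h
      exact ⟨g.1.toAdd, h⟩
    · rintro ⟨k, h⟩
      refine ⟨(Multiplicative.ofAdd k, 1), MonoidHom.mem_graph.2 rfl, ?_⟩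
      rw [fiberFlip_one]
      exact h
  | moebius =>
    constructor
    · rintro ⟨g, hg, h⟩
      have h2 : (-1) ^ g.1.toAdd = g.2 := MonoidHom.mem_graph.1 hg
      rw [← h2] at h
      rcases Int.even_or_odd g.1.toAdd with hk | hk
      · rw [hk.neg_one_zpow, fiberFlip_one] at h
        exact ⟨g.1.toAdd, Or.inl ⟨hk, h⟩⟩
      · rw [hk.neg_one_zpow, fiberFlip_neg_one] at h
        exact ⟨g.1.toAdd, Or.inr ⟨hk, h⟩⟩
    · rintro ⟨k, ⟨hk, h⟩ | ⟨hk, h⟩⟩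
      · refine ⟨(Multiplicative.ofAdd k, 1), MonoidHom.mem_graph.2 hk.neg_one_zpow, ?_⟩
        rw [fiberFlip_one]
        exact h
      · refine ⟨(Multiplicative.ofAdd k, -1), MonoidHom.mem_graph.2 hk.neg_one_zpow, ?_⟩
        rw [fiberFlip_neg_one]
        exact h

theorem isQuotientMap_domRestrict_stripMap : IsQuotientMap (strip.domRestrict (stripMap S ℓ)) := by
  have h : strip.domRestrict (stripMap S ℓ) = (proj S : StripCover ℓ → QuotientSurface S ℓ) :=
    funext fun p => congrArg (proj S) (StripCover.mk_eta (ℓ := ℓ) p)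
  rw [h]
  exact isQuotientMap_proj

/-- On the quotients by slides and glides every point has a lift with first coordinate in a
fundamental interval. -/
theorem exists_stripMap_eq_fst_mem (hℓ : 0 < ℓ) (hS : S ≠ StripSurface.strip)
    (m : QuotientSurface S ℓ) : ∃ p ∈ Icc (0 : ℝ) ℓ ×ˢ Icc (0 : ℝ) 14, stripMap S ℓ p = m := by
  obtain ⟨⟨x, y⟩, hp, rfl⟩ := exists_stripMap_eq m
  have hy := mem_strip.1 hp
  set k : ℤ := -⌊x / ℓ⌋ with hk
  have hx : x + (k : ℝ) * ℓ ∈ Icc (0 : ℝ) ℓ := by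
    have h1 := (le_div_iff₀ hℓ).1 (Int.floor_le (x / ℓ))
    have h2 := (div_lt_iff₀ hℓ).1 (Int.lt_floor_add_one (x / ℓ))
    rw [hk]
    push_cast
    constructor <;> linarith
  have hkey : ∀ y' ∈ Icc (0 : ℝ) 14, S.rel ℓ (x, y) (x + (k : ℝ) * ℓ, y') →
      ∃ p ∈ Icc (0 : ℝ) ℓ ×ˢ Icc (0 : ℝ) 14, stripMap S ℓ p = stripMap S ℓ (x, y) :=
    fun y' hy' hr => ⟨_, ⟨hx, hy'⟩, ((stripMap_eq_iff hp (fst_mem_strip _ hy')).2 hr).symm⟩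
  cases S with
  | strip => exact absurd rfl hS
  | cylinder => exact hkey y hy ⟨k, rfl⟩
  | moebius =>
    rcases Int.even_or_odd k with h | h
    · exact hkey y hy ⟨k, Or.inl ⟨h, rfl⟩⟩
    · exact hkey (14 - y) ⟨by linarith [hy.2], by linarith [hy.1]⟩ ⟨k, Or.inr ⟨h, rfl⟩⟩

theorem compactSpace (hℓ : 0 < ℓ) (hS : S ≠ StripSurface.strip) :
    CompactSpace (QuotientSurface S ℓ) := by
  refine ⟨?_⟩
  have h : stripMap S ℓ '' (Icc (0 : ℝ) ℓ ×ˢ Icc (0 : ℝ) 14) = univ :=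
    eq_univ_of_forall fun m => exists_stripMap_eq_fst_mem hℓ hS m
  rw [← h]
  exact (isCompact_Icc.prod isCompact_Icc).image continuous_stripMap

variable [hℓ : Fact (0 < ℓ)]

/-- The glide reflection exchanges the two lines that bound the strip, so that the boundary of the
Möbius band is the image of one of them. -/
theorem isConnected_boundary_moebius :
    IsConnected ((𝓡∂ 2).boundary (QuotientSurface StripSurface.moebius ℓ)) := by
  have h : (𝓡∂ 2).boundary (QuotientSurface StripSurface.moebius ℓ) =
      range fun x : ℝ => stripMap StripSurface.moebius ℓ (x, 0) := by
    ext m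
    constructor
    · intro hm
      obtain ⟨⟨x, y⟩, hp, rfl⟩ := exists_stripMap_eq m
      rcases (stripMap_mem_boundary_iff hp).1 hm with rfl | rfl
      · exact ⟨x, rfl⟩
      · refine ⟨x + ℓ, ((stripMap_eq_iff hp (fst_mem_strip _ (by norm_num))).2 ?_).symm⟩
        exact ⟨1, Or.inr ⟨odd_one, by simp⟩⟩
    · rintro ⟨x, rfl⟩
      exact (stripMap_mem_boundary_iff (fst_mem_strip _ (by norm_num))).2 (Or.inl rfl)
  rw [h]
  exact isConnected_range (continuous_stripMap.comp (by fun_prop))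

theorem bijective_stripCoordL (ε : ℤˣ) : Function.Bijective (stripCoordL ε) := by
  refine ⟨fun v w h => ?_, fun u => ⟨(u 1, ((ε : ℤ) : ℝ) * u 0), ?_⟩⟩
  · have h0 := congrArg (fun u => ((ε : ℤ) : ℝ) * u 0) h
    have h1 := congrArg (fun u => u 1) h
    simp only [stripCoordL_apply_zero, stripCoordL_apply_one, ← mul_assoc, units_mul_self_real,
      one_mul] at h0 h1
    exact Prod.ext h1 h0
  · ext i
    fin_cases i
    · simp [← mul_assoc, units_mul_self_real]
    · simp

theorem isStripQuotient_stripMap : IsStripQuotient (S.rel ℓ) (stripMap S ℓ) where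
  smooth := contMDiffOn_stripMap
  bijective_deriv p hp := by
    rw [stripDeriv_stripMap hp]
    exact bijective_stripCoordL _
  quotient := isQuotientMap_domRestrict_stripMap
  fibers p hp q hq := stripMap_eq_iff hp hq
  boundary p hp := stripMap_mem_boundary_iff hp

/-! ### Lifting curves to the strip -/

/-- Curves in the quotient surface lift to the strip with the same regularity: lifts exist because the
projection is a covering map, and the charts read them up to reflection and translation. -/
theorem exists_lift {γ : ℝ → QuotientSurface S ℓ} {T : ℝ} (hT : 0 < T) {n : ℕ}
    (hγ : ContMDiffOn 𝓘(ℝ, ℝ) (𝓡∂ 2) n γ (Icc 0 T)) {p : ℝ × ℝ} (hp : p ∈ strip)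
    (h0 : stripMap S ℓ p = γ 0) : ∃ x y : ℝ → ℝ, ContDiffOn ℝ n x (Icc 0 T) ∧
      ContDiffOn ℝ n y (Icc 0 T) ∧ x 0 = p.1 ∧ y 0 = p.2 ∧
      ∀ t ∈ Icc 0 T, y t ∈ Icc (0 : ℝ) 14 ∧ γ t = stripMap S ℓ (x t, y t) := by
  have hmaps : ∀ s : unitInterval, T * s ∈ Icc 0 T := fun s =>
    ⟨mul_nonneg hT.le s.2.1, mul_le_of_le_one_right hT.le s.2.2⟩
  have hc : Continuous fun s : unitInterval => γ (T * s) :=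
    hγ.continuousOn.comp_continuous (by fun_prop) hmaps
  obtain ⟨Γ, hΓ, hΓ0⟩ := (isCoveringMap_proj (S := S) (ℓ := ℓ)).exists_path_lifts
    ⟨fun s : unitInterval => γ (T * s), hc⟩ (StripCover.mk ℓ p) (by
      change γ (T * 0) = _
      rw [mul_zero]
      exact h0.symm)
  set G : ℝ → StripCover ℓ := fun t => Γ (projIcc 0 1 zero_le_one (t / T)) with hG
  have hGc : Continuous G := by
    refine Γ.continuous.comp (continuous_projIcc.comp ?_)
    fun_prop
  have hG0 : G 0 = StripCover.mk ℓ p := by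
    rw [← hΓ0, hG]
    simp
  have hlift : ∀ t ∈ Icc 0 T, γ t = stripMap S ℓ ((G t).fst, (G t).snd) := by
    intro t ht
    have ht' : t / T ∈ Icc (0 : ℝ) 1 :=
      ⟨div_nonneg ht.1 hT.le, (div_le_one hT).2 ht.2⟩
    have h1 := congrFun hΓ (projIcc 0 1 zero_le_one (t / T))
    simp only [Function.comp_apply, ContinuousMap.coe_mk, projIcc_of_mem zero_le_one ht'] at h1
    rw [mul_div_cancel₀ _ hT.ne'] at h1
    rw [stripMap, StripCover.mk_eta, ← h1, hG]
    simp only [projIcc_of_mem zero_le_one ht']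
  have hsm : ContDiffOn ℝ n (fun t => ((G t).fst, (G t).snd)) (Icc 0 T) := by
    intro t ht
    have h1 : ContDiffWithinAt ℝ n
        (fun s => (chartAt (EuclideanHalfSpace 2) (γ t)).extend (𝓡∂ 2) (γ s)) (Icc 0 T) t :=
      (contMDiffWithinAt_iff_target.1 (hγ t ht)).2.contDiffWithinAt
    rw [hlift t ht] at h1
    have htend : Tendsto (fun s => ((G s).fst, (G s).snd)) (𝓝[Icc 0 T] t)
        (𝓝[strip] ((G t).fst, (G t).snd)) := by
      refine tendsto_nhdsWithin_iff.2 ⟨?_, Eventually.of_forall fun s =>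
        fst_mem_strip _ (G s).snd_mem⟩
      exact (((StripCover.continuous_fst.comp hGc).prodMk
        (StripCover.continuous_snd.comp hGc)).tendsto t).mono_left nhdsWithin_le_nhds
    have h2 := htend.eventually
      (eventually_chartAt_extend (S := S) (ℓ := ℓ) ((G t).fst, (G t).snd))
    set ε := chartSign S ℓ ((G t).fst, (G t).snd)
    set k := chartShift S ℓ ((G t).fst, (G t).snd)
    have h3 := ((contDiff_stripPoint (n := n) ε).contDiffAt.comp_contDiffWithinAt t h1).sub
      (contDiffWithinAt_const (c := ((k, 0) : ℝ × ℝ)))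
    refine h3.congr_of_eventuallyEq_of_mem ?_ ht
    filter_upwards [h2, self_mem_nhdsWithin] with s hs hsm
    simp only [Function.comp_apply]
    rw [hlift s hsm, hs.2, stripPoint_stripCoord]
    simp
  refine ⟨fun t => (G t).fst, fun t => (G t).snd, hsm.fst, hsm.snd, ?_, ?_, fun t ht =>
    ⟨(G t).snd_mem, hlift t ht⟩⟩
  · simp only [hG0]; rfl
  · simp only [hG0]; exact StripCover.snd_mk (mem_strip.1 hp)

end QuotientSurface

/-! ### Geodesics of the quotient surfaces -/

namespace QuotientSurface

variable {S : StripSurface} {ℓ : ℝ} [hℓ : Fact (0 < ℓ)] {f : ℝ → ℝ}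

section Lift

variable {γ : ℝ → QuotientSurface S ℓ} {T : ℝ} {x y : ℝ → ℝ}
  (hlift : ∀ t ∈ Icc 0 T, y t ∈ Icc (0 : ℝ) 14 ∧ γ t = stripMap S ℓ (x t, y t))
include hlift

theorem velocity_eq_of_lift (hT : 0 < T) {t x' y' : ℝ} (ht : t ∈ Icc 0 T)
    (hx : HasDerivWithinAt x x' (Icc 0 T) t) (hy : HasDerivWithinAt y y' (Icc 0 T) t) :
    (velocity γ T t : EuclideanSpace ℝ (Fin 2)) =
      stripCoordL (chartSign S ℓ (x t, y t)) (x', y') := by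
  have h := mfderivWithin_eq_of_lift (uniqueDiffOn_Icc hT t ht) ht
    (hx.hasFDerivWithinAt.prodMk hy.hasFDerivWithinAt)
    (eventually_nhdsWithin_of_forall fun s hs => ⟨fst_mem_strip _ (hlift s hs).1, (hlift s hs).2⟩)
    (1 : ℝ)
  exact h.trans (congrArg (stripCoordL _) (Prod.ext (one_mul x') (one_mul y')))

theorem inner_velocity_of_lift (hf : IsWarp f) (hT : 0 < T) {t x' y' : ℝ} (ht : t ∈ Icc 0 T)
    (hx : HasDerivWithinAt x x' (Icc 0 T) t) (hy : HasDerivWithinAt y y' (Icc 0 T) t) :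
    (warpMetric S ℓ hf).inner (γ t) (velocity γ T t) (velocity γ T t) =
      f (y t) * x' ^ 2 + y' ^ 2 := by
  have h := velocity_eq_of_lift hlift hT ht hx hy
  have e : f (height (γ t)) = f (y t) := by
    rw [(hlift t ht).2, warp_height_stripMap hf (fst_mem_strip _ (hlift t ht).1)]
  change warpForm (f (height (γ t))) (velocity γ T t : EuclideanSpace ℝ (Fin 2))
    (velocity γ T t : EuclideanSpace ℝ (Fin 2)) = _
  rw [h, e, warpForm_stripCoordL]
  ring

/-- The coordinate representation of a curve in the preferred chart, with its first two derivatives,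
in terms of a lift. -/
theorem chart_derivs_of_lift (hT : 0 < T) (hx : ContDiffOn ℝ 2 x (Icc 0 T))
    (hy : ContDiffOn ℝ 2 y (Icc 0 T)) {t : ℝ} (ht : t ∈ Icc 0 T) : ∃ (ε : ℤˣ) (k : ℝ),
    let c : ℝ → EuclideanSpace ℝ (Fin 2) :=
      fun s => (chartAt (EuclideanHalfSpace 2) (γ t)).extend (𝓡∂ 2) (γ s)
    c t = stripCoord ε k (x t, y t) ∧
    derivWithin c (Icc 0 T) t =
      stripCoordL ε (derivWithin x (Icc 0 T) t, derivWithin y (Icc 0 T) t) ∧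
    derivWithin (derivWithin c (Icc 0 T)) (Icc 0 T) t =
      stripCoordL ε (derivWithin (derivWithin x (Icc 0 T)) (Icc 0 T) t,
        derivWithin (derivWithin y (Icc 0 T)) (Icc 0 T) t) := by
  obtain ⟨dx, ddx⟩ := hx.hasDerivWithinAt_two hT
  obtain ⟨dy, ddy⟩ := hy.hasDerivWithinAt_two hT
  have hu := uniqueDiffOn_Icc hT
  set ε := chartSign S ℓ (x t, y t)
  set k := chartShift S ℓ (x t, y t)
  refine ⟨ε, k, ?_⟩
  intro c
  have htend : Tendsto (fun s => (x s, y s)) (𝓝[Icc 0 T] t) (𝓝[strip] (x t, y t)) :=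
    tendsto_nhdsWithin_iff.2 ⟨(dx t ht).continuousWithinAt.prodMk (dy t ht).continuousWithinAt,
      eventually_nhdsWithin_of_forall fun s hs => fst_mem_strip _ (hlift s hs).1⟩
  have h0 : c =ᶠ[𝓝[Icc 0 T] t] fun s => stripCoord ε k (x s, y s) := by
    filter_upwards [htend.eventually (eventually_chartAt_extend (S := S) (ℓ := ℓ) (x t, y t)),
      self_mem_nhdsWithin] with s hs hs'
    simp only [c]
    rw [(hlift s hs').2, (hlift t ht).2]
    exact hs.2
  have h1 : derivWithin c (Icc 0 T) =ᶠ[𝓝[Icc 0 T] t]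
      fun s => stripCoordL ε (derivWithin x (Icc 0 T) s, derivWithin y (Icc 0 T) s) := by
    filter_upwards [eventually_eventually_nhdsWithin.2 h0, self_mem_nhdsWithin] with s hs hs'
    rw [EventuallyEq.derivWithin_eq hs (hs.self_of_nhdsWithin hs')]
    exact ((hasFDerivAt_stripCoord ε k (x s, y s)).comp_hasDerivWithinAt s
      ((dx s hs').prodMk (dy s hs'))).derivWithin (hu s hs')
  refine ⟨h0.self_of_nhdsWithin ht, h1.self_of_nhdsWithin ht, ?_⟩
  rw [h1.derivWithin_eq (h1.self_of_nhdsWithin ht)]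
  exact ((stripCoordL ε).hasFDerivAt.comp_hasDerivWithinAt t
    ((ddx t ht).prodMk (ddy t ht))).derivWithin (hu t ht)

theorem isUnitSpeedGeodesic_iff_of_lift (hf : IsWarp f) (hT : 0 < T)
    (hx : ContDiffOn ℝ 2 x (Icc 0 T)) (hy : ContDiffOn ℝ 2 y (Icc 0 T)) :
    IsUnitSpeedGeodesic (warpMetric S ℓ hf) γ T ↔ IsStripGeodesic f T x y := by
  obtain ⟨dx, -⟩ := hx.hasDerivWithinAt_two hT
  obtain ⟨dy, -⟩ := hy.hasDerivWithinAt_two hT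
  have hunit := fun t ht => inner_velocity_of_lift hlift hf hT ht (dx t ht) (dy t ht)
  have hgeo : ∀ t ∈ Icc 0 T, ∃ ε : ℤˣ, ∀ w : EuclideanSpace ℝ (Fin 2),
      let e := chartAt (EuclideanHalfSpace 2) (γ t)
      let c : ℝ → EuclideanSpace ℝ (Fin 2) := fun s => e.extend (𝓡∂ 2) (γ s)
      let c' := derivWithin c (Icc 0 T)
      coordMetric (warpMetric S ℓ hf) e (c t) (derivWithin c' (Icc 0 T) t) w +
        christoffelFirst (warpMetric S ℓ hf) e (c t) (c' t) (c' t) w =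
      (f (y t) * derivWithin (derivWithin x (Icc 0 T)) (Icc 0 T) t +
        deriv f (y t) * derivWithin y (Icc 0 T) t * derivWithin x (Icc 0 T) t) * w 1 +
      ((ε : ℤ) : ℝ) * (derivWithin (derivWithin y (Icc 0 T)) (Icc 0 T) t -
        deriv f (y t) * derivWithin x (Icc 0 T) t ^ 2 / 2) * w 0 := by
    intro t ht
    obtain ⟨ε, k, h0, h1, h2⟩ := chart_derivs_of_lift hlift hT hx hy ht
    refine ⟨ε, fun w => ?_⟩
    intro e c c'
    have hz : c t ∈ (e.extend (𝓡∂ 2)).target := mem_extChartAt_target (γ t)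
    have he := chart_mem_atlas (EuclideanHalfSpace 2) (γ t)
    rw [coordMetric_warpMetric hf he hz, christoffelFirst_warpMetric hf he hz]
    simp only [c', c, e, h0, h1, h2, stripCoord_apply_zero, stripCoordL_apply_zero,
      stripCoordL_apply_one, hf.comp_fiberFlip, hf.deriv_fiberFlip]
    linear_combination (deriv f (y t) * derivWithin y (Icc 0 T) t * derivWithin x (Icc 0 T) t *
      w 1) * units_mul_self_real ε
  constructor
  · rintro ⟨-, h⟩
    refine ⟨hx, hy, fun t ht => (hlift t ht).1, fun t ht => ?_, fun t ht => ?_, fun t ht => ?_⟩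
    · exact (hunit t ht).symm.trans (h t ht).1
    · obtain ⟨ε, hε⟩ := hgeo t ht
      have := (hε (EuclideanSpace.single 1 1)).symm.trans ((h t ht).2 _)
      simp at this
      linarith
    · obtain ⟨ε, hε⟩ := hgeo t ht
      have := (hε (EuclideanSpace.single 0 1)).symm.trans ((h t ht).2 _)
      simp at this
      linarith
  · intro h
    refine ⟨?_, fun t ht => ⟨(hunit t ht).trans (h.unit t ht), ?_⟩⟩
    · exact contMDiffOn_of_lift (n := 2) (hx.prodMk hy)
        fun t ht => ⟨fst_mem_strip _ (hlift t ht).1, (hlift t ht).2⟩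
    · intro e c c' c'' w
      obtain ⟨ε, hε⟩ := hgeo t ht
      refine (hε w).trans ?_
      have e1 := h.eq_fst t ht
      have e2 := h.eq_snd t ht
      rw [e2]
      linear_combination w 1 * e1

end Lift

end QuotientSurface

/-! ### The lens relation -/

theorem fiberFlip_zero_mem (ε : ℤˣ) : fiberFlip ε 0 ∈ Icc (0 : ℝ) 14 := fiberFlip_mem (by norm_num)

theorem exists_eq_fiberFlip_zero {y : ℝ} (hy : y = 0 ∨ y = 14) : ∃ ε : ℤˣ, y = fiberFlip ε 0 := by
  rcases hy with rfl | rfl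
  · exact ⟨1, by simp⟩
  · exact ⟨-1, by simp⟩

theorem fiberFlip_eq_zero_or_iff {ε : ℤˣ} {y : ℝ} :
    fiberFlip ε y = 0 ∨ fiberFlip ε y = 14 ↔ y = 0 ∨ y = 14 := by
  rcases Int.units_eq_one_or ε with rfl | rfl
  · simp
  · rw [fiberFlip_neg_one, or_comm]
    exact or_congr ⟨fun h => by linarith, fun h => by linarith⟩
      ⟨fun h => by linarith, fun h => by linarith⟩

theorem derivWithin_fiberFlip (ε : ℤˣ) (y : ℝ → ℝ) (s : Set ℝ) (t : ℝ) :
    derivWithin (fun t => fiberFlip ε (y t)) s t = ((ε : ℤ) : ℝ) * derivWithin y s t := by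
  rcases Int.units_eq_one_or ε with rfl | rfl
  · simp
  · simp [derivWithin_const_sub]

theorem IsStripGeodesic.fiberFlip {f : ℝ → ℝ} (hf : IsWarp f) {T : ℝ} {x y : ℝ → ℝ}
    (h : IsStripGeodesic f T x y) (ε : ℤˣ) :
    IsStripGeodesic f T x (fun t => fiberFlip ε (y t)) := by
  rcases Int.units_eq_one_or ε with rfl | rfl
  · simpa using h
  · simpa using h.reflect hf

namespace QuotientSurface

variable {S : StripSurface} {ℓ : ℝ} [hℓ : Fact (0 < ℓ)] {f : ℝ → ℝ}

theorem chartSign_boundary (x : ℝ) (ε : ℤˣ) : chartSign S ℓ (x, fiberFlip ε 0) = ε := by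
  rcases Int.units_eq_one_or ε with rfl | rfl
  · exact chartSign_of_snd_eq_zero (fiberFlip_one 0)
  · exact chartSign_of_snd_eq_top (by simp)

/-- A tangent vector of the quotient surface, given by its base point and its coordinates in the
preferred chart. -/
def tangentVector (m : QuotientSurface S ℓ) (u : EuclideanSpace ℝ (Fin 2)) :
    TangentBundle (𝓡∂ 2) (QuotientSurface S ℓ) :=
  ⟨m, u⟩

/-- Every element of the lens relation is given by a starting point on the boundary and the Clairaut
constant `c` of a crossing geodesic. -/
theorem lensRelation_subset (hf : IsWarp f)
    {q : TangentBundle (𝓡∂ 2) (QuotientSurface S ℓ) ×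
      TangentBundle (𝓡∂ 2) (QuotientSurface S ℓ) × ℝ}
    (hq : q ∈ lensRelation (warpMetric S ℓ hf)) : ∃ (x₀ c : ℝ) (ε : ℤˣ), c ^ 2 < 1 ∧
      q = (tangentVector (stripMap S ℓ (x₀, fiberFlip ε 0)) !₂[0, c],
        tangentVector (stripMap S ℓ (x₀ + crossShift f c, fiberFlip ε 14)) !₂[0, c],
        crossTime f c) := by
  obtain ⟨γ, T, u, v, rfl, hT, hgeo, b0, bT, -, hν, hu, hv⟩ := hq
  have m0 : (0 : ℝ) ∈ Icc 0 T := ⟨le_rfl, hT.le⟩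
  have mT : T ∈ Icc 0 T := ⟨hT.le, le_rfl⟩
  obtain ⟨⟨x₀, y₀⟩, hp, h0⟩ := exists_stripMap_eq (γ 0)
  rw [← h0, stripMap_mem_boundary_iff hp] at b0
  obtain ⟨ε, rfl⟩ := exists_eq_fiberFlip_zero b0
  obtain ⟨x, y, hx, hy, x0, y0, hlift⟩ := exists_lift (n := 2) hT hgeo.1 hp h0
  have h := (isUnitSpeedGeodesic_iff_of_lift hlift hf hT hx hy).1 hgeo
  obtain ⟨dx, -⟩ := hx.hasDerivWithinAt_two hT
  obtain ⟨dy, -⟩ := hy.hasDerivWithinAt_two hT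
  have v0 := velocity_eq_of_lift hlift hT m0 (dx 0 m0) (dy 0 m0)
  have vT := velocity_eq_of_lift hlift hT mT (dx T mT) (dy T mT)
  have hin : 0 < derivWithin (fun t => fiberFlip ε (y t)) (Icc 0 T) 0 := by
    have h1 := (exists_inwardUnitNormal_iff hf).1 hν
    rw [v0, stripCoordL_apply_zero, x0, y0, chartSign_boundary] at h1
    rwa [derivWithin_fiberFlip]
  have hend : fiberFlip ε (y T) = 0 ∨ fiberFlip ε (y T) = 14 := by
    rw [(hlift T mT).2, stripMap_mem_boundary_iff (fst_mem_strip _ (hlift T mT).1)] at bT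
    exact fiberFlip_eq_zero_or_iff.2 bT
  obtain ⟨hc, hyT, hTc, hxT, hx'T⟩ := (h.fiberFlip hf ε).cross hf hT
    (by rw [y0, fiberFlip_fiberFlip]) hin hend
  have hyT' : y T = fiberFlip ε 14 := by rw [← hyT, fiberFlip_fiberFlip]
  set c := derivWithin x (Icc 0 T) 0
  have hu' := (isBoundaryProjection_iff hf).1 hu
  have hv' := (isBoundaryProjection_iff hf).1 hv
  rw [v0, stripCoordL_apply_one] at hu'
  rw [vT, stripCoordL_apply_one, hx'T] at hv'
  refine ⟨x₀, c, ε, hc, ?_⟩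
  have e0 : tangentVector (γ 0) u =
      tangentVector (stripMap S ℓ (x₀, fiberFlip ε 0)) !₂[0, c] := by rw [h0, hu']
  have eT : tangentVector (γ T) v =
      tangentVector (stripMap S ℓ (x₀ + crossShift f c, fiberFlip ε 14)) !₂[0, c] := by
    rw [(hlift T mT).2, hv', hxT, hyT', x0]
  exact Prod.ext e0 (Prod.ext eT hTc)

/-- Every starting point on the boundary and every constant `c` with `c² < 1` are realized by a
crossing geodesic. -/
theorem mem_lensRelation (hf : IsWarp f) {c : ℝ} (hc : c ^ 2 < 1) (x₀ : ℝ) (ε : ℤˣ) :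
    (tangentVector (stripMap S ℓ (x₀, fiberFlip ε 0)) !₂[0, c],
      tangentVector (stripMap S ℓ (x₀ + crossShift f c, fiberFlip ε 14)) !₂[0, c],
      crossTime f c) ∈ lensRelation (warpMetric S ℓ hf) := by
  have hT := crossTime_pos hf.smooth.continuous hc
  obtain ⟨x, y, h, x0, xT, y0, yT, hint, hin, hx'⟩ := hf.exists_stripGeodesic hc x₀
  have hx'T := (h.cross hf hT y0 hin (Or.inr yT)).2.2.2.2
  set T := crossTime f c
  have m0 : (0 : ℝ) ∈ Icc 0 T := ⟨le_rfl, hT.le⟩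
  have mT : T ∈ Icc 0 T := ⟨hT.le, le_rfl⟩
  have h' := h.fiberFlip hf ε
  set γ : ℝ → QuotientSurface S ℓ := fun t => stripMap S ℓ (x t, fiberFlip ε (y t))
  have hlift : ∀ t ∈ Icc 0 T, fiberFlip ε (y t) ∈ Icc (0 : ℝ) 14 ∧
      γ t = stripMap S ℓ (x t, fiberFlip ε (y t)) := fun t ht => ⟨h'.mem t ht, rfl⟩
  obtain ⟨dx, -⟩ := h'.smooth_fst.hasDerivWithinAt_two hT
  obtain ⟨dy, -⟩ := h'.smooth_snd.hasDerivWithinAt_two hT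
  have v0 := velocity_eq_of_lift hlift hT m0 (dx 0 m0) (dy 0 m0)
  have vT := velocity_eq_of_lift hlift hT mT (dx T mT) (dy T mT)
  have hb : ∀ t ∈ Icc 0 T, γ t ∈ (𝓡∂ 2).boundary (QuotientSurface S ℓ) ↔ y t = 0 ∨ y t = 14 :=
    fun t ht => (stripMap_mem_boundary_iff (fst_mem_strip _ (hlift t ht).1)).trans
      fiberFlip_eq_zero_or_iff
  have e0 : γ 0 = stripMap S ℓ (x₀, fiberFlip ε 0) := by simp only [γ, x0, y0]
  have eT : γ T = stripMap S ℓ (x₀ + crossShift f c, fiberFlip ε 14) := by simp only [γ, xT, yT]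
  rw [← e0, ← eT]
  refine ⟨γ, T, !₂[0, c], !₂[0, c], rfl, hT,
    (isUnitSpeedGeodesic_iff_of_lift hlift hf hT h'.smooth_fst h'.smooth_snd).2 h',
    (hb 0 m0).2 (Or.inl y0), (hb T mT).2 (Or.inr yT), fun t ht hbt => ?_,
    (exists_inwardUnitNormal_iff hf).2 ?_, (isBoundaryProjection_iff hf).2 ?_,
    (isBoundaryProjection_iff hf).2 ?_⟩
  · have h1 := hint t ht
    rcases (hb t (Ioo_subset_Icc_self ht)).1 hbt with h2 | h2
    · exact h1.1.ne' h2
    · exact h1.2.ne h2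
  · rw [v0, stripCoordL_apply_zero, y0, chartSign_boundary, derivWithin_fiberFlip, ← mul_assoc,
      units_mul_self_real, one_mul]
    exact hin
  · rw [v0, stripCoordL_apply_one, hx']
  · rw [vT, stripCoordL_apply_one, hx'T, hx']

theorem lensRelation_warpMetric_subset {f' : ℝ → ℝ} (hf : IsWarp f) (hf' : IsWarp f')
    (ht : ∀ c : ℝ, c ^ 2 < 1 → crossTime f c = crossTime f' c)
    (hs : ∀ c : ℝ, c ^ 2 < 1 → crossShift f c = crossShift f' c) :
    lensRelation (warpMetric S ℓ hf) ⊆ lensRelation (warpMetric S ℓ hf') := by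
  intro q hq
  obtain ⟨x₀, c, ε, hc, rfl⟩ := lensRelation_subset hf hq
  rw [ht c hc, hs c hc]
  exact mem_lensRelation hf' hc x₀ ε

end QuotientSurface

/-! ### Distances between boundary points -/

/-- The length on `[0, T]` of the curve `(x, y)` in the strip with the metric `f(y) dx² + dy²`. -/
def stripLength (f : ℝ → ℝ) (T : ℝ) (x y : ℝ → ℝ) : ℝ :=
  ∫ t in (0 : ℝ)..T, √(f (y t) * derivWithin x (Icc 0 T) t ^ 2 + derivWithin y (Icc 0 T) t ^ 2)

theorem stripLength_fiberFlip {f : ℝ → ℝ} (hf : IsWarp f) (T : ℝ) (x y : ℝ → ℝ) (ε : ℤˣ) :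
    stripLength f T x (fun t => fiberFlip ε (y t)) = stripLength f T x y := by
  simp only [stripLength, hf.comp_fiberFlip, derivWithin_fiberFlip, mul_pow, sq ((ε : ℤ) : ℝ),
    units_mul_self_real, one_mul]

theorem IsStripGeodesic.stripLength_eq {f : ℝ → ℝ} {T : ℝ} (hT : 0 < T) {x y : ℝ → ℝ}
    (h : IsStripGeodesic f T x y) : stripLength f T x y = T := by
  rw [stripLength, intervalIntegral.integral_congr (g := fun _ => 1)]
  · simp
  · intro t ht
    rw [uIcc_of_le hT.le] at ht
    simp only [h.unit t ht, Real.sqrt_one]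

theorem enorm_eq_sqrt_inner {n : ℕ} [NeZero n] {M : Type*} [TopologicalSpace M]
    [ChartedSpace (EuclideanHalfSpace n) M] [IsManifold (𝓡∂ n) ∞ M] (g : SmoothMetric n M)
    (m : M) (v : TangentSpace (𝓡∂ n) m) :
    letI : RiemannianBundle (fun x : M => TangentSpace (𝓡∂ n) x) := ⟨g.toRiemannianMetric⟩
    ‖v‖ₑ = ENNReal.ofReal √(g.inner m v v) := by
  let _ : RiemannianBundle (fun x : M => TangentSpace (𝓡∂ n) x) := ⟨g.toRiemannianMetric⟩
  rw [← ofReal_norm, norm_eq_sqrt_real_inner]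
  rfl

namespace QuotientSurface

variable {S : StripSurface} {ℓ : ℝ} [hℓ : Fact (0 < ℓ)] {f : ℝ → ℝ}

theorem pathELength_of_lift (hf : IsWarp f) {γ : ℝ → QuotientSurface S ℓ} {T : ℝ} (hT : 0 < T)
    {x y : ℝ → ℝ} (hx : ContDiffOn ℝ 1 x (Icc 0 T)) (hy : ContDiffOn ℝ 1 y (Icc 0 T))
    (hlift : ∀ t ∈ Icc 0 T, y t ∈ Icc (0 : ℝ) 14 ∧ γ t = stripMap S ℓ (x t, y t)) :
    letI : RiemannianBundle (fun m : QuotientSurface S ℓ => TangentSpace (𝓡∂ 2) m) :=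
      ⟨(warpMetric S ℓ hf).toRiemannianMetric⟩
    pathELength (𝓡∂ 2) γ 0 T = ENNReal.ofReal (stripLength f T x y) := by
  let _ : RiemannianBundle (fun m : QuotientSurface S ℓ => TangentSpace (𝓡∂ 2) m) :=
    ⟨(warpMetric S ℓ hf).toRiemannianMetric⟩
  have hu := uniqueDiffOn_Icc hT
  have cx := hx.continuousOn_derivWithin hu (by norm_num)
  have cy := hy.continuousOn_derivWithin hu (by norm_num)
  have hc : ContinuousOn (fun t => √(f (y t) * derivWithin x (Icc 0 T) t ^ 2 +
      derivWithin y (Icc 0 T) t ^ 2)) (Icc 0 T) :=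
    (((hf.smooth.continuous.comp_continuousOn hy.continuousOn).mul (cx.pow 2)).add
      (cy.pow 2)).sqrt
  rw [pathELength_eq_lintegral_mfderivWithin_Icc, stripLength,
    intervalIntegral.integral_of_le hT.le, ← MeasureTheory.integral_Icc_eq_integral_Ioc,
    MeasureTheory.ofReal_integral_eq_lintegral_ofReal hc.integrableOn_Icc
      (Eventually.of_forall fun t => Real.sqrt_nonneg _)]
  refine MeasureTheory.setLIntegral_congr_fun measurableSet_Icc fun t ht => ?_
  refine (enorm_eq_sqrt_inner (warpMetric S ℓ hf) (γ t) (velocity γ T t)).trans ?_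
  rw [inner_velocity_of_lift hlift hf hT ht
    (hx.differentiableOn (by norm_num) t ht).hasDerivWithinAt
    (hy.differentiableOn (by norm_num) t ht).hasDerivWithinAt]

theorem metricDist_le_stripLength (hf : IsWarp f) {T : ℝ} (hT : 0 < T)
    {x y : ℝ → ℝ} (hx : ContDiffOn ℝ 1 x (Icc 0 T)) (hy : ContDiffOn ℝ 1 y (Icc 0 T))
    (hmem : ∀ t ∈ Icc 0 T, y t ∈ Icc (0 : ℝ) 14) :
    metricDist (warpMetric S ℓ hf) (stripMap S ℓ (x 0, y 0)) (stripMap S ℓ (x T, y T)) ≤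
      ENNReal.ofReal (stripLength f T x y) := by
  let _ : RiemannianBundle (fun m : QuotientSurface S ℓ => TangentSpace (𝓡∂ 2) m) :=
    ⟨(warpMetric S ℓ hf).toRiemannianMetric⟩
  rw [← pathELength_of_lift (γ := fun t => stripMap S ℓ (x t, y t)) hf hT hx hy
    fun t ht => ⟨hmem t ht, rfl⟩]
  refine riemannianEDist_le_pathELength ?_ rfl rfl hT.le
  exact contMDiffOn_of_lift (n := 1) (hx.prodMk hy) fun t ht => ⟨fst_mem_strip _ (hmem t ht), rfl⟩

theorem exists_stripLength_lt (hf : IsWarp f) {p : ℝ × ℝ} (hp : p ∈ strip)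
    {m : QuotientSurface S ℓ} {r : ℝ≥0∞}
    (hr : metricDist (warpMetric S ℓ hf) (stripMap S ℓ p) m < r) : ∃ x y : ℝ → ℝ,
      ContDiffOn ℝ 1 x (Icc 0 1) ∧ ContDiffOn ℝ 1 y (Icc 0 1) ∧
      (∀ t ∈ Icc (0 : ℝ) 1, y t ∈ Icc (0 : ℝ) 14) ∧ x 0 = p.1 ∧ y 0 = p.2 ∧
      stripMap S ℓ (x 1, y 1) = m ∧ ENNReal.ofReal (stripLength f 1 x y) < r := by
  let _ : RiemannianBundle (fun m : QuotientSurface S ℓ => TangentSpace (𝓡∂ 2) m) :=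
    ⟨(warpMetric S ℓ hf).toRiemannianMetric⟩
  obtain ⟨γ, h0, h1, hγ, hlt⟩ := exists_lt_of_riemannianEDist_lt hr
  obtain ⟨x, y, hx, hy, x0, y0, hlift⟩ := exists_lift (n := 1) one_pos hγ hp h0.symm
  refine ⟨x, y, hx, hy, fun t ht => (hlift t ht).1, x0, y0, ?_, ?_⟩
  · rw [← (hlift 1 ⟨zero_le_one, le_rfl⟩).2, h1]
  · rwa [← pathELength_of_lift hf one_pos hx hy hlift]

/-- Boundary points on the same line are at most as far apart as along the boundary. -/
theorem metricDist_same_side_le (hf : IsWarp f) (x₀ x₁ : ℝ) (ε : ℤˣ) :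
    metricDist (warpMetric S ℓ hf) (stripMap S ℓ (x₀, fiberFlip ε 0))
      (stripMap S ℓ (x₁, fiberFlip ε 0)) ≤ ENNReal.ofReal |x₁ - x₀| := by
  have hx : ContDiffOn ℝ 1 (fun t : ℝ => x₀ + t * (x₁ - x₀)) (Icc 0 1) := by fun_prop
  have h := metricDist_le_stripLength (S := S) (ℓ := ℓ) hf one_pos hx
    (contDiffOn_const (c := fiberFlip ε 0)) fun t _ => fiberFlip_zero_mem ε
  have e : stripLength f 1 (fun t : ℝ => x₀ + t * (x₁ - x₀)) (fun _ => fiberFlip ε 0) =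
      |x₁ - x₀| := by
    rw [stripLength, intervalIntegral.integral_congr (g := fun _ => |x₁ - x₀|)]
    · simp
    · intro t ht
      rw [uIcc_of_le zero_le_one] at ht
      have hd : derivWithin (fun t : ℝ => x₀ + t * (x₁ - x₀)) (Icc 0 1) t = x₁ - x₀ := by
        have h1 : HasDerivAt (fun t : ℝ => x₀ + t * (x₁ - x₀)) (1 * (x₁ - x₀)) t :=
          ((hasDerivAt_id t).mul_const _).const_add _
        rw [h1.hasDerivWithinAt.derivWithin (uniqueDiffOn_Icc one_pos t ht), one_mul]
      simp only [hd, hf.comp_fiberFlip, hf.zero, derivWithin_fun_const, Pi.zero_apply]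
      rw [one_mul, zero_pow two_ne_zero, add_zero, Real.sqrt_sq_eq_abs]
  rw [e] at h
  simpa using h

/-- Boundary points on different lines are at most as far apart as along the crossing geodesic. -/
theorem metricDist_crossing_le (hf : IsWarp f) {c : ℝ} (hc : c ^ 2 < 1) (x₀ : ℝ) (ε : ℤˣ) :
    metricDist (warpMetric S ℓ hf) (stripMap S ℓ (x₀, fiberFlip ε 0))
      (stripMap S ℓ (x₀ + crossShift f c, fiberFlip ε 14)) ≤ ENNReal.ofReal (crossTime f c) := by
  have hT := crossTime_pos hf.smooth.continuous hc
  obtain ⟨x, y, h, x0, xT, y0, yT, -⟩ := hf.exists_stripGeodesic hc x₀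
  have h' := h.fiberFlip hf ε
  have key := metricDist_le_stripLength (S := S) (ℓ := ℓ) hf hT
    (h'.smooth_fst.of_le (by norm_num)) (h'.smooth_snd.of_le (by norm_num)) h'.mem
  rwa [h'.stripLength_eq hT, x0, xT, y0, yT] at key

/-- Both metrics give boundary points the distance `|x₁ - x₀|` if these are on the same line, and the
crossing time for the displacement `x₁ - x₀` otherwise; the lower bound is used for `f`, the upper
bound for `f'`. -/
theorem metricDist_warpMetric_le {f' : ℝ → ℝ} (hf : IsWarp f) (hf' : IsWarp f')
    (ht : ∀ c : ℝ, c ^ 2 < 1 → crossTime f c = crossTime f' c)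
    (hs : ∀ c : ℝ, c ^ 2 < 1 → crossShift f c = crossShift f' c)
    {m m' : QuotientSurface S ℓ} (hm : m ∈ (𝓡∂ 2).boundary (QuotientSurface S ℓ))
    (hm' : m' ∈ (𝓡∂ 2).boundary (QuotientSurface S ℓ)) :
    metricDist (warpMetric S ℓ hf') m m' ≤ metricDist (warpMetric S ℓ hf) m m' := by
  refine le_of_forall_gt fun r hr => ?_
  obtain ⟨⟨x₀, y₀⟩, hp, rfl⟩ := exists_stripMap_eq m
  rw [stripMap_mem_boundary_iff hp] at hm
  obtain ⟨ε, rfl⟩ := exists_eq_fiberFlip_zero hm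
  obtain ⟨x, y, hx, hy, hmem, x0, y0, rfl, hlt⟩ := exists_stripLength_lt hf hp hr
  rw [stripMap_mem_boundary_iff (fst_mem_strip _ (hmem 1 ⟨zero_le_one, le_rfl⟩)),
    ← fiberFlip_eq_zero_or_iff (ε := ε)] at hm'
  refine lt_of_le_of_lt ?_ hlt
  have hy' : ContDiffOn ℝ 1 (fun t => fiberFlip ε (y t)) (Icc 0 1) := by
    unfold fiberFlip; fun_prop
  have hmem' : ∀ t ∈ Icc (0 : ℝ) 1, fiberFlip ε (y t) ∈ Icc (0 : ℝ) 14 :=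
    fun t ht => fiberFlip_mem (hmem t ht)
  rw [← stripLength_fiberFlip hf 1 x y ε]
  have hx0 : x 0 = x₀ := x0
  rcases hm' with h1 | h1
  · have e1 : y 1 = fiberFlip ε 0 := by rw [← h1, fiberFlip_fiberFlip]
    rw [e1, ← hx0]
    exact (metricDist_same_side_le hf' _ _ ε).trans
      (ENNReal.ofReal_le_ofReal (abs_sub_le_integral hf hx hy' hmem'))
  · have e1 : y 1 = fiberFlip ε 14 := by rw [← h1, fiberFlip_fiberFlip]
    obtain ⟨c, hc, hshift⟩ := hf.exists_crossShift_eq (x 1 - x 0)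
    have e2 : x 1 = x 0 + crossShift f c := by rw [hshift]; ring
    have key := metricDist_crossing_le (S := S) (ℓ := ℓ) hf' hc (x 0) ε
    rw [← hs c hc, ← ht c hc, ← e2, ← e1, hx0] at key
    refine key.trans (ENNReal.ofReal_le_ofReal ?_)
    exact crossTime_le_integral hf hc hx hy' hmem'
      (by rw [y0, fiberFlip_fiberFlip]) h1 e2

/-- The lens data depend on the warping function only through the crossing times and the
displacements. -/
theorem lensEquivalent_warpMetric {f' : ℝ → ℝ} (hf : IsWarp f) (hf' : IsWarp f')
    (ht : ∀ c : ℝ, c ^ 2 < 1 → crossTime f c = crossTime f' c)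
    (hs : ∀ c : ℝ, c ^ 2 < 1 → crossShift f c = crossShift f' c) :
    LensEquivalent (warpMetric S ℓ hf) (warpMetric S ℓ hf') := by
  have ht' : ∀ c : ℝ, c ^ 2 < 1 → crossTime f' c = crossTime f c := fun c hc => (ht c hc).symm
  have hs' : ∀ c : ℝ, c ^ 2 < 1 → crossShift f' c = crossShift f c := fun c hc => (hs c hc).symm
  exact ⟨sameBoundary_warpMetric hf hf',
    (lensRelation_warpMetric_subset hf hf' ht hs).antisymm
      (lensRelation_warpMetric_subset hf' hf ht' hs'),
    fun m hm m' hm' => (metricDist_warpMetric_le hf' hf ht' hs' hm hm').antisymm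
      (metricDist_warpMetric_le hf hf' ht hs hm hm')⟩

end QuotientSurface

end

theorem mainTheorem5 :
    (∃ f₁ : ℝ → ℝ, IsProfile f₁) ∧
    ∀ f₁ : ℝ → ℝ, IsProfile f₁ → ∃ f₂ : ℝ → ℝ,
      IsCentralLineup f₁ f₂ ∧
      (∀ f : ℝ → ℝ, IsCentralLineup f₁ f → EqOn f f₂ (Icc 0 14)) ∧
      ContDiffOn ℝ ∞ f₂ (Icc 0 14) ∧
      ∀ (S : StripSurface) (ℓ : ℝ), 0 < ℓ →
        ∃ (M : Type) (_ : TopologicalSpace M) (_ : T2Space M) (_ : SecondCountableTopology M)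
          (_ : ConnectedSpace M) (_ : ChartedSpace (EuclideanHalfSpace 2) M)
          (_ : IsManifold (𝓡∂ 2) ∞ M) (ψ : ℝ × ℝ → M) (g₁ g₂ : SmoothMetric 2 M),
          (S ≠ StripSurface.strip → CompactSpace M) ∧
          (S = StripSurface.moebius → IsConnected ((𝓡∂ 2).boundary M)) ∧
          IsStripQuotient (S.rel ℓ) ψ ∧ IsWarpedMetric f₁ ψ g₁ ∧ IsWarpedMetric f₂ ψ g₂ ∧
          LensEquivalent g₁ g₂ ∧
          (∀ x ∈ (𝓡∂ 2).boundary M, IsStrictlyConcaveAt g₁ x) ∧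
          (∀ x ∈ (𝓡∂ 2).boundary M, IsTotallyGeodesicAt g₂ x) ∧
          (∀ x ∈ (𝓡∂ 2).boundary M, ¬ SameC1JetAt g₁ g₂ x) := by
  refine ⟨?_, fun f₁ hf₁ => ?_⟩
  · obtain ⟨P, hP⟩ := exists_isHalfProfile
    exact ⟨mirror P, hP.isProfile_mirror⟩
  obtain ⟨P, hP, hfP⟩ := hf₁.exists_isHalfProfile
  obtain ⟨Q, X, σ, hQ⟩ := hP.exists_isHalfLineup
  have hfP6 : EqOn f₁ P (Icc 0 6) := fun x hx => by
    rw [hfP ⟨hx.1, by linarith [hx.2]⟩, mirror_of_le hP.flat (by linarith [hx.2])]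
  have hlineup := hQ.isCentralLineup hP hfP6
  have hQ1 : ∀ x ∈ Ico (0 : ℝ) 3, 1 ≤ mirror Q x := fun x hx => by
    rw [mirror_of_le hQ.flat (by linarith [hx.2])]
    exact hQ.one_le hP x
  have hwP := hP.isWarp
  have hwQ := hQ.isWarp hP
  refine ⟨mirror Q, hlineup, fun f hf => hf.eqOn hlineup hQ1,
    hwQ.smooth.contDiffOn, fun S ℓ hℓ => ?_⟩
  have : Fact (0 < ℓ) := ⟨hℓ⟩
  refine ⟨QuotientSurface S ℓ, inferInstance, inferInstance, inferInstance, inferInstance,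
    inferInstance, inferInstance, QuotientSurface.stripMap S ℓ,
    QuotientSurface.warpMetric S ℓ hwP, QuotientSurface.warpMetric S ℓ hwQ,
    QuotientSurface.compactSpace hℓ, ?_, QuotientSurface.isStripQuotient_stripMap, ?_,
    QuotientSurface.isWarpedMetric_warpMetric hwQ, ?_, fun x hx => ?_, fun x hx => ?_,
    fun x hx => ?_⟩
  · rintro rfl
    exact QuotientSurface.isConnected_boundary_moebius
  · intro p hp v w
    rw [hfP (mem_strip.1 hp)]
    exact QuotientSurface.isWarpedMetric_warpMetric hwP p hp v w
  · exact QuotientSurface.lensEquivalent_warpMetric hwP hwQ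
      (fun c hc => (hQ.crossTime_eq hP hc).symm) (fun c hc => (hQ.crossShift_eq hP hc).symm)
  · exact QuotientSurface.isStrictlyConcaveAt_warpMetric hwP
      (by rw [hP.deriv_mirror]; exact one_pos) hx
  · exact QuotientSurface.isTotallyGeodesicAt_warpMetric hwQ hQ.deriv_mirror hx
  · exact QuotientSurface.not_sameC1JetAt_warpMetric hwP hwQ
      (by rw [hP.deriv_mirror, hQ.deriv_mirror]; exact one_ne_zero) hx
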